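/- **Model.** Let $\lambda\in(0,\infty]$. A configuration is a map $\eta:\mathbb Z\to\mathbb N\cup\{s\}$, where $\eta(x)=k\in\mathbb N$ means $k$ active particles at $x$ and $\eta(x)=s$ means one sleeping particle at $x$; put $|s|=1$, $|k|=k$. To each $x\in\mathbb Z$ attach an infinite stack of instructions; all instructions are independent, and for $\lambda<\infty$ each of them is "sleep" with probability $\lambda/(1+\lambda)$, "step left" with probability $1/(2(1+\lambda))$ and "step right" with probability $1/(2(1+\lambda))$. If $\eta(x)\ge 1$ is an active site, it may be fired: the first unused instruction of its stack is applied. A step instruction moves one active particle from $x$ to the neighbouring site (waking up a particle sleeping there); a sleep instruction turns the particle at $x$ into a sleeping one if it is alone at $x$ and has no effect otherwise. For $\lambda=\infty$ (Internal DLA), instructions are "step left" or "step right" with probability $1/2$ each, and a site may be fired if it holds at least two particles. A finite sequence of firings is legal if each firing is allowed when it is performed, and it stabilizes $\eta$ if at its end no site may be fired. The odometer $u(x)\in\mathbb N\cup\{\infty\}$ of $\eta$ is the number of firings at $x$ needed to stabilize $\eta$, i.e. the supremum over finite legal sequences of the number of firings at $x$. For a finite interval $I\subset\mathbb Z$, stabilization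 with killing upon exiting $I$ is the same procedure in which only sites of $I$ are fired and particles that step out of $I$ are removed; let $|\mathcal S_I(\mathbf 1_I)|$ be the number of particles that remain when one starts with one active particle at each site of $I$. **Densities.** For $\zeta\in(0,1)$ let $w$ be the odometer of a configuration with one active particle at each site $x\in\mathbb Z$ independently with probability $\zeta$, and none otherwise, independent of the stacks, and set $$\zeta_{out}=\sup\{\zeta\in(0,1):\ \mathbf E_\zeta[w(0)^3]<\infty\}$$ (with $\sup\emptyset=0$). For a finite interval $I\subset\mathbb Z$ set $$\zeta_{in,I}=\inf\{\zeta>0:\ \mathbb P(|\mathcal S_I(\mathbf 1_I)|>\zeta\,\#I)\le(\#I)^{-20}\},\qquad \zeta_{in}=\limsup_{\#I\to\infty}\zeta_{in,I}.$$ **Theorem.** Let $\lambda\in(0,\infty]$ and assume $\min\{\zeta_{in},\zeta_{out}\}>0$. For each $n$ start $n$ active particles at the origin of $\mathbb Z$, and let $A_n$ be the set of sites that fire at least once during the stabilization (the sites with positive odometer). The stacks used for different $n$ may be the same or, more generally, have any joint law for which the stacks used for each single $n$ have the law above. Then for every $\varepsilon>0$, almost surely, for all large $n$, $$\#A_n\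 \ge\ \frac{n}{\zeta_{in}}(1-\varepsilon)\qquad\text{and}\qquad A_n\subseteq\Big[-\frac{n}{2\zeta_{out}}(1+\varepsilon),\ \frac{n}{2\zeta_{out}}(1+\varepsilon)\Big].$$ -/

import Mathlib

open MeasureTheory ProbabilityTheory Filter
open scoped ENNReal

noncomputable section

namespace ARW

/-! ### Configurations -/

/-- The set `ℕ ∪ {s}` of possible states of a site: `num k` means `k` active particles
(`num 0` is the empty site) and `s` means one sleeping particle. -/
inductive NatS
  | s : NatS
  | num (k : ℕ) : NatS

/-- The number of particles at a site, regardless of their state (`|s| = 1`). -/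
def NatS.size : NatS → ℕ
  | .s => 1
  | .num k => k

/-- The effect of an active particle stepping onto the site: a sleeping particle wakes up. -/
def NatS.arrive : NatS → NatS
  | .s => .num 2
  | .num k => .num (k + 1)

/-- The effect of an active particle leaving the site. -/
def NatS.leave : NatS → NatS
  | .s => .s
  | .num k => .num (k - 1)

/-- The effect of a sleep instruction: an active particle falls asleep if it is alone,
otherwise nothing happens. -/
def NatS.trySleep : NatS → NatS
  | .num 1 => .s
  | c => c

/-- Particle configurations on `ℤ`. -/
abbrev Config : Type := ℤ → NatS

open Classical in
/-- The configuration `1_I`: one active particle at each site of `I`, no other particle. -/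
def ones (I : Set ℤ) : Config := fun x => if x ∈ I then .num 1 else .num 0

/-- The configuration `n δ₀`: `n` active particles at the origin, no other particle. -/
def pile (n : ℕ) : Config := fun x => if x = 0 then .num n else .num 0

/-! ### Stacks of instructions and firings -/

/-- Instructions: fall asleep if alone, step left, step right. -/
inductive Instr
  | sleep : Instr
  | left : Instr
  | right : Instr

instance : MeasurableSpace Instr := ⊤

/-- A realization of all stacks; `ρ (x, k)` is the instruction number `k + 1` at the site `x`. -/
abbrev Stacks : Type := ℤ × ℕ → Instr

open Classical in
/-- One active particle steps from `x` to `y`; it is killed if `y` is not in the domain `D`. -/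
def step (D : Set ℤ) (x y : ℤ) (η : Config) : Config :=
  let η' := Function.update η x (η x).leave
  if y ∈ D then Function.update η' y (η' y).arrive else η'

/-- Execution at the site `x` of a given instruction, with killing upon exiting `D`. -/
def execute (D : Set ℤ) (x : ℤ) (η : Config) : Instr → Config
  | .sleep => Function.update η x (η x).trySleep
  | .left => step D x (x - 1) η
  | .right => step D x (x + 1) η

/-- The current configuration, with the number of instructions already used at each site. -/
structure State where
  config : Config
  used : ℤ → ℕ

/-- The initial state: no instruction has been used. -/
def State.init (η : Config) : State := ⟨η, 0⟩

/-- Firing `x`: the first unused instruction of the stack at `x` is applied. -/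
def fire (D : Set ℤ) (ρ : Stacks) (S : State) (x : ℤ) : State :=
  ⟨execute D x S.config (ρ (x, S.used x)), Function.update S.used x (S.used x + 1)⟩

/-- Firing the sites of a finite sequence one after the other, from the first to the last. -/
def fireSeq (D : Set ℤ) (ρ : Stacks) (S : State) (α : List ℤ) : State :=
  α.foldl (fire D ρ) S

/-- A site can be fired, with sleep rate `lam`, if it holds at least one active particle. The case
`lam = ∞` is Internal DLA: particles alone at their site stay there, and a site can be fired if it
holds at least two active particles. -/
def Unstable (lam : ℝ≥0∞) : NatS → Prop
  | .s => False
  | .num k => if lam = ∞ then 2 ≤ k else 1 ≤ k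

/-- Legal sequences of firings of sites of `D`. -/
def Legal (lam : ℝ≥0∞) (D : Set ℤ) (ρ : Stacks) : State → List ℤ → Prop
  | _, [] => True
  | S, x :: α => x ∈ D ∧ Unstable lam (S.config x) ∧ Legal lam D ρ (fire D ρ S x) α

/-- The sequence `α` is legal for `η` and leads to a configuration that is stable in `D`. -/
def Stabilizes (lam : ℝ≥0∞) (D : Set ℤ) (ρ : Stacks) (η : Config) (α : List ℤ) : Prop :=
  Legal lam D ρ (State.init η) α ∧
    ∀ x ∈ D, ¬ Unstable lam ((fireSeq D ρ (State.init η) α).config x)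

open Classical in
/-- The stabilization of `η` in `D`, with killing upon exiting `D`: the final configuration of
a finite legal stabilizing sequence (which does not depend on the choice of that sequence; the
value is `η` if there is none). -/
def stabilization (lam : ℝ≥0∞) (D : Set ℤ) (ρ : Stacks) (η : Config) : Config :=
  if h : ∃ α, Stabilizes lam D ρ η α then (fireSeq D ρ (State.init η) h.choose).config else η

/-- The odometer of `η` on `ℤ`: the number of firings at `x` needed to stabilize `η`, that is, the
supremum over all finite legal sequences of the number of firings at `x`. When a finite
legal stabilizing sequence exists, this is the number of times that sequence fires `x`. -/
def odometer (lam : ℝ≥0∞) (ρ : Stacks) (η : Config) (x : ℤ) : ℕ∞ :=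
  ⨆ (α : List ℤ) (_ : Legal lam Set.univ ρ (State.init η) α), (α.count x : ℕ∞)

/-- The set of sites that fire at least once during the stabilization of `n δ₀` on `ℤ`. -/
def firedSites (lam : ℝ≥0∞) (ρ : Stacks) (n : ℕ) : Set ℤ :=
  {x | 0 < odometer lam ρ (pile n) x}

/-! ### The law of the stacks -/

/-- The probability of each instruction: `lam / (1 + lam)` for sleep and `1 / (2 (1 + lam))` for
each step if `lam` is finite. For Internal DLA (`lam = ∞`) only steps are used. -/
def instrWeight (lam : ℝ≥0∞) : Instr → ℝ≥0∞
  | .sleep => if lam = ∞ then 0 else lam / (1 + lam)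
  | .left => if lam = ∞ then 1 / 2 else 1 / (2 * (1 + lam))
  | .right => if lam = ∞ then 1 / 2 else 1 / (2 * (1 + lam))

/-- The law of one instruction. -/
def instrLaw (lam : ℝ≥0∞) : Measure Instr :=
  instrWeight lam .sleep • Measure.dirac .sleep + instrWeight lam .left • Measure.dirac .left
    + instrWeight lam .right • Measure.dirac .right

theorem half_add_half_inv (a : ℝ≥0∞) : 1 / (2 * a) + 1 / (2 * a) = 1 / a := by
  rw [one_div, one_div, ENNReal.mul_inv (by simp) (by simp), ← add_mul, ENNReal.inv_two_add_inv_two,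
    one_mul]

instance (lam : ℝ≥0∞) : IsProbabilityMeasure (instrLaw lam) := by
  constructor
  by_cases h : lam = ∞
  · simp [instrLaw, instrWeight, h, ENNReal.inv_two_add_inv_two]
  · have h1 : (1 + lam) ≠ 0 := by simp
    have h2 : (1 + lam) ≠ ∞ := by simp [h]
    simp only [instrLaw, instrWeight, h, if_false, Measure.add_apply, Measure.smul_apply,
      measure_univ, smul_eq_mul, mul_one]
    rw [add_assoc, half_add_half_inv, ← ENNReal.add_div, add_comm lam 1]
    exact ENNReal.div_self h1 h2

/-- The law of the stacks: all instructions are independent, with law `instrLaw lam`. -/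
def stackLaw (lam : ℝ≥0∞) : Measure Stacks := Measure.infinitePi fun _ => instrLaw lam

/-! ### The outer and the inner density -/

/-- The law of the occupation variables of a Bernoulli configuration: independent over the sites
of `ℤ`, equal to `1` with probability `z` and to `0` with probability `1 - z`. -/
def bernoulliLaw (z : unitInterval) : Measure (ℤ → ℕ) :=
  Measure.infinitePi fun _ => bernoulliMeasure 1 0 z

/-- `E_z (w(0)³)`, where `w` is the odometer of the Bernoulli configuration of density `z`. -/
def thirdMoment (lam : ℝ≥0∞) (z : unitInterval) : ℝ≥0∞ :=
  ∫⁻ p : Stacks × (ℤ → ℕ), (odometer lam p.1 (fun x => .num (p.2 x)) 0 : ℝ≥0∞) ^ 3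
    ∂((stackLaw lam).prod (bernoulliLaw z))

/-- The outer density `ζ_out`. -/
def zetaOut (lam : ℝ≥0∞) : ℝ :=
  sSup {z : ℝ | ∃ h : z ∈ unitInterval, 0 < z ∧ z < 1 ∧ thirdMoment lam ⟨z, h⟩ < ∞}

/-- The number of particles left in the finite set `I` after the stabilization of `1_I` with
killing upon exiting `I`. -/
def survivors (lam : ℝ≥0∞) (ρ : Stacks) (I : Finset ℤ) : ℕ :=
  ∑ x ∈ I, (stabilization lam I ρ (ones I) x).size

/-- The density `ζ_{in,I}` of a finite interval `I`. -/
def zetaInOn (lam : ℝ≥0∞) (I : Finset ℤ) : ℝ :=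
  sInf {z : ℝ | 0 < z ∧
    stackLaw lam {ρ | z * (I.card : ℝ) < (survivors lam ρ I : ℝ)} ≤ ((I.card : ℝ≥0∞) ^ 20)⁻¹}

/-- The inner density `ζ_in`: the upper limit of `ζ_{in,I}` over the intervals `I = [a, b]` of `ℤ`
as their number of sites tends to infinity. -/
def zetaIn (lam : ℝ≥0∞) : ℝ :=
  limsup (fun I : ℤ × ℤ => zetaInOn lam (Finset.Icc I.1 I.2))
    (comap (fun I : ℤ × ℤ => (Finset.Icc I.1 I.2).card) atTop)

end ARW

end

noncomputable section

namespace ARW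

/-! ### Counting instructions -/

/-! The basic tool is the least action principle: a function u whose use leaves a stable
configuration dominates the odometer, whether or not its firings are legal (`Legal.odo_le`).
Everything is therefore phrased through toppling functions: `cnt` computes particle numbers from u
and the stacks, and `IsOdo` says that u is the odometer. A firing allowed in Internal DLA is legal
for every λ, so a stage of Internal DLA may be run first; the instructions that it leaves unused are
fresh (`fresh_after_top`) and the stabilization resumes from its final configuration. The
quantitative input is the balance of mass and of first moment on an interval (`sum_cnt`,
`sum_pos_cnt`). The noise in it, right steps minus left steps, is a martingale with Gaussian tails
(`net_bound`), and a quadratic potential shows that O(n³) firings are made (`total_bound`).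

Inner bound. Let N ≥ δn particles end up to the right of some edge. They occupy distinct sites, so
their first moment is at least about N²/2; up to noise, this moment equals the number of steps made
across the edge from left to right. That many arrivals are enough for Internal DLA to fill the next
w ≈ (1-δ)N sites (`fill_of_balanced`). If all particles that ever enter this block I are delivered
at the start (`IsOdo.restrict`), then after the filling what remains is the stabilization of 1_I
with fresh stacks, which leaves at most zw particles for any z > ζ_in (`sum_block_eq_survivors`,
`crowded_small`). So the flux decreases by at most zw across w sites (`GoodRight.step`), and
iterating bounds it by z times the number of fired sites, plus δn (`GoodRight.density`). The power
20 in the definition of ζ_in pays for a union bound over blocks and inflows. The left side follows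
by reflection.

Outer bound. Take a density z close to ζ_out at which the third moment is finite, and a typical
Bernoulli environment η of density z. Put a virtual particle in every hole of η. Internal DLA
started from the pile then keeps its particles on sites of η only, so it spreads over about n/(2z)
sites on each side; the first moment forces the symmetry (`IsOdo.no_exit`). The settled particles
are dominated by η, so stabilizing them costs at most the odometer of η, which by the third moment
is at most n^(3/4) at all relevant sites (`ae_small_busy`). With so few firings no particle crosses
a further margin of δn sites (`IsOdo.no_escape_right`). The sum of the two toppling functions need
not be legal for the pile, but it stabilizes it (`IsOdo.stab_add`), hence dominates its odometer
(`wide_small`).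

All exceptional events have summable probabilities (`atypical_small`), and the Borel–Cantelli lemma
concludes. -/

/-- Number of right steps of an instruction. -/
def Instr.toRight : Instr → ℕ
  | .right => 1
  | _ => 0

/-- Number of left steps of an instruction. -/
def Instr.toLeft : Instr → ℕ
  | .left => 1
  | _ => 0

/-- Number of right steps among the first `k` instructions at `x`. -/
def rights (ρ : Stacks) (x : ℤ) (k : ℕ) : ℕ := ∑ j ∈ Finset.range k, (ρ (x, j)).toRight

/-- Number of left steps among the first `k` instructions at `x`. -/
def lefts (ρ : Stacks) (x : ℤ) (k : ℕ) : ℕ := ∑ j ∈ Finset.range k, (ρ (x, j)).toLeft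

/-- Number of particles at `x` after using `u y` instructions at each site `y`. -/
def cnt (η : ℤ → ℕ) (ρ : Stacks) (u : ℤ → ℕ) (x : ℤ) : ℤ :=
  η x + rights ρ (x - 1) (u (x - 1)) + lefts ρ (x + 1) (u (x + 1))
    - rights ρ x (u x) - lefts ρ x (u x)

/-- The configuration with `η x` active particles at `x`. -/
def act (η : ℤ → ℕ) : Config := fun x => .num (η x)

/-- A site with `c` particles, at which `k` instructions have been used, is stable. -/
def StableAt (lam : ℝ≥0∞) (ρ : Stacks) (x : ℤ) (k : ℕ) (c : ℤ) : Prop :=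
  -- A lone particle is asleep exactly when the last instruction used at its site is a sleep, so its
  -- state can be read from counts and stacks. Negative counts are stable: they occur when the
  -- toppling function is not legal.
  c ≤ 0 ∨ (c ≤ 1 ∧ (lam = ∞ ∨ (0 < k ∧ ρ (x, k - 1) = .sleep)))

/-- `u` is a stabilizing toppling function for `η` on `D`. -/
structure Stab (lam : ℝ≥0∞) (D : Set ℤ) (ρ : Stacks) (η u : ℤ → ℕ) : Prop where
  off : ∀ x ∉ D, u x = 0
  stable : ∀ x ∈ D, StableAt lam ρ x (u x) (cnt η ρ u x)

theorem rights_succ (ρ : Stacks) (x : ℤ) (k : ℕ) :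
    rights ρ x (k + 1) = rights ρ x k + (ρ (x, k)).toRight := Finset.sum_range_succ _ _

theorem lefts_succ (ρ : Stacks) (x : ℤ) (k : ℕ) :
    lefts ρ x (k + 1) = lefts ρ x k + (ρ (x, k)).toLeft := Finset.sum_range_succ _ _

@[simp] theorem rights_zero (ρ : Stacks) (x : ℤ) : rights ρ x 0 = 0 := rfl

@[simp] theorem lefts_zero (ρ : Stacks) (x : ℤ) : lefts ρ x 0 = 0 := rfl

theorem rights_mono (ρ : Stacks) (x : ℤ) : Monotone (rights ρ x) :=
  monotone_nat_of_le_succ fun k => by rw [rights_succ]; omega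

theorem lefts_mono (ρ : Stacks) (x : ℤ) : Monotone (lefts ρ x) :=
  monotone_nat_of_le_succ fun k => by rw [lefts_succ]; omega

theorem rights_add_lefts_le (ρ : Stacks) (x : ℤ) (k : ℕ) : rights ρ x k + lefts ρ x k ≤ k := by
  induction k with
  | zero => simp
  | succ k ih =>
    rw [rights_succ, lefts_succ]
    cases ρ (x, k) <;> simp [Instr.toRight, Instr.toLeft] <;> omega

theorem cnt_zero (η : ℤ → ℕ) (ρ : Stacks) (x : ℤ) : cnt η ρ 0 x = η x := by
  simp [cnt]

/-- The effect of one more firing at `x` on the particle counts. -/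
theorem cnt_fire (η : ℤ → ℕ) (ρ : Stacks) (u : ℤ → ℕ) (x y : ℤ) :
    cnt η ρ (Function.update u x (u x + 1)) y = cnt η ρ u y
      + (if y = x + 1 then ((ρ (x, u x)).toRight : ℤ) else 0)
      + (if y = x - 1 then ((ρ (x, u x)).toLeft : ℤ) else 0)
      - (if y = x then ((ρ (x, u x)).toRight + (ρ (x, u x)).toLeft : ℤ) else 0) := by
  unfold cnt
  by_cases h1 : y = x
  · subst h1
    have a : y - 1 ≠ y := by omega
    have b : y + 1 ≠ y := by omega
    have c : y ≠ y + 1 := by omega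
    have d : y ≠ y - 1 := by omega
    simp only [Function.update_of_ne a, Function.update_of_ne b, Function.update_self, rights_succ,
      lefts_succ, if_neg c, if_neg d, if_true]
    push_cast
    ring
  · rw [Function.update_of_ne h1, if_neg h1]
    by_cases h2 : y = x + 1
    · have a : y - 1 = x := by omega
      have b : y + 1 ≠ x := by omega
      have c : y ≠ x - 1 := by omega
      simp only [a, Function.update_self, Function.update_of_ne b, rights_succ, if_pos h2, if_neg c]
      push_cast
      ring
    · have a : y - 1 ≠ x := by omega
      rw [Function.update_of_ne a, if_neg h2]
      by_cases h3 : y = x - 1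
      · have b : y + 1 = x := by omega
        simp only [b, Function.update_self, lefts_succ, if_pos h3]
        push_cast
        ring
      · have b : y + 1 ≠ x := by omega
        rw [Function.update_of_ne b, if_neg h3]
        ring

theorem StableAt.mono {lam : ℝ≥0∞} {ρ : Stacks} {x : ℤ} {k : ℕ} {c c' : ℤ}
    (h : StableAt lam ρ x k c) (hc : c' ≤ c) : StableAt lam ρ x k c' := by
  unfold StableAt at *
  rcases h with h | ⟨h, h'⟩
  · left; omega
  · right; exact ⟨by omega, h'⟩

theorem StableAt.top {lam : ℝ≥0∞} {ρ : Stacks} {x : ℤ} {k : ℕ} {c : ℤ}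
    (h : StableAt lam ρ x k c) : StableAt ∞ ρ x k c := by
  unfold StableAt at *
  rcases h with h | ⟨h, h'⟩
  · left; omega
  · right; exact ⟨by omega, Or.inl rfl⟩

theorem StableAt.le_one {lam : ℝ≥0∞} {ρ : Stacks} {x : ℤ} {k : ℕ} {c : ℤ}
    (h : StableAt lam ρ x k c) : c ≤ 1 := by
  rcases h with h | h
  · omega
  · exact h.1

/-- Internal DLA only asks for at most one particle per site. Through least action this makes the
Internal DLA odometer a lower bound for the odometer at any λ. -/
theorem Stab.top {lam : ℝ≥0∞} {D : Set ℤ} {ρ : Stacks} {η u : ℤ → ℕ}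
    (h : Stab lam D ρ η u) : Stab ∞ D ρ η u :=
  ⟨h.off, fun x hx => (h.stable x hx).top⟩

theorem cnt_mono_init {η η' : ℤ → ℕ} {x : ℤ} (h : η x ≤ η' x) (ρ : Stacks) (u : ℤ → ℕ) :
    cnt η ρ u x ≤ cnt η' ρ u x := by
  unfold cnt
  have : (η x : ℤ) ≤ η' x := by exact_mod_cast h
  linarith

theorem Stab.mono_init {lam : ℝ≥0∞} {D : Set ℤ} {ρ : Stacks} {η η' u : ℤ → ℕ}
    (h : Stab lam D ρ η' u) (hη : ∀ x ∈ D, η x ≤ η' x) : Stab lam D ρ η u :=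
  ⟨h.off, fun x hx => (h.stable x hx).mono (cnt_mono_init (hη x hx) _ _)⟩

/-! ### Legal sequences at the level of toppling functions -/

theorem execute_size {lam : ℝ≥0∞} {D : Set ℤ} {x : ℤ} (hx : x ∈ D) {c : Config}
    (h : Unstable lam (c x)) (i : Instr) {y : ℤ} (hy : y ∈ D) :
    ((execute D x c i y).size : ℤ) = (c y).size
      + (if y = x + 1 then (i.toRight : ℤ) else 0)
      + (if y = x - 1 then (i.toLeft : ℤ) else 0)
      - (if y = x then (i.toRight + i.toLeft : ℤ) else 0) := by
  obtain ⟨k, hk, hk1⟩ : ∃ k, c x = .num k ∧ 1 ≤ k := by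
    cases hc : c x with
    | s => rw [hc] at h; exact absurd h (by simp [Unstable])
    | num k =>
      rw [hc] at h
      refine ⟨k, rfl, ?_⟩
      unfold Unstable at h
      split_ifs at h <;> omega
  have arr : ∀ a : NatS, (a.arrive.size : ℤ) = a.size + 1 := by
    intro a; cases a <;> simp [NatS.arrive, NatS.size]
  have lv : ((c x).leave.size : ℤ) = (c x).size - 1 := by
    rw [hk]; simp [NatS.leave, NatS.size]; omega
  have sl : (c x).trySleep.size = (c x).size := by
    rw [hk]
    rcases k with _ | _ | k <;> simp [NatS.trySleep, NatS.size]
  cases i with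
  | sleep =>
    simp only [execute, Instr.toRight, Instr.toLeft]
    by_cases h1 : y = x
    · subst h1; simp [sl]
    · simp [h1]
  | left =>
    simp only [execute, step, Instr.toRight, Instr.toLeft]
    by_cases h1 : y = x
    · subst h1
      have e1 : y ≠ y - 1 := by omega
      have e2 : y ≠ y + 1 := by omega
      split_ifs <;> simp [lv, e1]
      all_goals exact absurd rfl ‹_›
    · by_cases h2 : y = x - 1
      · subst h2
        have : x - 1 ≠ x := by omega
        simp_all
      · split_ifs <;> simp_all
  | right =>
    simp only [execute, step, Instr.toRight, Instr.toLeft]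
    by_cases h1 : y = x
    · subst h1
      have e1 : y ≠ y - 1 := by omega
      have e2 : y ≠ y + 1 := by omega
      split_ifs <;> simp [lv, e2]
      all_goals exact absurd rfl ‹_›
    · by_cases h2 : y = x + 1
      · subst h2
        have : x + 1 ≠ x := by omega
        simp_all
      · split_ifs <;> simp_all

/-- The relation between the configuration and the toppling function along legal sequences. -/
structure Inv (lam : ℝ≥0∞) (D : Set ℤ) (ρ : Stacks) (η : ℤ → ℕ) (S : State) : Prop where
  size : ∀ x ∈ D, ((S.config x).size : ℤ) = cnt η ρ S.used x
  asleep : ∀ x ∈ D, S.config x = .s →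
    lam ≠ ∞ ∧ 0 < S.used x ∧ ρ (x, S.used x - 1) = .sleep
  -- The empty state is included because an arrival turns it into a lone active particle without
  -- using an instruction at x.
  awake : ∀ x ∈ D, S.config x = .num 1 ∨ S.config x = .num 0 →
    ¬ (0 < S.used x ∧ ρ (x, S.used x - 1) = .sleep)
  off : ∀ x ∉ D, S.used x = 0

theorem Inv.init (lam : ℝ≥0∞) (D : Set ℤ) (ρ : Stacks) (η : ℤ → ℕ) :
    Inv lam D ρ η (State.init (act η)) where
  size x _ := by simp [State.init, cnt_zero, act, NatS.size]
  asleep x _ h := by simp [State.init, act] at h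
  awake x _ _ h := by simp [State.init] at h
  off x _ := rfl

theorem Inv.unstable_iff {lam : ℝ≥0∞} {D : Set ℤ} {ρ : Stacks} {η : ℤ → ℕ} {S : State}
    (h : Inv lam D ρ η S) {x : ℤ} (hx : x ∈ D) :
    Unstable lam (S.config x) ↔ ¬ StableAt lam ρ x (S.used x) (cnt η ρ S.used x) := by
  have hs := h.size x hx
  have ha := h.asleep x hx
  have hw := h.awake x hx
  unfold StableAt
  rw [← hs]
  cases hc : S.config x with
  | s =>
    obtain ⟨h1, h2⟩ := ha hc
    simp only [Unstable, NatS.size]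
    simp [h2]
  | num k =>
    simp only [Unstable, NatS.size]
    by_cases hl : lam = ∞
    · simp only [hl, if_true, true_or, and_true]
      omega
    · simp only [hl, if_false, false_or]
      rcases k with _ | _ | k
      · simp
      · have := hw (Or.inl hc)
        simpa using this
      · simp; omega

theorem unstable_num {lam : ℝ≥0∞} {a : NatS} (h : Unstable lam a) : ∃ k, a = .num (k + 1) := by
  cases a with
  | s => simp [Unstable] at h
  | num k =>
    rcases k with _ | k
    · unfold Unstable at h; split_ifs at h <;> omega
    · exact ⟨k, rfl⟩

theorem Inv.fire {lam : ℝ≥0∞} {D : Set ℤ} {ρ : Stacks} {η : ℤ → ℕ} {S : State}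
    (h : Inv lam D ρ η S) {x : ℤ} (hx : x ∈ D) (hu : Unstable lam (S.config x)) :
    Inv lam D ρ η (ARW.fire D ρ S x) := by
  have hsize : ∀ y ∈ D, (((ARW.fire D ρ S x).config y).size : ℤ)
      = cnt η ρ (ARW.fire D ρ S x).used y := by
    intro y hy
    simp only [ARW.fire]
    rw [execute_size hx hu _ hy, cnt_fire, h.size y hy]
  obtain ⟨k, hk⟩ := unstable_num hu
  refine ⟨hsize, ?_, ?_, ?_⟩
  · intro y hy hys
    by_cases hxy : y = x
    · subst hxy
      simp only [ARW.fire, Function.update_self] at hys ⊢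
      have e1 : y ≠ y - 1 := by omega
      have e2 : y ≠ y + 1 := by omega
      cases hi : ρ (y, S.used y) with
      | sleep =>
        rw [hi] at hys
        refine ⟨?_, by omega, by simpa using hi⟩
        rintro rfl
        rw [hk] at hu
        simp only [execute, Function.update_self, hk] at hys
        rcases k with _ | k
        · simp [Unstable] at hu
        · simp [NatS.trySleep] at hys
      | left =>
        rw [hi] at hys
        simp only [execute, step] at hys
        split_ifs at hys <;> simp [hk, NatS.leave, e1] at hys
      | right =>
        rw [hi] at hys
        simp only [execute, step] at hys
        split_ifs at hys <;> simp [hk, NatS.leave, e2] at hys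
    · have hold : S.config y = .s := by
        simp only [ARW.fire] at hys
        have arr : ∀ a : NatS, a.arrive ≠ .s := by intro a; cases a <;> simp [NatS.arrive]
        cases hi : ρ (x, S.used x) with
        | sleep => rw [hi] at hys; simpa [execute, hxy] using hys
        | left =>
          rw [hi] at hys
          simp only [execute, step] at hys
          by_cases e : y = x - 1
          · subst e
            simp [hxy, hy] at hys
            exact absurd hys (arr _)
          · split_ifs at hys <;> simpa [hxy, e] using hys
        | right =>
          rw [hi] at hys
          simp only [execute, step] at hys
          by_cases e : y = x + 1
          · subst e
            simp [hxy, hy] at hys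
            exact absurd hys (arr _)
          · split_ifs at hys <;> simpa [hxy, e] using hys
      simpa [ARW.fire, hxy] using h.asleep y hy hold
  · intro y hy hys
    by_cases hxy : y = x
    · subst hxy
      simp only [ARW.fire, Function.update_self] at hys ⊢
      rintro ⟨-, hi⟩
      simp only [Nat.add_sub_cancel] at hi
      rw [hi] at hys
      simp only [execute, Function.update_self, hk] at hys
      rcases k with _ | k <;> simp [NatS.trySleep] at hys
    · simp only [ARW.fire, Function.update_of_ne hxy] at hys ⊢
      refine h.awake y hy ?_
      have key : S.config y = .num 1 ∨ S.config y = .num 0 := by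
        have arr : ∀ a : NatS, a.arrive = .num 1 ∨ a.arrive = .num 0 → a = .num 0 := by
          intro a; cases a <;> simp [NatS.arrive]
        cases hi : ρ (x, S.used x) with
        | sleep => rw [hi] at hys; simpa [execute, hxy] using hys
        | left =>
          rw [hi] at hys
          simp only [execute, step] at hys
          by_cases e : y = x - 1
          · subst e
            simp [hxy, hy] at hys
            exact Or.inr (arr _ hys)
          · split_ifs at hys <;> simpa [hxy, e] using hys
        | right =>
          rw [hi] at hys
          simp only [execute, step] at hys
          by_cases e : y = x + 1
          · subst e
            simp [hxy, hy] at hys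
            exact Or.inr (arr _ hys)
          · split_ifs at hys <;> simpa [hxy, e] using hys
      exact key
  · intro y hy
    have : y ≠ x := by rintro rfl; exact hy hx
    simp [ARW.fire, this, h.off y hy]

theorem legal_append {lam : ℝ≥0∞} {D : Set ℤ} {ρ : Stacks} {S : State} {α β : List ℤ} :
    Legal lam D ρ S (α ++ β) ↔ Legal lam D ρ S α ∧ Legal lam D ρ (fireSeq D ρ S α) β := by
  induction α generalizing S with
  | nil => simp [Legal, fireSeq]
  | cons x α ih =>
    simp only [List.cons_append, Legal, ih, fireSeq, List.foldl_cons, and_assoc]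

theorem fireSeq_append (D : Set ℤ) (ρ : Stacks) (S : State) (α β : List ℤ) :
    fireSeq D ρ S (α ++ β) = fireSeq D ρ (fireSeq D ρ S α) β := List.foldl_append

theorem fireSeq_used (D : Set ℤ) (ρ : Stacks) (S : State) (α : List ℤ) (x : ℤ) :
    (fireSeq D ρ S α).used x = S.used x + α.count x := by
  induction α generalizing S with
  | nil => simp [fireSeq]
  | cons y α ih =>
    have : fireSeq D ρ S (y :: α) = fireSeq D ρ (fire D ρ S y) α := rfl
    rw [this, ih, List.count_cons]
    by_cases h : y = x
    · subst h; simp [fire]; ring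
    · have h' : x ≠ y := fun e => h e.symm
      simp [fire, h, h']

theorem Inv.fireSeq {lam : ℝ≥0∞} {D : Set ℤ} {ρ : Stacks} {η : ℤ → ℕ} {S : State}
    (h : Inv lam D ρ η S) {α : List ℤ} (hα : Legal lam D ρ S α) :
    Inv lam D ρ η (ARW.fireSeq D ρ S α) := by
  induction α generalizing S with
  | nil => exact h
  | cons y α ih => exact ih (h.fire hα.1 hα.2.1) hα.2.2

theorem Legal.inv {lam : ℝ≥0∞} {D : Set ℤ} {ρ : Stacks} {η : ℤ → ℕ} {α : List ℤ}
    (hα : Legal lam D ρ (State.init (act η)) α) :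
    Inv lam D ρ η (ARW.fireSeq D ρ (State.init (act η)) α) :=
  (Inv.init lam D ρ η).fireSeq hα

/-- The toppling function of a sequence. -/
def odo (α : List ℤ) : ℤ → ℕ := fun x => α.count x

theorem fireSeq_init_used (D : Set ℤ) (ρ : Stacks) (η : Config) (α : List ℤ) :
    (fireSeq D ρ (State.init η) α).used = odo α := by
  funext x
  rw [fireSeq_used]
  simp [State.init, odo]

theorem odo_snoc (α : List ℤ) (x : ℤ) :
    odo (α ++ [x]) = Function.update (odo α) x (odo α x + 1) := by
  funext y
  unfold odo
  by_cases h : y = x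
  · subst h; simp
  · have : x ≠ y := fun e => h e.symm
    simp [h, this]

theorem Legal.unstable_iff {lam : ℝ≥0∞} {D : Set ℤ} {ρ : Stacks} {η : ℤ → ℕ} {α : List ℤ}
    (hα : Legal lam D ρ (State.init (act η)) α) {x : ℤ} (hx : x ∈ D) :
    Unstable lam ((ARW.fireSeq D ρ (State.init (act η)) α).config x) ↔
      ¬ StableAt lam ρ x (odo α x) (cnt η ρ (odo α) x) := by
  rw [hα.inv.unstable_iff hx, fireSeq_init_used]

theorem legal_snoc_iff {lam : ℝ≥0∞} {D : Set ℤ} {ρ : Stacks} {η : ℤ → ℕ} {α : List ℤ} {x : ℤ} :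
    Legal lam D ρ (State.init (act η)) (α ++ [x]) ↔
      Legal lam D ρ (State.init (act η)) α ∧ x ∈ D ∧
        ¬ StableAt lam ρ x (odo α x) (cnt η ρ (odo α) x) := by
  rw [legal_append]
  constructor
  · rintro ⟨h1, h2, h3, -⟩
    exact ⟨h1, h2, (h1.unstable_iff h2).1 h3⟩
  · rintro ⟨h1, h2, h3⟩
    exact ⟨h1, h2, (h1.unstable_iff h2).2 h3, trivial⟩

theorem Legal.mem {lam : ℝ≥0∞} {D : Set ℤ} {ρ : Stacks} {S : State} {α : List ℤ}
    (hα : Legal lam D ρ S α) : ∀ x ∈ α, x ∈ D := by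
  induction α generalizing S with
  | nil => simp
  | cons y α ih =>
    intro x hx
    rcases List.mem_cons.1 hx with rfl | hx
    · exact hα.1
    · exact ih hα.2.2 x hx

/-- Legality is monotone in the domain, in the initial configuration, and is inherited from
the Internal DLA rule. -/
theorem Legal.mono {lam lam' : ℝ≥0∞} {D D' : Set ℤ} {ρ : Stacks} {η η' : ℤ → ℕ} {α : List ℤ}
    (hα : Legal lam D ρ (State.init (act η)) α) (hl : lam = ∞ ∨ lam = lam')
    (hη : ∀ x ∈ D, η x ≤ η' x) (hm : ∀ x ∈ α, x ∈ D') :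
    Legal lam' D' ρ (State.init (act η')) α := by
  induction α using List.reverseRecOn with
  | nil => trivial
  | append_singleton α x ih =>
    rw [legal_snoc_iff] at hα ⊢
    refine ⟨ih hα.1 fun y hy => hm y (by simp [hy]), hm x (by simp), fun hs => hα.2.2 ?_⟩
    have := hs.mono (cnt_mono_init (hη x hα.2.1) ρ (odo α))
    rcases hl with rfl | rfl
    · exact this.top
    · exact this

/-- With the firings at x fixed, firings elsewhere can only bring particles to x. -/
theorem cnt_mono_used {η : ℤ → ℕ} {ρ : Stacks} {u v : ℤ → ℕ} {x : ℤ} (h : ∀ y, v y ≤ u y)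
    (hx : v x = u x) : cnt η ρ v x ≤ cnt η ρ u x := by
  unfold cnt
  rw [hx]
  have h1 := rights_mono ρ (x - 1) (h (x - 1))
  have h2 := lefts_mono ρ (x + 1) (h (x + 1))
  omega

/-- Least action principle. -/
theorem Legal.odo_le {lam : ℝ≥0∞} {D : Set ℤ} {ρ : Stacks} {η : ℤ → ℕ} {α : List ℤ}
    (hα : Legal lam D ρ (State.init (act η)) α) {u : ℤ → ℕ} (hu : Stab lam D ρ η u) (x : ℤ) :
    odo α x ≤ u x := by
  induction α using List.reverseRecOn generalizing x with
  | nil => simp [odo]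
  | append_singleton α y ih =>
    rw [legal_snoc_iff] at hα
    have ih := ih hα.1
    rw [odo_snoc]
    by_cases hxy : x = y
    · subst hxy
      rw [Function.update_self]
      -- If x had already fired u x times, the other sites would have sent it at most what they send
      -- under u, so x would be stable and could not be fired.
      refine Nat.lt_of_le_of_ne (ih x) fun he => hα.2.2 ?_
      rw [he]
      exact (hu.stable x hα.2.1).mono (cnt_mono_used ih he)
    · rw [Function.update_of_ne hxy]
      exact ih x

/-- `u` is the toppling function of a legal stabilizing sequence of `η` on `D`. -/
def IsOdo (lam : ℝ≥0∞) (D : Set ℤ) (ρ : Stacks) (η u : ℤ → ℕ) : Prop :=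
  ∃ α, Stabilizes lam D ρ (act η) α ∧ odo α = u

theorem Stabilizes.stab {lam : ℝ≥0∞} {D : Set ℤ} {ρ : Stacks} {η : ℤ → ℕ} {α : List ℤ}
    (h : Stabilizes lam D ρ (act η) α) : Stab lam D ρ η (odo α) where
  off x hx := List.count_eq_zero.2 fun hm => hx (h.1.mem x hm)
  stable x hx := by
    by_contra hc
    exact h.2 x hx ((h.1.unstable_iff hx).2 hc)

theorem Legal.stabilizes {lam : ℝ≥0∞} {D : Set ℤ} {ρ : Stacks} {η : ℤ → ℕ} {α : List ℤ}
    (h : Legal lam D ρ (State.init (act η)) α) (hs : Stab lam D ρ η (odo α)) :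
    Stabilizes lam D ρ (act η) α :=
  ⟨h, fun x hx hc => (h.unstable_iff hx).1 hc (hs.stable x hx)⟩

theorem IsOdo.stab {lam : ℝ≥0∞} {D : Set ℤ} {ρ : Stacks} {η u : ℤ → ℕ}
    (h : IsOdo lam D ρ η u) : Stab lam D ρ η u := by
  obtain ⟨α, hα, rfl⟩ := h
  exact hα.stab

theorem IsOdo.le {lam : ℝ≥0∞} {D : Set ℤ} {ρ : Stacks} {η u v : ℤ → ℕ}
    (h : IsOdo lam D ρ η u) (hv : Stab lam D ρ η v) (x : ℤ) : u x ≤ v x := by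
  obtain ⟨α, hα, rfl⟩ := h
  exact hα.1.odo_le hv x

/-- Abelian property: each of two legal stabilizing sequences is dominated by the other. -/
theorem IsOdo.unique {lam : ℝ≥0∞} {D : Set ℤ} {ρ : Stacks} {η u v : ℤ → ℕ}
    (h : IsOdo lam D ρ η u) (hv : IsOdo lam D ρ η v) : u = v :=
  funext fun x => le_antisymm (h.le hv.stab x) (hv.le h.stab x)

theorem IsOdo.cnt_nonneg {lam : ℝ≥0∞} {D : Set ℤ} {ρ : Stacks} {η u : ℤ → ℕ}
    (h : IsOdo lam D ρ η u) {x : ℤ} (hx : x ∈ D) : 0 ≤ cnt η ρ u x := by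
  obtain ⟨α, hα, rfl⟩ := h
  have := hα.1.inv.size x hx
  rw [fireSeq_init_used] at this
  omega

theorem IsOdo.cnt_le_one {lam : ℝ≥0∞} {D : Set ℤ} {ρ : Stacks} {η u : ℤ → ℕ}
    (h : IsOdo lam D ρ η u) {x : ℤ} (hx : x ∈ D) : cnt η ρ u x ≤ 1 :=
  (h.stab.stable x hx).le_one

theorem length_eq_sum_odo {α : List ℤ} {F : Finset ℤ} (h : ∀ x ∈ α, x ∈ F) :
    α.length = ∑ x ∈ F, odo α x :=
  (List.sum_toFinset_count_eq_length α).symm.trans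
    (Finset.sum_subset (fun x hx => h x (List.mem_toFinset.1 hx))
      fun _ _ hx => List.count_eq_zero.2 fun hm => hx (List.mem_toFinset.2 hm))

/-- If legal sequences have bounded length, one of them stabilizes. -/
theorem exists_legal_stable {lam : ℝ≥0∞} {D : Set ℤ} {ρ : Stacks} {S : State} {B : ℕ}
    (hB : ∀ β, Legal lam D ρ S β → β.length ≤ B) :
    ∃ β, Legal lam D ρ S β ∧ ∀ x ∈ D, ¬ Unstable lam ((fireSeq D ρ S β).config x) := by
  by_contra! hcon
  have : ∀ k, ∃ β, Legal lam D ρ S β ∧ β.length = k := by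
    intro k
    induction k with
    | zero => exact ⟨[], trivial, rfl⟩
    | succ k ih =>
      obtain ⟨β, hβ, hl⟩ := ih
      obtain ⟨x, hx, hu⟩ := hcon β hβ
      exact ⟨β ++ [x], legal_append.2 ⟨hβ, hx, hu, trivial⟩, by simp [hl]⟩
  obtain ⟨β, hβ, hl⟩ := this (B + 1)
  have := hB β hβ
  omega

theorem Legal.length_le {lam : ℝ≥0∞} {D : Set ℤ} {ρ : Stacks} {η u : ℤ → ℕ}
    (hu : Stab lam D ρ η u) {F : Finset ℤ} (hF : ∀ x ∉ F, u x = 0) {α : List ℤ}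
    (hα : Legal lam D ρ (State.init (act η)) α) : α.length ≤ ∑ x ∈ F, u x := by
  have hm : ∀ x ∈ α, x ∈ F := by
    intro x hx
    by_contra hc
    have h1 := hα.odo_le hu x
    rw [hF x hc] at h1
    have : 0 < odo α x := List.count_pos_iff.2 hx
    omega
  rw [length_eq_sum_odo hm]
  exact Finset.sum_le_sum fun x _ => hα.odo_le hu x

/-- A finitely supported stabilizing function, legal or not, bounds the length of all legal
sequences, so extending greedily must stop. -/
theorem Stab.exists_isOdo {lam : ℝ≥0∞} {D : Set ℤ} {ρ : Stacks} {η u : ℤ → ℕ}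
    (hu : Stab lam D ρ η u) {F : Finset ℤ} (hF : ∀ x ∉ F, u x = 0) :
    ∃ v, IsOdo lam D ρ η v := by
  obtain ⟨β, hβ, hs⟩ := exists_legal_stable (fun β hβ => Legal.length_le hu hF (α := β) hβ)
  exact ⟨odo β, β, ⟨hβ, hs⟩, rfl⟩

/-- The odometer is the least stabilizing function; this identifies odometers without exhibiting a
legal sequence. -/
theorem isOdo_of_least {lam : ℝ≥0∞} {D : Set ℤ} {ρ : Stacks} {η u : ℤ → ℕ}
    (hu : Stab lam D ρ η u) {F : Finset ℤ} (hF : ∀ x ∉ F, u x = 0)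
    (hl : ∀ v, Stab lam D ρ η v → ∀ x, u x ≤ v x) : IsOdo lam D ρ η u := by
  obtain ⟨v, hv⟩ := hu.exists_isOdo hF
  have : u = v := funext fun x => le_antisymm (hl v hv.stab x) (hv.le hu x)
  rwa [this]

/-! ### Pile, survivors and odometer -/

/-- The indicator of a set, as a particle count. -/
def ind (I : Finset ℤ) : ℤ → ℕ := fun x => if x ∈ I then 1 else 0

theorem ones_eq (I : Finset ℤ) : ones I = act (ind I) := by
  funext x
  by_cases h : x ∈ I <;> simp [ones, act, ind, h]

/-- `n` particles at the site `y`. -/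
def single (y : ℤ) (n : ℕ) : ℤ → ℕ := fun x => if x = y then n else 0

theorem pile_eq (n : ℕ) : pile n = act (single 0 n) := by
  funext x
  by_cases h : x = 0 <;> simp [pile, act, single, h]

/-- The sequence chosen in `stabilization` is irrelevant by uniqueness of the odometer. -/
theorem survivors_eq {lam : ℝ≥0∞} {ρ : Stacks} {I : Finset ℤ} {u : ℤ → ℕ}
    (h : IsOdo lam I ρ (ind I) u) : (survivors lam ρ I : ℤ) = ∑ x ∈ I, cnt (ind I) ρ u x := by
  have hex : ∃ α, Stabilizes lam I ρ (act (ind I)) α := h.imp fun _ h => h.1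
  unfold survivors stabilization
  rw [ones_eq, dif_pos hex]
  push_cast
  refine Finset.sum_congr rfl fun x hx => ?_
  have h1 : IsOdo lam I ρ (ind I) (odo hex.choose) := ⟨_, hex.choose_spec, rfl⟩
  rw [h1.unique h |>.symm, hex.choose_spec.1.inv.size x hx, fireSeq_init_used]

theorem odometer_eq {lam : ℝ≥0∞} {ρ : Stacks} {η u : ℤ → ℕ}
    (h : IsOdo lam Set.univ ρ η u) (x : ℤ) : odometer lam ρ (act η) x = u x := by
  unfold odometer
  refine le_antisymm (iSup₂_le fun α hα => ?_) ?_
  · exact_mod_cast hα.odo_le h.stab x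
  · obtain ⟨α, hα, rfl⟩ := h
    exact le_iSup₂_of_le α hα.1 le_rfl

theorem firedSites_eq {lam : ℝ≥0∞} {ρ : Stacks} {n : ℕ} {u : ℤ → ℕ}
    (h : IsOdo lam Set.univ ρ (single 0 n) u) : firedSites lam ρ n = {x | 0 < u x} := by
  ext x
  simp only [firedSites, pile_eq, odometer_eq h, Set.mem_ofPred_eq]
  exact_mod_cast Iff.rfl

/-! ### Restriction and composition -/

open Classical in
/-- The initial configuration on `K` together with the particles entering `K` from outside. -/
def inflow (K : Set ℤ) (ρ : Stacks) (η u : ℤ → ℕ) : ℤ → ℕ := fun x =>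
  η x + (if x - 1 ∈ K then 0 else rights ρ (x - 1) (u (x - 1)))
    + (if x + 1 ∈ K then 0 else lefts ρ (x + 1) (u (x + 1)))

open Classical in
/-- Replace `u` by `v` on `K`. -/
def patch (K : Set ℤ) (v u : ℤ → ℕ) : ℤ → ℕ := fun x => if x ∈ K then v x else u x

/-- All particles that u ever sends into K are delivered at the start, so firing inside K gives the
same final counts as in the full system. -/
theorem cnt_inflow {K : Set ℤ} {ρ : Stacks} {η u v : ℤ → ℕ} (hv : ∀ x ∉ K, v x = 0)
    {x : ℤ} (hx : x ∈ K) : cnt (inflow K ρ η u) ρ v x = cnt η ρ (patch K v u) x := by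
  have h1 := hv (x - 1)
  have h2 := hv (x + 1)
  unfold cnt inflow patch
  by_cases a : x - 1 ∈ K <;> by_cases b : x + 1 ∈ K <;> simp [a, b, hx] <;>
    simp [h1, h2, a, b] <;> ring

theorem patch_zero_off (K : Set ℤ) (u : ℤ → ℕ) : ∀ x ∉ K, patch K u 0 x = 0 := by
  intro x hx; simp [patch, hx]

/-- If v stabilizes K with the inflow delivered at the start, then the minimum of u and of u patched
by v on K stabilizes the full system: at each site the function realizing the minimum is stable
there, and lowering the others only removes arrivals. Minimality of u then gives u ≤ v on K. -/
theorem IsOdo.restrict {lam : ℝ≥0∞} {D : Set ℤ} {ρ : Stacks} {η u : ℤ → ℕ}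
    (h : IsOdo lam D ρ η u) {K : Finset ℤ} (hK : (K : Set ℤ) ⊆ D) :
    IsOdo lam K ρ (inflow K ρ η u) (patch K u 0) := by
  have hst : Stab lam K ρ (inflow K ρ η u) (patch K u 0) := by
    refine ⟨patch_zero_off _ _, fun x hx => ?_⟩
    rw [cnt_inflow (patch_zero_off _ _) hx]
    have e1 : patch K (patch K u 0) u = u := by
      funext y; by_cases hy : y ∈ (K : Set ℤ) <;> simp_all [patch]
    have e2 : patch K u 0 x = u x := by simp_all [patch]
    rw [e1, e2]
    exact h.stab.stable x (hK hx)
  refine isOdo_of_least hst (F := K) (patch_zero_off _ _) fun v hv x => ?_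
  have hc : Stab lam D ρ η (fun x => min (patch K v u x) (u x)) := by
    refine ⟨fun x hx => by simp [h.stab.off x hx], fun x hx => ?_⟩
    by_cases hxK : x ∈ (K : Set ℤ)
    · rcases le_total (v x) (u x) with hle | hle
      · have e : min (patch K v u x) (u x) = v x := by simp [patch, hxK, hle]
        simp only [e]
        refine (hv.stable x hxK).mono ?_
        rw [cnt_inflow hv.off hxK]
        exact cnt_mono_used (fun y => min_le_left _ _) (by simp [patch, hxK, hle])
      · have e : min (patch K v u x) (u x) = u x := by simp [patch, hxK, hle]
        simp only [e]
        exact (h.stab.stable x hx).mono (cnt_mono_used (fun y => min_le_right _ _) (by simp [e]))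
    · have e : min (patch K v u x) (u x) = u x := by simp [patch, hxK]
      simp only [e]
      exact (h.stab.stable x hx).mono (cnt_mono_used (fun y => min_le_right _ _) (by simp [e]))
  have := h.le hc x
  by_cases hxK : x ∈ (K : Set ℤ)
  · simp [patch, hxK] at this ⊢; exact this
  · simp [patch, hxK]

/-- Remove the first `v x` instructions from the stack at each site `x`. -/
def shiftBy (v : ℤ → ℕ) (ρ : Stacks) : Stacks := fun p => ρ (p.1, p.2 + v p.1)

theorem shiftBy_apply (v : ℤ → ℕ) (ρ : Stacks) (x : ℤ) (k : ℕ) :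
    shiftBy v ρ (x, k) = ρ (x, k + v x) := rfl

theorem rights_add (ρ : Stacks) (v : ℤ → ℕ) (x : ℤ) (k : ℕ) :
    rights ρ x (v x + k) = rights ρ x (v x) + rights (shiftBy v ρ) x k := by
  unfold rights
  rw [Finset.sum_range_add]
  simp only [shiftBy_apply, add_comm]

theorem lefts_add (ρ : Stacks) (v : ℤ → ℕ) (x : ℤ) (k : ℕ) :
    lefts ρ x (v x + k) = lefts ρ x (v x) + lefts (shiftBy v ρ) x k := by
  unfold lefts
  rw [Finset.sum_range_add]
  simp only [shiftBy_apply, add_comm]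

/-- The configuration ξ cancels. It is to be taken equal to the counts left by v, where the first
two terms disappear or differ only by a known constant. -/
theorem cnt_add (η ξ : ℤ → ℕ) (ρ : Stacks) (v w : ℤ → ℕ) (x : ℤ) :
    cnt η ρ (v + w) x = cnt η ρ v x - ξ x + cnt ξ (shiftBy v ρ) w x := by
  simp only [cnt, Pi.add_apply, rights_add, lefts_add]
  push_cast
  ring

theorem StableAt.unshift {lam : ℝ≥0∞} {ρ : Stacks} {v : ℤ → ℕ} {x : ℤ} {k : ℕ} {c : ℤ}
    (h : StableAt lam (shiftBy v ρ) x k c) : StableAt lam ρ x (v x + k) c := by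
  rcases h with h | ⟨h1, h2 | ⟨h2, h3⟩⟩
  · exact Or.inl h
  · exact Or.inr ⟨h1, Or.inl h2⟩
  · refine Or.inr ⟨h1, Or.inr ⟨by omega, ?_⟩⟩
    rw [shiftBy_apply] at h3
    rw [← h3]
    congr 2
    omega

theorem fire_shift (D : Set ℤ) (ρ : Stacks) (c : Config) (v w : ℤ → ℕ) (x : ℤ) :
    fire D ρ ⟨c, v + w⟩ x = ⟨(fire D (shiftBy v ρ) ⟨c, w⟩ x).config,
      v + (fire D (shiftBy v ρ) ⟨c, w⟩ x).used⟩ := by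
  simp only [fire, shiftBy_apply, Pi.add_apply, State.mk.injEq]
  constructor
  · rw [add_comm]
  · funext y
    by_cases h : y = x
    · subst h; simp; ring
    · simp [h]

theorem legal_shift {lam : ℝ≥0∞} {D : Set ℤ} {ρ : Stacks} {c : Config} {v w : ℤ → ℕ}
    {α : List ℤ} :
    Legal lam D ρ ⟨c, v + w⟩ α ↔ Legal lam D (shiftBy v ρ) ⟨c, w⟩ α := by
  induction α generalizing c w with
  | nil => simp [Legal]
  | cons x α ih =>
    simp only [Legal, fire_shift, ih]

theorem fireSeq_shift (D : Set ℤ) (ρ : Stacks) (c : Config) (v w : ℤ → ℕ) (α : List ℤ) :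
    fireSeq D ρ ⟨c, v + w⟩ α = ⟨(fireSeq D (shiftBy v ρ) ⟨c, w⟩ α).config,
      v + (fireSeq D (shiftBy v ρ) ⟨c, w⟩ α).used⟩ := by
  induction α generalizing c w with
  | nil => simp [fireSeq]
  | cons x α ih =>
    simp only [fireSeq, List.foldl_cons] at ih ⊢
    rw [fire_shift]
    exact ih _ _

theorem execute_off {D : Set ℤ} {x : ℤ} (hx : x ∈ D) (c : Config) (i : Instr) {y : ℤ}
    (hy : y ∉ D) : execute D x c i y = c y := by
  have h : y ≠ x := by rintro rfl; exact hy hx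
  cases i with
  | sleep => simp [execute, h]
  | left =>
    simp only [execute, step]
    by_cases e : y = x - 1
    · subst e; simp [hy, h]
    · split_ifs <;> simp [h, e]
  | right =>
    simp only [execute, step]
    by_cases e : y = x + 1
    · subst e; simp [hy, h]
    · split_ifs <;> simp [h, e]

theorem fireSeq_off {lam : ℝ≥0∞} {D : Set ℤ} {ρ : Stacks} {S : State} {α : List ℤ}
    (hα : Legal lam D ρ S α) {y : ℤ} (hy : y ∉ D) :
    (fireSeq D ρ S α).config y = S.config y := by
  induction α generalizing S with
  | nil => rfl
  | cons x α ih =>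
    have := ih hα.2.2
    simp only [fireSeq, List.foldl_cons] at this ⊢
    rw [this]
    exact execute_off hα.1 _ _ hy

open Classical in
/-- The particle counts after using `u` on `D`, starting from `η`. -/
def settle (D : Set ℤ) (ρ : Stacks) (η u : ℤ → ℕ) : ℤ → ℕ := fun x =>
  if x ∈ D then (cnt η ρ u x).toNat else η x

/-- Under the Internal DLA rule nothing falls asleep, so the counts determine the state, which can
serve as a new initial configuration of active particles. -/
theorem Legal.config_top {D : Set ℤ} {ρ : Stacks} {η : ℤ → ℕ} {α : List ℤ}
    (hα : Legal ∞ D ρ (State.init (act η)) α) :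
    fireSeq D ρ (State.init (act η)) α = ⟨act (settle D ρ η (odo α)), odo α⟩ := by
  rw [show fireSeq D ρ (State.init (act η)) α
    = ⟨(fireSeq D ρ (State.init (act η)) α).config, (fireSeq D ρ (State.init (act η)) α).used⟩
    from rfl, fireSeq_init_used]
  congr 1
  funext x
  by_cases hx : x ∈ D
  · have h1 := hα.inv.size x hx
    have h2 := hα.inv.asleep x hx
    rw [fireSeq_init_used] at h1
    cases hc : (fireSeq D ρ (State.init (act η)) α).config x with
    | s => exact absurd rfl (h2 hc).1
    | num k =>
      rw [hc] at h1
      simp only [NatS.size] at h1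
      simp [act, settle, hx, ← h1]
  · rw [fireSeq_off hα hx]
    simp [State.init, act, settle, hx]

/-- Stabilizing after an Internal DLA phase. -/
theorem IsOdo.after_top {lam : ℝ≥0∞} {D : Set ℤ} {ρ : Stacks} {η u v : ℤ → ℕ}
    (hu : IsOdo lam D ρ η u) (hv : IsOdo ∞ D ρ η v) {F : Finset ℤ} (hF : D ⊆ F) :
    ∃ w, IsOdo lam D (shiftBy v ρ) (settle D ρ η v) w ∧ u = v + w := by
  obtain ⟨α, hα, rfl⟩ := hv
  have hleg : Legal lam D ρ (State.init (act η)) α :=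
    hα.1.mono (Or.inl rfl) (fun _ _ => le_rfl) hα.1.mem
  have hS := hα.1.config_top
  have hB : ∀ β, Legal lam D (shiftBy (odo α) ρ) (State.init (act (settle D ρ η (odo α)))) β →
      Legal lam D ρ (State.init (act η)) (α ++ β) := by
    intro β hβ
    refine legal_append.2 ⟨hleg, ?_⟩
    rw [hS]
    have := (legal_shift (v := odo α) (w := 0)).2 hβ
    simpa using this
  obtain ⟨β, hβ, hs⟩ := exists_legal_stable (S := State.init (act (settle D ρ η (odo α))))
    (lam := lam) (D := D) (ρ := shiftBy (odo α) ρ) (B := ∑ x ∈ F, u x) (fun β hβ => by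
    have h1 := Legal.length_le hu.stab (F := F)
      (fun x hx => hu.stab.off x fun h => hx (hF h)) (hB β hβ)
    rw [List.length_append] at h1
    omega)
  refine ⟨odo β, ⟨β, ⟨hβ, hs⟩, rfl⟩, ?_⟩
  have h2 : IsOdo lam D ρ η (odo (α ++ β)) := by
    refine ⟨α ++ β, ⟨hB β hβ, ?_⟩, rfl⟩
    rw [fireSeq_append, hS]
    have := fireSeq_shift D ρ (act (settle D ρ η (odo α))) (odo α) 0 β
    rw [add_zero] at this
    rw [this]
    exact hs
  rw [hu.unique h2]
  funext x
  simp [odo]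

/-! ### Internal DLA -/

theorem toRight_add_toLeft_le (i : Instr) : i.toRight + i.toLeft ≤ 1 := by
  cases i <;> simp [Instr.toRight, Instr.toLeft]

/-- In Internal DLA, a site that has been occupied remains occupied. -/
theorem Legal.one_le_cnt {D : Set ℤ} {ρ : Stacks} {η : ℤ → ℕ} {α : List ℤ}
    (hα : Legal ∞ D ρ (State.init (act η)) α) (x : ℤ) (h : 0 < odo α x ∨ 0 < η x) :
    1 ≤ cnt η ρ (odo α) x := by
  induction α using List.reverseRecOn with
  | nil =>
    have : odo [] = 0 := rfl
    rw [this, cnt_zero]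
    rcases h with h | h
    · simp [odo] at h
    · exact_mod_cast h
  | append_singleton α y ih =>
    rw [legal_snoc_iff] at hα
    rw [odo_snoc, cnt_fire]
    have h1 := toRight_add_toLeft_le (ρ (y, odo α y))
    by_cases hxy : x = y
    · subst hxy
      have h2 : ¬ cnt η ρ (odo α) x ≤ 1 := fun hc => hα.2.2 (Or.inr ⟨hc, Or.inl rfl⟩)
      rw [if_pos rfl]
      split_ifs <;> omega
    · rw [odo_snoc, Function.update_of_ne hxy] at h
      have := ih hα.1 h
      rw [if_neg hxy]
      split_ifs <;> omega

theorem IsOdo.one_le_cnt {D : Set ℤ} {ρ : Stacks} {η u : ℤ → ℕ} (h : IsOdo ∞ D ρ η u) (x : ℤ)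
    (hx : 0 < u x ∨ 0 < η x) : 1 ≤ cnt η ρ u x := by
  obtain ⟨α, hα, rfl⟩ := h
  exact hα.1.one_le_cnt x hx

/-- In Internal DLA, an empty site has never been visited. -/
theorem IsOdo.empty {D : Set ℤ} {ρ : Stacks} {η u : ℤ → ℕ} (h : IsOdo ∞ D ρ η u) {x : ℤ}
    (hx : cnt η ρ u x ≤ 0) : u x = 0 ∧ η x = 0 ∧ rights ρ (x - 1) (u (x - 1)) = 0 ∧
      lefts ρ (x + 1) (u (x + 1)) = 0 := by
  have h1 : u x = 0 := by
    by_contra hc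
    have := h.one_le_cnt x (Or.inl (Nat.pos_of_ne_zero hc))
    omega
  have h2 : η x = 0 := by
    by_contra hc
    have := h.one_le_cnt x (Or.inr (Nat.pos_of_ne_zero hc))
    omega
  unfold cnt at hx
  rw [h1, h2] at hx
  simp only [rights_zero, lefts_zero] at hx
  omega

/-- In Internal DLA, more particles occupy more sites. -/
theorem IsOdo.one_le_cnt_of_le {D : Set ℤ} {ρ : Stacks} {η η' u u' : ℤ → ℕ}
    (h : IsOdo ∞ D ρ η u) (h' : IsOdo ∞ D ρ η' u') (hη : ∀ x, η x ≤ η' x) {x : ℤ}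
    (hx : 1 ≤ cnt η ρ u x) : 1 ≤ cnt η' ρ u' x := by
  by_contra hc
  obtain ⟨-, e2, e3, e4⟩ := h'.empty (x := x) (by omega)
  have hle := h.le (h'.stab.mono_init fun x _ => hη x)
  have a := rights_mono ρ (x - 1) (hle (x - 1))
  have b := lefts_mono ρ (x + 1) (hle (x + 1))
  have c := hη x
  unfold cnt at hx
  omega

/-! ### Mass and position balance -/

/-- Right steps minus left steps among the first `k` instructions at `x`. -/
def net (ρ : Stacks) (x : ℤ) (k : ℕ) : ℤ := rights ρ x k - lefts ρ x k

/-- Steps inside the block cancel; only traffic through its two ends remains. -/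
theorem sum_cnt (η : ℤ → ℕ) (ρ : Stacks) (u : ℤ → ℕ) (y : ℤ) (k : ℕ) :
    ∑ i ∈ Finset.range k, cnt η ρ u (y + i) = ∑ i ∈ Finset.range k, (η (y + i) : ℤ)
      + rights ρ (y - 1) (u (y - 1)) - lefts ρ y (u y)
      - rights ρ (y + k - 1) (u (y + k - 1)) + lefts ρ (y + k) (u (y + k)) := by
  induction k with
  | zero => simp
  | succ k ih =>
    rw [Finset.sum_range_succ, Finset.sum_range_succ, ih]
    have e1 : y + ((k + 1 : ℕ) : ℤ) = y + k + 1 := by push_cast; ring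
    have e2 : y + k + 1 - 1 = y + k := by ring
    unfold cnt
    rw [e1, e2]
    ring

/-- With weights 1, …, k, an arrival at the left end adds 1 and one at the right end adds k. The net
term credits an exit to the right with weight k + 1, which is taken back; an exit to the left
correctly goes to weight 0. -/
theorem sum_pos_cnt (η : ℤ → ℕ) (ρ : Stacks) (u : ℤ → ℕ) (y : ℤ) (k : ℕ) :
    ∑ i ∈ Finset.range k, ((i : ℤ) + 1) * cnt η ρ u (y + i)
      = ∑ i ∈ Finset.range k, ((i : ℤ) + 1) * (η (y + i) : ℤ)
      + rights ρ (y - 1) (u (y - 1)) + ∑ i ∈ Finset.range k, net ρ (y + i) (u (y + i))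
      - (k + 1) * rights ρ (y + k - 1) (u (y + k - 1)) + k * lefts ρ (y + k) (u (y + k)) := by
  induction k with
  | zero => simp
  | succ k ih =>
    rw [Finset.sum_range_succ, Finset.sum_range_succ, Finset.sum_range_succ, ih]
    have e1 : y + ((k + 1 : ℕ) : ℤ) = y + k + 1 := by push_cast; ring
    have e2 : y + k + 1 - 1 = y + k := by ring
    unfold cnt net
    rw [e1, e2]
    push_cast
    ring

/-! ### The law of the stacks -/

theorem exists_weights (lam : ℝ≥0∞) : ∃ p s : ℝ, 0 < p ∧ 0 ≤ s ∧ s + 2 * p = 1 ∧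
    instrWeight lam .sleep = ENNReal.ofReal s ∧ instrWeight lam .left = ENNReal.ofReal p ∧
    instrWeight lam .right = ENNReal.ofReal p := by
  by_cases h : lam = ∞
  · refine ⟨1 / 2, 0, by norm_num, le_rfl, by norm_num, by simp [instrWeight, h], ?_, ?_⟩ <;>
    · simp only [instrWeight, h, if_true]
      rw [ENNReal.ofReal_div_of_pos (by norm_num)]
      simp
  · lift lam to NNReal using h
    have hl : (0 : ℝ) ≤ lam := lam.2
    have e : ∀ r : ℝ, ENNReal.ofReal (1 / (2 * (1 + (lam : ℝ)))) = 1 / (2 * (1 + (lam : ℝ≥0∞))) := by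
      intro _
      rw [ENNReal.ofReal_div_of_pos (by positivity), ENNReal.ofReal_mul (by norm_num),
        ENNReal.ofReal_add (by norm_num) hl]
      simp
    refine ⟨1 / (2 * (1 + lam)), lam / (1 + lam), by positivity, by positivity, ?_, ?_, ?_, ?_⟩
    · field_simp; ring
    · simp only [instrWeight, ENNReal.coe_ne_top, if_false]
      rw [ENNReal.ofReal_div_of_pos (by positivity), ENNReal.ofReal_add (by norm_num) hl]
      simp
    · simp only [instrWeight, ENNReal.coe_ne_top, if_false]
      exact (e 0).symm
    · simp only [instrWeight, ENNReal.coe_ne_top, if_false]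
      exact (e 0).symm

instance (lam : ℝ≥0∞) : IsProbabilityMeasure (stackLaw lam) := by
  unfold stackLaw; infer_instance

theorem instrLaw_singleton (lam : ℝ≥0∞) (i : Instr) :
    instrLaw lam {i} = instrWeight lam i := by
  cases i <;> simp [instrLaw]

theorem measurable_shiftBy (v : ℤ → ℕ) : Measurable (shiftBy v) :=
  measurable_pi_iff.2 fun p => measurable_pi_apply (p.1, p.2 + v p.1)

/-- The shifted stacks have the same law. -/
theorem measurePreserving_shiftBy (lam : ℝ≥0∞) (v : ℤ → ℕ) :
    MeasurePreserving (shiftBy v) (stackLaw lam) (stackLaw lam) := by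
  refine ⟨measurable_shiftBy v, ?_⟩
  have hinj : Function.Injective fun p : ℤ × ℕ => (p.1, p.2 + v p.1) := by
    rintro ⟨a, b⟩ ⟨c, d⟩ h
    simp only [Prod.mk.injEq] at h ⊢
    obtain ⟨rfl, h⟩ := h
    exact ⟨rfl, by omega⟩
  exact Measure.map_infinitePi_infinitePi_of_inj (P := fun _ : ℤ × ℕ => instrLaw lam) hinj

/-- The first instruction at `x` is independent of the remaining instructions. -/
theorem stackLaw_first (lam : ℝ≥0∞) (x : ℤ) (i : Instr) {E : Set Stacks} (hE : MeasurableSet E) :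
    stackLaw lam ({ρ | ρ (x, 0) = i} ∩ shiftBy (Pi.single x 1) ⁻¹' E)
      = instrWeight lam i * stackLaw lam E := by
  have hind : iIndepFun (fun (p : ℤ × ℕ) (ρ : Stacks) => ρ p) (stackLaw lam) :=
    iIndepFun_infinitePi (X := fun _ i => i) fun _ => measurable_id
  have hI := indep_iSup_of_disjoint
    (m := fun p : ℤ × ℕ => MeasurableSpace.comap (fun ρ : Stacks => ρ p) inferInstance)
    (fun p => (measurable_pi_apply p).comap_le) hind (S := {(x, 0)}) (T := {(x, 0)}ᶜ)
    disjoint_compl_right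
  have h1 : MeasurableSet[⨆ p ∈ ({(x, 0)} : Set (ℤ × ℕ)),
      MeasurableSpace.comap (fun ρ : Stacks => ρ p) inferInstance] {ρ : Stacks | ρ (x, 0) = i} := by
    refine le_biSup (fun p : ℤ × ℕ => MeasurableSpace.comap (fun ρ : Stacks => ρ p) inferInstance)
      (Set.mem_singleton _) _ ?_
    exact ⟨{i}, trivial, rfl⟩
  have h2 : MeasurableSet[⨆ p ∈ ({(x, 0)}ᶜ : Set (ℤ × ℕ)),
      MeasurableSpace.comap (fun ρ : Stacks => ρ p) inferInstance]
      (shiftBy (Pi.single x 1) ⁻¹' E) := by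
    refine Measurable.of_comap_le ?_ |> fun (h : @Measurable _ _ (⨆ p ∈ ({(x, 0)}ᶜ : Set (ℤ × ℕ)),
      MeasurableSpace.comap (fun ρ : Stacks => ρ p) inferInstance) _
      (shiftBy (Pi.single x 1))) => h hE
    rw [MeasurableSpace.pi, MeasurableSpace.comap_iSup]
    refine iSup_le fun p => ?_
    rw [MeasurableSpace.comap_comp]
    refine le_biSup (fun p : ℤ × ℕ => MeasurableSpace.comap (fun ρ : Stacks => ρ p) inferInstance)
      (i := (p.1, p.2 + (Pi.single x 1 : ℤ → ℕ) p.1)) ?_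
    simp only [Set.mem_compl_iff, Set.mem_singleton_iff, Prod.mk.injEq, not_and]
    intro h
    rw [h]
    simp
  rw [(Indep_iff _ _ _).1 hI _ _ h1 h2]
  congr 1
  · have := (measurePreserving_eval_infinitePi (fun _ : ℤ × ℕ => instrLaw lam) (x, 0)).measure_preimage
      (s := {i}) (MeasurableSet.nullMeasurableSet trivial)
    rw [instrLaw_singleton] at this
    exact this
  · exact (measurePreserving_shiftBy lam _).measure_preimage hE.nullMeasurableSet

/-- First step analysis. -/
theorem stackLaw_step (lam : ℝ≥0∞) (x : ℤ) (C : Instr → Set Stacks) :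
    stackLaw lam {ρ | shiftBy (Pi.single x 1) ρ ∈ C (ρ (x, 0))} ≤
      instrWeight lam .sleep * stackLaw lam (C .sleep)
      + instrWeight lam .left * stackLaw lam (C .left)
      + instrWeight lam .right * stackLaw lam (C .right) := by
  -- The sets C i are arbitrary, while independence is about measurable sets; measurable hulls
  -- bridge the gap.
  have hsub : {ρ | shiftBy (Pi.single x 1) ρ ∈ C (ρ (x, 0))} ⊆
      (({ρ | ρ (x, 0) = .sleep} ∩ shiftBy (Pi.single x 1) ⁻¹' (toMeasurable (stackLaw lam) (C .sleep)))
      ∪ ({ρ | ρ (x, 0) = .left} ∩ shiftBy (Pi.single x 1) ⁻¹' (toMeasurable (stackLaw lam) (C .left))))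
      ∪ ({ρ | ρ (x, 0) = .right} ∩
        shiftBy (Pi.single x 1) ⁻¹' (toMeasurable (stackLaw lam) (C .right))) := by
    intro ρ hρ
    have h : shiftBy (Pi.single x 1) ρ ∈ C (ρ (x, 0)) := hρ
    cases hi : ρ (x, 0) with
    | sleep =>
      rw [hi] at h
      exact Or.inl (Or.inl ⟨hi, subset_toMeasurable _ _ h⟩)
    | left =>
      rw [hi] at h
      exact Or.inl (Or.inr ⟨hi, subset_toMeasurable _ _ h⟩)
    | right =>
      rw [hi] at h
      exact Or.inr ⟨hi, subset_toMeasurable _ _ h⟩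
  refine (measure_mono hsub).trans ((measure_union_le _ _).trans
    (add_le_add ((measure_union_le _ _).trans (add_le_add ?_ ?_)) ?_)) <;>
  · rw [stackLaw_first lam x _ (measurableSet_toMeasurable _ _), measure_toMeasurable]

/-! ### Running the dynamics -/

open Classical in
/-- The first `t` firings of a legal sequence chosen according to the current configuration. -/
def run (lam : ℝ≥0∞) (D : Set ℤ) : ℕ → Config → Stacks → List ℤ
  | 0, _, _ => []
  | t + 1, c, ρ => if h : ∃ x ∈ D, Unstable lam (c x) then
      h.choose :: run lam D t (execute D h.choose c (ρ (h.choose, 0)))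
        (shiftBy (Pi.single h.choose 1) ρ)
    else []

theorem fire_init (D : Set ℤ) (ρ : Stacks) (c : Config) (x : ℤ) :
    fire D ρ (State.init c) x = ⟨execute D x c (ρ (x, 0)), Pi.single x 1 + 0⟩ := by
  simp only [fire, State.init, State.mk.injEq]
  refine ⟨rfl, ?_⟩
  funext y
  by_cases h : y = x
  · subst h; simp
  · simp [h]

theorem legal_cons_shift {lam : ℝ≥0∞} {D : Set ℤ} {ρ : Stacks} {c : Config} {x : ℤ}
    {α : List ℤ} : Legal lam D ρ (State.init c) (x :: α) ↔ x ∈ D ∧ Unstable lam (c x) ∧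
      Legal lam D (shiftBy (Pi.single x 1) ρ) (State.init (execute D x c (ρ (x, 0)))) α := by
  simp only [Legal, fire_init]
  rw [legal_shift]
  rfl

theorem fireSeq_cons_shift (D : Set ℤ) (ρ : Stacks) (c : Config) (x : ℤ) (α : List ℤ) :
    (fireSeq D ρ (State.init c) (x :: α)).config
      = (fireSeq D (shiftBy (Pi.single x 1) ρ) (State.init (execute D x c (ρ (x, 0)))) α).config := by
  have : fireSeq D ρ (State.init c) (x :: α) = fireSeq D ρ (fire D ρ (State.init c) x) α := rfl
  rw [this, fire_init, fireSeq_shift]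
  rfl

theorem run_legal (lam : ℝ≥0∞) (D : Set ℤ) (t : ℕ) (c : Config) (ρ : Stacks) :
    Legal lam D ρ (State.init c) (run lam D t c ρ) := by
  induction t generalizing c ρ with
  | zero => trivial
  | succ t ih =>
    rw [run]
    split_ifs with h
    · rw [legal_cons_shift]
      exact ⟨h.choose_spec.1, h.choose_spec.2, ih _ _⟩
    · trivial

theorem run_stable {lam : ℝ≥0∞} {D : Set ℤ} {t : ℕ} {c : Config} {ρ : Stacks}
    (hl : (run lam D t c ρ).length < t) {x : ℤ} (hx : x ∈ D) :
    ¬ Unstable lam ((fireSeq D ρ (State.init c) (run lam D t c ρ)).config x) := by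
  induction t generalizing c ρ with
  | zero => simp at hl
  | succ t ih =>
    rw [run] at hl ⊢
    split_ifs at hl ⊢ with h
    · rw [fireSeq_cons_shift]
      exact ih (by simpa using hl)
    · exact fun hc => h ⟨x, hx, hc⟩

/-- A time budget exceeding the total odometer is never exhausted, so the run is a complete
stabilization. -/
theorem run_odo {lam : ℝ≥0∞} {D : Set ℤ} {ρ : Stacks} {η u : ℤ → ℕ} (hu : IsOdo lam D ρ η u)
    {F : Finset ℤ} (hF : D ⊆ F) {t : ℕ} (ht : ∑ x ∈ F, u x < t) :
    (run lam D t (act η) ρ).length < t ∧ odo (run lam D t (act η) ρ) = u := by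
  have h1 := Legal.length_le hu.stab (F := F) (fun x hx => hu.stab.off x fun h => hx (hF h))
    (run_legal lam D t (act η) ρ)
  have h2 := lt_of_le_of_lt h1 ht
  refine ⟨h2, IsOdo.unique ⟨_, ⟨run_legal lam D t (act η) ρ, fun x hx => run_stable h2 hx⟩, rfl⟩ hu⟩

theorem run_length_le (lam : ℝ≥0∞) (D : Set ℤ) (t : ℕ) (c : Config) (ρ : Stacks) :
    (run lam D t c ρ).length ≤ t := by
  induction t generalizing c ρ with
  | zero => simp [run]
  | succ t ih =>
    rw [run]
    split_ifs with h
    · simpa using ih _ _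
    · simp

theorem odo_cons (x : ℤ) (α : List ℤ) : odo (x :: α) = Pi.single x 1 + odo α := by
  funext y
  by_cases h : y = x
  · subst h; simp [odo, add_comm]
  · have : x ≠ y := fun e => h e.symm
    simp [odo, h, this]

theorem shiftBy_add (v w : ℤ → ℕ) (ρ : Stacks) : shiftBy (v + w) ρ = shiftBy w (shiftBy v ρ) := by
  funext p
  simp only [shiftBy, Pi.add_apply]
  congr 2
  omega

theorem weights_sum (lam : ℝ≥0∞) (q : ℝ≥0∞) :
    instrWeight lam .sleep * q + instrWeight lam .left * q + instrWeight lam .right * q = q := by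
  obtain ⟨p, s, hp, hs, h1, e1, e2, e3⟩ := exists_weights lam
  rw [e1, e2, e3, ← add_mul, ← add_mul, ← ENNReal.ofReal_add hs hp.le,
    ← ENNReal.ofReal_add (by positivity) hp.le]
  have : s + p + p = 1 := by linarith
  rw [this]
  simp

/-- At the end of a run, the unused instructions are fresh. -/
theorem fresh_after_run {lam lam' : ℝ≥0∞} {D : Set ℤ} {B : Config → Set Stacks} {q : ℝ≥0∞}
    (hB : ∀ c, stackLaw lam (B c) ≤ q) (t : ℕ) (c : Config) :
    stackLaw lam {ρ | (run lam' D t c ρ).length < t ∧ shiftBy (odo (run lam' D t c ρ)) ρ ∈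
      B (fireSeq D ρ (State.init c) (run lam' D t c ρ)).config} ≤ q := by
  induction t generalizing c with
  | zero => simp
  | succ t ih =>
    by_cases h : ∃ x ∈ D, Unstable lam' (c x)
    -- Given that the first instruction is i, the remaining stacks are fresh and the run continues
    -- from the new configuration. The induction hypothesis applies to each i, and the weights add
    -- up to one.
    · refine le_trans ?_ ((stackLaw_step lam h.choose fun i =>
        {ρ | (run lam' D t (execute D h.choose c i) ρ).length < t ∧
          shiftBy (odo (run lam' D t (execute D h.choose c i) ρ)) ρ ∈
          B (fireSeq D ρ (State.init (execute D h.choose c i))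
            (run lam' D t (execute D h.choose c i) ρ)).config}).trans
        ((add_le_add (add_le_add (mul_le_mul_right (ih _) _) (mul_le_mul_right (ih _) _))
          (mul_le_mul_right (ih _) _)).trans (weights_sum lam q).le))
      refine measure_mono fun ρ hρ => ?_
      obtain ⟨h1, h2⟩ := hρ
      rw [run, dif_pos h] at h1 h2
      rw [fireSeq_cons_shift, odo_cons, shiftBy_add] at h2
      exact ⟨by simpa using h1, h2⟩
    · refine le_trans (measure_mono fun ρ hρ => ?_) (hB c)
      have h2 := hρ.2
      rw [run, dif_neg h] at h2
      exact h2

/-- Induction step for exponential bounds: f i bounds the problem left after the instruction i, and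
the last hypothesis is the supermartingale inequality. -/
theorem stackLaw_le_of_step {lam : ℝ≥0∞} {p s q : ℝ} (hp : 0 < p) (hs : 0 ≤ s)
    (e1 : instrWeight lam .sleep = ENNReal.ofReal s)
    (e2 : instrWeight lam .left = ENNReal.ofReal p)
    (e3 : instrWeight lam .right = ENNReal.ofReal p) {E : Set Stacks} (x : ℤ)
    (C : Instr → Set Stacks) (hE : ∀ ρ ∈ E, shiftBy (Pi.single x 1) ρ ∈ C (ρ (x, 0)))
    (f : Instr → ℝ) (hf : ∀ i, 0 ≤ f i) (hC : ∀ i, stackLaw lam (C i) ≤ ENNReal.ofReal (f i))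
    (h : s * f .sleep + p * f .left + p * f .right ≤ q) :
    stackLaw lam E ≤ ENNReal.ofReal q := by
  have hsub : E ⊆ {ρ | shiftBy (Pi.single x 1) ρ ∈ C (ρ (x, 0))} := hE
  refine (measure_mono hsub).trans ((stackLaw_step lam x C).trans ?_)
  refine (add_le_add (add_le_add (mul_le_mul_right (hC _) _) (mul_le_mul_right (hC _) _))
    (mul_le_mul_right (hC _) _)).trans ?_
  have p1 := mul_nonneg hs (hf .sleep)
  have p2 := mul_nonneg hp.le (hf .left)
  have p3 := mul_nonneg hp.le (hf .right)
  rw [e1, e2, e3, ← ENNReal.ofReal_mul hs, ← ENNReal.ofReal_mul hp.le, ← ENNReal.ofReal_mul hp.le,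
    ← ENNReal.ofReal_add p1 p2, ← ENNReal.ofReal_add (add_nonneg p1 p2) p3]
  exact ENNReal.ofReal_le_ofReal h

/-! ### Concentration bounds -/

/-- The displacement of an instruction. -/
def Instr.disp (i : Instr) : ℤ := i.toRight - i.toLeft

theorem sum_net_cons (ρ : Stacks) (x : ℤ) (α : List ℤ) (A : Finset ℤ) :
    ∑ y ∈ A, net ρ y (odo (x :: α) y) = (if x ∈ A then (ρ (x, 0)).disp else 0)
      + ∑ y ∈ A, net (shiftBy (Pi.single x 1) ρ) y (odo α y) := by
  have : ∀ y, net ρ y (odo (x :: α) y) = (if y = x then (ρ (x, 0)).disp else 0)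
      + net (shiftBy (Pi.single x 1) ρ) y (odo α y) := by
    intro y
    rw [odo_cons]
    unfold net
    rw [Pi.add_apply, rights_add, lefts_add]
    by_cases h : y = x
    · subst h
      simp [Instr.disp, rights, lefts]
      ring
    · simp [h]
  simp_rw [this, Finset.sum_add_distrib, Finset.sum_ite_eq']

theorem sum_odo_cons (x : ℤ) (α : List ℤ) (A : Finset ℤ) :
    ∑ y ∈ A, odo (x :: α) y = (if x ∈ A then 1 else 0) + ∑ y ∈ A, odo α y := by
  rw [odo_cons]
  simp only [Pi.add_apply, Finset.sum_add_distrib]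
  congr 1
  simp [Pi.single_apply]

/-- With S the signed displacement and V the number of firings in A, exp(θS - θ²V/2) is a
supermartingale along the run. Instead of stopping times, the thresholds a and T are shifted by each
instruction and the proof is by induction on t. -/
theorem run_net_bound (lam lam' : ℝ≥0∞) (D : Set ℤ) (A : Finset ℤ) {σ θ : ℝ} (hσ : σ = 1 ∨ σ = -1)
    (hθ : 0 ≤ θ) (t : ℕ) (c : Config) (a T : ℝ) :
    stackLaw lam {ρ | a ≤ σ * ((∑ y ∈ A, net ρ y (odo (run lam' D t c ρ) y) : ℤ) : ℝ) ∧
      ((∑ y ∈ A, odo (run lam' D t c ρ) y : ℕ) : ℝ) ≤ T}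
      ≤ ENNReal.ofReal (Real.exp (-θ * a + θ ^ 2 * T / 2)) := by
  have base : ∀ (c : Config) (a T : ℝ), a ≤ 0 → 0 ≤ T →
      ∀ E : Set Stacks, stackLaw lam E ≤ ENNReal.ofReal (Real.exp (-θ * a + θ ^ 2 * T / 2)) := by
    intro c a T ha hT E
    refine prob_le_one.trans ?_
    rw [← ENNReal.ofReal_one]
    refine ENNReal.ofReal_le_ofReal (Real.one_le_exp ?_)
    have : 0 ≤ θ * -a := mul_nonneg hθ (by linarith)
    have : 0 ≤ θ ^ 2 * T / 2 := by positivity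
    linarith
  have nilcase : ∀ (c : Config) (a T : ℝ), stackLaw lam {ρ |
      a ≤ σ * ((∑ y ∈ A, net ρ y (odo [] y) : ℤ) : ℝ) ∧ ((∑ y ∈ A, odo [] y : ℕ) : ℝ) ≤ T}
      ≤ ENNReal.ofReal (Real.exp (-θ * a + θ ^ 2 * T / 2)) := by
    intro c a T
    by_cases h : a ≤ 0 ∧ 0 ≤ T
    · exact base c a T h.1 h.2 _
    · refine le_of_eq_of_le ?_ zero_le
      convert measure_empty (μ := stackLaw lam)
      ext ρ
      simp only [Set.mem_ofPred_eq, Set.mem_empty_iff_false, iff_false]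
      intro hh
      apply h
      simpa [odo, net] using hh
  induction t generalizing c a T with
  | zero => exact nilcase c a T
  | succ t ih =>
    by_cases h : ∃ x ∈ D, Unstable lam' (c x)
    · obtain ⟨p, s, hp, hs, h1, e1, e2, e3⟩ := exists_weights lam
      set x := h.choose with hx
      set δ : ℝ := if x ∈ A then 1 else 0 with hδ
      set C : Instr → Set Stacks := fun i => {ρ |
        a - δ * σ * i.disp ≤ σ * ((∑ y ∈ A, net ρ y (odo (run lam' D t (execute D x c i) ρ) y) : ℤ) : ℝ) ∧
        ((∑ y ∈ A, odo (run lam' D t (execute D x c i) ρ) y : ℕ) : ℝ) ≤ T - δ} with hC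
      have hCb : ∀ i, stackLaw lam (C i) ≤ ENNReal.ofReal
          (Real.exp (-θ * (a - δ * σ * i.disp) + θ ^ 2 * (T - δ) / 2)) :=
        fun i => ih (execute D x c i) (a - δ * σ * i.disp) (T - δ)
      refine stackLaw_le_of_step hp hs e1 e2 e3 x C ?_ _ (fun i => Real.exp_nonneg _) hCb ?_
      · intro ρ hρ
        obtain ⟨h1, h2⟩ := hρ
        rw [run, dif_pos h, sum_net_cons] at h1
        rw [run, dif_pos h, sum_odo_cons] at h2
        simp only [hC, Set.mem_ofPred_eq]
        rw [← hx] at h1 h2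
        push_cast at h1 h2 ⊢
        constructor
        · by_cases hxA : x ∈ A
          · simp only [hδ, hxA, if_true] at h1 ⊢
            linarith
          · simp only [hδ, hxA, if_false] at h1 ⊢
            linarith
        · by_cases hxA : x ∈ A
          · simp only [hδ, hxA, if_true] at h2 ⊢
            linarith
          · simp only [hδ, hxA, if_false] at h2 ⊢
            linarith
      -- For a firing in A the left side is s + 2p cosh θ ≤ cosh θ ≤ exp(θ²/2): sleep instructions
      -- only reduce the fluctuations.
      · have key : s + p * Real.exp (-(θ * δ * σ)) + p * Real.exp (θ * δ * σ)
            ≤ Real.exp (θ ^ 2 * δ / 2) := by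
          have hδ2 : δ = 0 ∨ δ = 1 := by
            simp only [hδ]; split_ifs <;> simp
          rcases hδ2 with h0 | h0
          · rw [h0]; simp; linarith
          · rw [h0]
            have hc := Real.cosh_le_exp_half_sq θ
            have hc1 := Real.one_le_cosh θ
            rw [Real.cosh_eq] at hc hc1
            have : Real.exp (-(θ * 1 * σ)) + Real.exp (θ * 1 * σ)
                = Real.exp θ + Real.exp (-θ) := by
              rcases hσ with rfl | rfl <;> simp [add_comm]
            have e : θ ^ 2 * 1 / 2 = θ ^ 2 / 2 := by ring
            rw [e]
            nlinarith
        have f : ∀ d : ℝ, Real.exp (-θ * (a - δ * σ * d) + θ ^ 2 * (T - δ) / 2)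
            = Real.exp (-θ * a + θ ^ 2 * T / 2) * Real.exp (-(θ ^ 2 * δ / 2))
              * Real.exp (θ * δ * σ * d) := by
          intro d
          rw [← Real.exp_add, ← Real.exp_add]
          congr 1
          ring
        have d1 : ((Instr.disp .sleep : ℤ) : ℝ) = 0 := by simp [Instr.disp, Instr.toRight, Instr.toLeft]
        have d2 : ((Instr.disp .left : ℤ) : ℝ) = -1 := by simp [Instr.disp, Instr.toRight, Instr.toLeft]
        have d3 : ((Instr.disp .right : ℤ) : ℝ) = 1 := by simp [Instr.disp, Instr.toRight, Instr.toLeft]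
        rw [f, f, f, d1, d2, d3, mul_zero, Real.exp_zero, mul_one, mul_one, mul_neg, mul_one]
        have hinv : Real.exp (-(θ ^ 2 * δ / 2)) * Real.exp (θ ^ 2 * δ / 2) = 1 := by
          rw [← Real.exp_add]; simp
        have h5 := mul_le_mul_of_nonneg_left key
          (mul_nonneg (Real.exp_nonneg (-θ * a + θ ^ 2 * T / 2))
            (Real.exp_nonneg (-(θ ^ 2 * δ / 2))))
        rw [mul_assoc _ _ (Real.exp (θ ^ 2 * δ / 2)), hinv, mul_one] at h5
        refine le_trans (le_of_eq ?_) h5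
        ring
    · have : ∀ ρ, run lam' D (t + 1) c ρ = [] := fun ρ => by rw [run, dif_neg h]
      simp only [this]
      exact nilcase c a T

/-- The odometer is balanced: right steps minus left steps from the sites of `A` concentrate. -/
theorem net_bound (lam lam' : ℝ≥0∞) (D : Finset ℤ) (A : Finset ℤ) (η : ℤ → ℕ) (t : ℕ) {a T : ℝ}
    (ha : 0 ≤ a) (hT : 0 < T) :
    stackLaw lam {ρ | ∃ u, IsOdo lam' D ρ η u ∧ ∑ x ∈ D, u x < t ∧
      a ≤ |((∑ y ∈ A, net ρ y (u y) : ℤ) : ℝ)| ∧ ((∑ y ∈ A, u y : ℕ) : ℝ) ≤ T}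
      ≤ 2 * ENNReal.ofReal (Real.exp (-a ^ 2 / (2 * T))) := by
  -- The value θ = a/T minimizes the exponent -θa + θ²T/2.
  have hθ : 0 ≤ a / T := by positivity
  have e : -(a / T) * a + (a / T) ^ 2 * T / 2 = -a ^ 2 / (2 * T) := by field_simp; ring
  have h1 := run_net_bound lam lam' D A (σ := 1) (Or.inl rfl) hθ t (act η) a T
  have h2 := run_net_bound lam lam' D A (σ := -1) (Or.inr rfl) hθ t (act η) a T
  rw [e] at h1 h2
  rw [two_mul]
  refine le_trans (measure_mono ?_) ((measure_union_le _ _).trans (add_le_add h1 h2))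
  rintro ρ ⟨u, hu, ht, hn, hV⟩
  obtain ⟨-, hr⟩ := run_odo hu (F := D) le_rfl ht
  simp only [Set.mem_union, Set.mem_ofPred_eq, hr]
  rcases le_abs.1 hn with h | h
  · left; exact ⟨by linarith, hV⟩
  · right; exact ⟨by linarith, hV⟩

/-- The quadratic potential on `[a, b]`, vanishing at `a - 1` and `b + 1`. -/
def pot (a b x : ℤ) : ℤ := (x - a + 1) * (b + 1 - x)

theorem pot_nonneg {a b x : ℤ} (h : x ∈ Finset.Icc a b) : 0 ≤ pot a b x := by
  rw [Finset.mem_Icc] at h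
  exact mul_nonneg (by omega) (by omega)

/-- The total potential of a configuration. -/
def Pot (a b : ℤ) (c : Config) : ℤ := ∑ x ∈ Finset.Icc a b, ((c x).size : ℤ) * pot a b x

/-- The potential has second difference -2, so a step lowers it by 1 on average. As it vanishes at
both sites next to the interval, a killed particle obeys the same formula. -/
theorem Pot_execute {lam : ℝ≥0∞} {a b x : ℤ} {c : Config} (hx : x ∈ Finset.Icc a b)
    (h : Unstable lam (c x)) (i : Instr) :
    Pot a b (execute (Finset.Icc a b : Finset ℤ) x c i) = Pot a b c
      + (i.toRight : ℤ) * (a + b - 2 * x - 1) - (i.toLeft : ℤ) * (a + b - 2 * x + 1) := by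
  unfold Pot
  have : ∀ y ∈ Finset.Icc a b,
      ((execute (Finset.Icc a b : Finset ℤ) x c i y).size : ℤ) * pot a b y
      = ((c y).size : ℤ) * pot a b y + (if y = x + 1 then (i.toRight : ℤ) * pot a b (x + 1) else 0)
      + (if y = x - 1 then (i.toLeft : ℤ) * pot a b (x - 1) else 0)
      - (if y = x then (i.toRight + i.toLeft : ℤ) * pot a b x else 0) := by
    intro y hy
    rw [execute_size (by exact_mod_cast hx) h i (by exact_mod_cast hy), sub_mul, add_mul, add_mul]
    congr 1
    · congr 1
      · congr 1
        split_ifs with e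
        · rw [e]
        · simp
      · split_ifs with e
        · rw [e]
        · simp
    · split_ifs with e
      · rw [e]
      · simp
  rw [Finset.sum_congr rfl this, Finset.sum_sub_distrib, Finset.sum_add_distrib,
    Finset.sum_add_distrib, Finset.sum_ite_eq', Finset.sum_ite_eq', Finset.sum_ite_eq', if_pos hx]
  rw [Finset.mem_Icc] at hx
  have r : (if x + 1 ∈ Finset.Icc a b then (i.toRight : ℤ) * pot a b (x + 1) else 0)
      = (i.toRight : ℤ) * pot a b (x + 1) := by
    split_ifs with e
    · rfl
    · have : x = b := by rw [Finset.mem_Icc] at e; omega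
      subst this; simp [pot]
  have l : (if x - 1 ∈ Finset.Icc a b then (i.toLeft : ℤ) * pot a b (x - 1) else 0)
      = (i.toLeft : ℤ) * pot a b (x - 1) := by
    split_ifs with e
    · rfl
    · have : x = a := by rw [Finset.mem_Icc] at e; omega
      subst this; simp [pot]
  rw [r, l]
  unfold pot
  ring

theorem Pot_nonneg (a b : ℤ) (c : Config) : 0 ≤ Pot a b c :=
  Finset.sum_nonneg fun _ hx => mul_nonneg (by positivity) (pot_nonneg hx)

/-- With θ = 1/L², the potential changes by -1 ± m at a step, and cosh(mθ) ≤ exp(θ/2) because m² ≤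
L². Half of the drift survives: steps contribute at most 2p exp(-θ/2) ≤ 2p(1 - θ/4). -/
theorem exp_drift {p s L m : ℝ} (hp : 0 < p) (hs : 0 ≤ s) (h1 : s + 2 * p = 1) (hL : 1 ≤ L)
    (hm : |m| ≤ L) :
    s + p * Real.exp ((-1 - m) / L ^ 2) + p * Real.exp ((-1 + m) / L ^ 2)
      ≤ Real.exp (-(p / 2) / L ^ 2) := by
  have hL0 : 0 < L := by linarith
  set θ := 1 / L ^ 2 with hθ
  have hθ0 : 0 < θ := by positivity
  have hθ1 : θ ≤ 1 := by
    rw [hθ, div_le_one (by positivity)]; nlinarith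
  have e1 : (-1 - m) / L ^ 2 = -θ + -(m * θ) := by rw [hθ]; ring
  have e2 : (-1 + m) / L ^ 2 = -θ + m * θ := by rw [hθ]; ring
  have e3 : -(p / 2) / L ^ 2 = -(p * θ / 2) := by rw [hθ]; ring
  rw [e1, e2, e3, Real.exp_add, Real.exp_add]
  have hc := Real.cosh_le_exp_half_sq (m * θ)
  rw [Real.cosh_eq] at hc
  have hsq : (m * θ) ^ 2 / 2 ≤ θ / 2 := by
    have : m ^ 2 ≤ L ^ 2 := sq_le_sq' (by linarith [abs_le.1 hm]) (by linarith [abs_le.1 hm])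
    have : m ^ 2 * θ ≤ 1 := by
      rw [hθ, mul_one_div, div_le_one (by positivity)]; exact this
    nlinarith
  have hc2 : Real.exp (-θ) * ((Real.exp (m * θ) + Real.exp (-(m * θ))) / 2)
      ≤ Real.exp (-(θ / 2)) := by
    refine (mul_le_mul_of_nonneg_left (hc.trans (Real.exp_le_exp.2 hsq)) (Real.exp_nonneg _)).trans ?_
    rw [← Real.exp_add]
    exact Real.exp_le_exp.2 (by linarith)
  have hq : Real.exp (-(θ / 2)) ≤ 1 - θ / 4 := by
    have h := Real.add_one_le_exp (θ / 2)
    have h3 : Real.exp (-(θ / 2)) * Real.exp (θ / 2) = 1 := by rw [← Real.exp_add]; simp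
    have h4 := Real.exp_pos (-(θ / 2))
    nlinarith
  have hf := Real.add_one_le_exp (-(p * θ / 2))
  nlinarith

/-- Each firing multiplies the expectation of exp(Pot/L²) by at most exp(-(p/2)/L²), while the
potential never becomes negative; so t firings are unlikely once (p/2)t exceeds the initial
potential. -/
theorem run_length_bound {lam : ℝ≥0∞} {p s : ℝ} (hp : 0 < p) (hs : 0 ≤ s) (h1 : s + 2 * p = 1)
    (e1 : instrWeight lam .sleep = ENNReal.ofReal s)
    (e2 : instrWeight lam .left = ENNReal.ofReal p)
    (e3 : instrWeight lam .right = ENNReal.ofReal p) (lam' : ℝ≥0∞) {a b : ℤ} {L : ℝ}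
    (hL1 : 1 ≤ L) (hL : (b - a : ℝ) ≤ L) (t : ℕ) (c : Config) :
    stackLaw lam {ρ | (run lam' (Finset.Icc a b : Finset ℤ) t c ρ).length = t}
      ≤ ENNReal.ofReal (Real.exp ((Pot a b c - p / 2 * t) / L ^ 2)) := by
  induction t generalizing c with
  | zero =>
    refine prob_le_one.trans ?_
    rw [← ENNReal.ofReal_one]
    refine ENNReal.ofReal_le_ofReal (Real.one_le_exp ?_)
    have : (0 : ℝ) ≤ Pot a b c := by exact_mod_cast Pot_nonneg a b c
    simp only [Nat.cast_zero, mul_zero, sub_zero]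
    positivity
  | succ t ih =>
    by_cases h' : ∃ x ∈ ((Finset.Icc a b : Finset ℤ) : Set ℤ), Unstable lam' (c x)
    · have hx := h'.choose_spec.1
      have hxu := h'.choose_spec.2
      set x := h'.choose
      set C : Instr → Set Stacks := fun i => {ρ | (run lam' (Finset.Icc a b : Finset ℤ) t
          (execute (Finset.Icc a b : Finset ℤ) x c i) ρ).length = t} with hC
      refine stackLaw_le_of_step hp hs e1 e2 e3 x C ?_ _ (fun i => Real.exp_nonneg _)
        (fun i => ih (execute (Finset.Icc a b : Finset ℤ) x c i)) ?_
      · intro ρ hρ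
        simp only [hC, Set.mem_ofPred_eq] at hρ ⊢
        rw [run, dif_pos h', List.length_cons] at hρ
        exact Nat.succ_injective hρ
      · have hx' : x ∈ Finset.Icc a b := by exact_mod_cast hx
        rw [Pot_execute hx' hxu, Pot_execute hx' hxu, Pot_execute hx' hxu]
        have hm : |(a + b - 2 * x : ℝ)| ≤ L := by
          rw [Finset.mem_Icc] at hx'
          have ha : (a : ℝ) ≤ x := by exact_mod_cast hx'.1
          have hb : (x : ℝ) ≤ b := by exact_mod_cast hx'.2
          rw [abs_le]
          constructor <;> linarith
        have key := exp_drift hp hs h1 hL1 hm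
        simp only [Instr.toRight, Instr.toLeft]
        push_cast
        have f1 : ((Pot a b c + 0 * (a + b - 2 * x - 1) - 0 * (a + b - 2 * x + 1) : ℝ) - p / 2 * t)
            / L ^ 2 = (Pot a b c - p / 2 * t) / L ^ 2 := by ring
        have f2 : ((Pot a b c + 0 * (a + b - 2 * x - 1) - 1 * (a + b - 2 * x + 1) : ℝ) - p / 2 * t)
            / L ^ 2 = (Pot a b c - p / 2 * t) / L ^ 2 + (-1 - (a + b - 2 * x)) / L ^ 2 := by ring
        have f3 : ((Pot a b c + 1 * (a + b - 2 * x - 1) - 0 * (a + b - 2 * x + 1) : ℝ) - p / 2 * t)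
            / L ^ 2 = (Pot a b c - p / 2 * t) / L ^ 2 + (-1 + (a + b - 2 * x)) / L ^ 2 := by ring
        have f4 : (Pot a b c - p / 2 * (t + 1)) / L ^ 2
            = (Pot a b c - p / 2 * t) / L ^ 2 + -(p / 2) / L ^ 2 := by ring
        rw [f1, f2, f3, f4, Real.exp_add, Real.exp_add, Real.exp_add]
        have := mul_le_mul_of_nonneg_left key
          (Real.exp_nonneg ((Pot a b c - p / 2 * t) / L ^ 2))
        linarith
    · have : ∀ ρ, run lam' (Finset.Icc a b : Finset ℤ) (t + 1) c ρ = [] :=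
        fun ρ => by rw [run, dif_neg h']
      simp only [this]
      simp

/-- The potential of a configuration of active particles. -/
def potOf (a b : ℤ) (η : ℤ → ℕ) : ℤ := ∑ x ∈ Finset.Icc a b, (η x : ℤ) * pot a b x

/-- Tail bound for the total number of firings. -/
theorem total_bound {lam : ℝ≥0∞} {p s : ℝ} (hp : 0 < p) (hs : 0 ≤ s) (h1 : s + 2 * p = 1)
    (e1 : instrWeight lam .sleep = ENNReal.ofReal s)
    (e2 : instrWeight lam .left = ENNReal.ofReal p)
    (e3 : instrWeight lam .right = ENNReal.ofReal p) (lam' : ℝ≥0∞) {a b : ℤ} {L : ℝ}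
    (hL1 : 1 ≤ L) (hL : (b - a : ℝ) ≤ L) (η : ℤ → ℕ) (t : ℕ) :
    stackLaw lam {ρ | ¬ ∃ u, IsOdo lam' (Finset.Icc a b : Finset ℤ) ρ η u ∧
      ∑ x ∈ Finset.Icc a b, u x < t}
      ≤ ENNReal.ofReal (Real.exp ((potOf a b η - p / 2 * t) / L ^ 2)) := by
  have := run_length_bound hp hs h1 e1 e2 e3 lam' hL1 hL t (act η)
  have e : Pot a b (act η) = potOf a b η := rfl
  rw [e] at this
  refine le_trans (measure_mono fun ρ hρ => ?_) this
  by_contra hc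
  have hlt := lt_of_le_of_ne (run_length_le lam' (Finset.Icc a b : Finset ℤ) t (act η) ρ) hc
  refine hρ ⟨odo (run lam' (Finset.Icc a b : Finset ℤ) t (act η) ρ),
    ⟨_, ⟨run_legal _ _ t (act η) ρ, fun x hx => run_stable hlt hx⟩, rfl⟩, ?_⟩
  rwa [← length_eq_sum_odo (F := Finset.Icc a b)
    (fun x hx => by exact_mod_cast (run_legal lam' (Finset.Icc a b : Finset ℤ) t (act η) ρ).mem x hx)]

/-- The instructions left unused by Internal DLA are fresh. -/
theorem fresh_after_top {lam : ℝ≥0∞} {D : Finset ℤ} {η : ℤ → ℕ} {B : (ℤ → ℕ) → Set Stacks}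
    {q : ℝ≥0∞} (hB : ∀ ξ, stackLaw lam (B ξ) ≤ q) (t : ℕ) :
    stackLaw lam {ρ | ∃ v, IsOdo ∞ D ρ η v ∧ ∑ x ∈ D, v x < t ∧
      shiftBy v ρ ∈ B (settle D ρ η v)} ≤ q := by
  refine le_trans (measure_mono ?_) (fresh_after_run (lam := lam) (lam' := ∞) (D := D)
    (B := fun c => B fun x => (c x).size) (fun c => hB _) t (act η))
  rintro ρ ⟨v, hv, ht, hb⟩
  obtain ⟨h1, h2⟩ := run_odo hv (F := D) le_rfl ht
  have h3 := (run_legal ∞ D t (act η) ρ).config_top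
  refine ⟨h1, ?_⟩
  rw [h3, h2]
  exact hb

/-! ### Filling an interval by Internal DLA -/

theorem sum_Icc_eq_sum_range {α : Type*} [AddCommMonoid α] (f : ℤ → α) (y : ℤ) (k : ℕ) :
    ∑ x ∈ Finset.Icc y (y + k - 1), f x = ∑ i ∈ Finset.range k, f (y + i) := by
  have : Finset.Icc y (y + k - 1) = (Finset.range k).map ⟨fun i : ℕ => y + i, fun i j h => by
      simpa using h⟩ := by
    ext x
    simp only [Finset.mem_Icc, Finset.mem_map, Finset.mem_range]
    constructor
    · rintro ⟨h1, h2⟩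
      exact ⟨(x - y).toNat, by omega, show y + ((x - y).toNat : ℤ) = x by omega⟩
    · rintro ⟨i, hi, rfl⟩
      change y ≤ y + (i : ℤ) ∧ y + (i : ℤ) ≤ _
      omega
  rw [this, Finset.sum_map]
  rfl

theorem card_Icc_block (y : ℤ) (k : ℕ) : (Finset.Icc y (y + k - 1)).card = k := by
  simp

theorem two_mul_sum_range_succ (k : ℕ) :
    2 * ∑ i ∈ Finset.range k, ((i : ℤ) + 1) = k * (k + 1) := by
  induction k with
  | zero => simp
  | succ k ih => rw [Finset.sum_range_succ, mul_add, ih]; push_cast; ring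

theorem single_sum (y : ℤ) (n k : ℕ) (hk : 0 < k) :
    ∑ i ∈ Finset.range k, ((i : ℤ) + 1) * (single y n (y + i) : ℤ) = n := by
  rw [Finset.sum_eq_single 0]
  · simp [single]
  · intro i _ hi
    simp [single, hi]
  · intro h
    exact absurd (Finset.mem_range.2 hk) h

/-- Internal DLA started from many particles at the left end fills the interval. -/
theorem fill_of_balanced {ρ : Stacks} {y : ℤ} {w l : ℕ} {v : ℤ → ℕ} (hl : 0 < l)
    (hv : IsOdo ∞ (Finset.Icc y (y + w - 1) : Finset ℤ) ρ (single y l) v)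
    (hbal : ∀ h : ℕ, h < w →
      2 * |∑ x ∈ Finset.Icc y (y + h - 1), net ρ x (v x)| + w * (w + 1) < 2 * l)
    {x : ℤ} (hx : x ∈ Finset.Icc y (y + w - 1)) : 1 ≤ cnt (single y l) ρ v x := by
  by_contra hc
  obtain ⟨-, e2, e3, e4⟩ := hv.empty (x := x) (by omega)
  rw [Finset.mem_Icc] at hx
  obtain ⟨h, rfl⟩ : ∃ h : ℕ, x = y + h := ⟨(x - y).toNat, by omega⟩
  have hh : h < w := by omega
  have hpos : 0 < h := by
    rcases Nat.eq_zero_or_pos h with rfl | h0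
    · simp [single] at e2; omega
    · exact h0
  have hb := hbal h hh
  -- If y + h is empty it was never visited, so nothing leaves the first h sites on the right. The
  -- first moment then gives l + net ≤ 1 + … + h, against the balance hypothesis.
  have key := sum_pos_cnt (single y l) ρ v y h
  rw [single_sum y l h hpos, e3] at key
  have o1 : v (y - 1) = 0 := hv.stab.off _ (by simp)
  have o2 : v (y + h) = 0 := by
    by_contra hne
    have := hv.one_le_cnt (y + h) (Or.inl (Nat.pos_of_ne_zero hne))
    omega
  rw [o1, o2, rights_zero, lefts_zero, ← sum_Icc_eq_sum_range (fun x => net ρ x (v x))] at key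
  have hle : ∑ i ∈ Finset.range h, ((i : ℤ) + 1) * cnt (single y l) ρ v (y + i)
      ≤ ∑ i ∈ Finset.range h, ((i : ℤ) + 1) := by
    refine Finset.sum_le_sum fun i hi => ?_
    rw [Finset.mem_range] at hi
    have := hv.cnt_le_one (x := y + i) (by
      rw [Finset.mem_coe, Finset.mem_Icc]; constructor <;> omega)
    nlinarith
  have h2 := two_mul_sum_range_succ h
  have h3 := neg_abs_le (∑ x ∈ Finset.Icc y (y + h - 1), net ρ x (v x))
  have h4 : (h : ℤ) * (h + 1) ≤ w * (w + 1) := by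
    have : (h : ℤ) ≤ w := by omega
    nlinarith
  push_cast at key
  linarith

/-! ### Propagation of the inner density -/

theorem IsOdo.congr {lam : ℝ≥0∞} {D : Set ℤ} {ρ : Stacks} {η η' u : ℤ → ℕ}
    (h : IsOdo lam D ρ η u) (he : ∀ x ∈ D, η x = η' x) : IsOdo lam D ρ η' u := by
  obtain ⟨α, hα, rfl⟩ := h
  refine ⟨α, Legal.stabilizes (hα.1.mono (Or.inr rfl) (fun x hx => (he x hx).le) hα.1.mem) ?_, rfl⟩
  exact hα.stab.mono_init fun x hx => (he x hx).ge

/-- Particles entering an interval of `w` sites from both ends. -/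
def edge (y : ℤ) (w l r : ℕ) : ℤ → ℕ := fun x =>
  (if x = y then l else 0) + (if x = y + w - 1 then r else 0)

/-- The net number of particles crossing the edge from `y - 1` to `y`. -/
def flux (ρ : Stacks) (u : ℤ → ℕ) (y : ℤ) : ℤ := rights ρ (y - 1) (u (y - 1)) - lefts ρ y (u y)

theorem flux_eq {ρ : Stacks} {u : ℤ → ℕ} {n : ℕ} {y : ℤ} (hy : 1 ≤ y) (k : ℕ) :
    flux ρ u y = ∑ i ∈ Finset.range k, cnt (single 0 n) ρ u (y + i) + flux ρ u (y + k) := by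
  rw [sum_cnt]
  have : ∑ i ∈ Finset.range k, (single 0 n (y + i) : ℤ) = 0 :=
    Finset.sum_eq_zero fun i _ => by
      have : y + (i : ℤ) ≠ 0 := by omega
      simp [single, this]
  rw [this]
  unfold flux
  ring

/-- N particles on distinct sites have the least total position when they occupy the first N sites,
which gives N(N + 1)/2. -/
theorem sum_pos_ge (c : ℕ → ℤ) (k : ℕ) (h0 : ∀ i < k, 0 ≤ c i) (h1 : ∀ i < k, c i ≤ 1) :
    (∑ i ∈ Finset.range k, c i) * (∑ i ∈ Finset.range k, c i + 1)
      ≤ 2 * ∑ i ∈ Finset.range k, ((i : ℤ) + 1) * c i ∧ ∑ i ∈ Finset.range k, c i ≤ k := by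
  induction k with
  | zero => simp
  | succ k ih =>
    obtain ⟨ih1, ih2⟩ := ih (fun i hi => h0 i (by omega)) fun i hi => h1 i (by omega)
    rw [Finset.sum_range_succ, Finset.sum_range_succ]
    have a := h0 k (by omega)
    have b := h1 k (by omega)
    obtain hc | hc : c k = 0 ∨ c k = 1 := by omega
    · rw [hc]; push_cast; constructor
      · simpa using ih1
      · linarith
    · rw [hc]; push_cast; constructor
      · nlinarith
      · linarith

/-- If a site to the right of the origin does not fire, nothing fires beyond it. -/
theorem IsOdo.zero_beyond {lam : ℝ≥0∞} {D : Set ℤ} {ρ : Stacks} {η u : ℤ → ℕ}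
    (hu : IsOdo lam D ρ η u) {x : ℤ} (hη : ∀ y, x < y → lam = ∞ ∧ η y ≤ 1 ∨ η y = 0)
    (hx : u x = 0) {y : ℤ} (hy : x < y) : u y = 0 := by
  -- Truncating u beyond x still stabilizes: x never fires, so the sites beyond it receive nothing
  -- and keep their stable initial content.
  have hs : Stab lam D ρ η (fun z => if z ≤ x then u z else 0) := by
    refine ⟨fun z hz => by simp [hu.stab.off z hz], fun z hz => ?_⟩
    by_cases hzx : z ≤ x
    · simp only [hzx, if_true]
      refine (hu.stab.stable z hz).mono (cnt_mono_used (fun w => ?_) (by simp [hzx]))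
      split_ifs <;> simp
    · simp only [hzx, if_false]
      have e : cnt η ρ (fun z => if z ≤ x then u z else 0) z = η z := by
        have a1 : ¬ z + 1 ≤ x := by omega
        unfold cnt
        by_cases a2 : z - 1 ≤ x
        · have : z - 1 = x := by omega
          simp [hzx, a1, this, hx]
        · simp [hzx, a1, a2]
      rw [e]
      rcases hη z (by omega) with ⟨h1, h2⟩ | h
      · exact Or.inr ⟨by exact_mod_cast h2, Or.inl h1⟩
      · left; simp [h]
  have := hu.le hs y
  have h : ¬ y ≤ x := by omega
  simpa [h] using this

theorem rights_le (ρ : Stacks) (x : ℤ) (k : ℕ) : rights ρ x k ≤ k := by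
  have := rights_add_lefts_le ρ x k; omega

theorem lefts_le (ρ : Stacks) (x : ℤ) (k : ℕ) : lefts ρ x k ≤ k := by
  have := rights_add_lefts_le ρ x k; omega

/-- The particles in a filled block are the survivors of the block. -/
theorem sum_block_eq_survivors {lam : ℝ≥0∞} {D : Set ℤ} {ρ : Stacks} {n : ℕ} {u : ℤ → ℕ}
    (hu : IsOdo lam D ρ (single 0 n) u) {y : ℤ} {w : ℕ} (hw : 0 < w) (hy : 1 ≤ y)
    (hK : ((Finset.Icc y (y + w - 1) : Finset ℤ) : Set ℤ) ⊆ D) {l : ℕ}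
    (hl : l ≤ rights ρ (y - 1) (u (y - 1)))
    (hfill : ∀ v, IsOdo ∞ (Finset.Icc y (y + w - 1) : Finset ℤ) ρ (single y l) v →
      ∀ x ∈ Finset.Icc y (y + w - 1), 1 ≤ cnt (single y l) ρ v x) :
    (∃ v, IsOdo ∞ (Finset.Icc y (y + w - 1) : Finset ℤ) ρ (edge y w
        (rights ρ (y - 1) (u (y - 1))) (lefts ρ (y + w) (u (y + w)))) v ∧
      (∀ x, v x ≤ u x) ∧
      settle (Finset.Icc y (y + w - 1) : Finset ℤ) ρ (edge y w
        (rights ρ (y - 1) (u (y - 1))) (lefts ρ (y + w) (u (y + w)))) v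
        = ind (Finset.Icc y (y + w - 1)) ∧
      ∑ x ∈ Finset.Icc y (y + w - 1), cnt (single 0 n) ρ u x
        = survivors lam (shiftBy v ρ) (Finset.Icc y (y + w - 1))) ∧
    (∀ x, 0 ≤ x → x < y + w - 1 → 0 < u x ∨ w = 1) := by
  set K := Finset.Icc y (y + w - 1) with hKdef
  set E := edge y w (rights ρ (y - 1) (u (y - 1))) (lefts ρ (y + w) (u (y + w))) with hE
  have hinf : ∀ x ∈ (K : Set ℤ), inflow K ρ (single 0 n) u x = E x := by
    intro x hx
    rw [Finset.mem_coe, Finset.mem_Icc] at hx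
    have h0 : x ≠ 0 := by omega
    unfold inflow
    simp only [hE, edge, single, h0, if_false, zero_add, hKdef, Finset.mem_coe, Finset.mem_Icc]
    congr 1
    · by_cases h : x = y
      · subst h; simp
      · rw [if_neg h, if_pos (by omega)]
    · by_cases h : x = y + w - 1
      · have e : x + 1 = y + w := by omega
        rw [if_pos h, if_neg (by omega), e]
      · rw [if_neg h, if_pos (by omega)]
  have hr := (hu.restrict hK).congr hinf
  obtain ⟨v, hv⟩ := hr.stab.top.exists_isOdo (F := K) (patch_zero_off _ _)
  have hsE : ∀ x, single y l x ≤ E x := by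
    intro x
    simp only [hE, edge, single]
    split_ifs <;> omega
  -- Comparison system: only l of the particles arriving at the left end. In Internal DLA more
  -- particles occupy more sites, so whatever v0 fills is filled by v.
  obtain ⟨v0, hv0⟩ := (hr.stab.top.mono_init fun x _ => hsE x).exists_isOdo (F := K)
    (patch_zero_off _ _)
  have hf0 := hfill v0 hv0
  have hfE : ∀ x ∈ K, cnt E ρ v x = 1 := fun x hx =>
    le_antisymm (hv.cnt_le_one hx) (hv0.one_le_cnt_of_le hv hsE (hf0 x hx))
  have hpu : ∀ x, patch K u 0 x ≤ u x := by
    intro x; unfold patch; split_ifs <;> simp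
  have hset : settle K ρ E v = ind K := by
    funext x
    by_cases hx : x ∈ K
    · simp [settle, ind, hx, hfE x hx]
    · have h1 : x ≠ y := by rintro rfl; apply hx; rw [hKdef, Finset.mem_Icc]; omega
      have h2 : x ≠ y + w - 1 := by rintro rfl; apply hx; rw [hKdef, Finset.mem_Icc]; omega
      simp only [settle, ind, Finset.mem_coe, hx, if_false, hE, edge, h1, h2]
  obtain ⟨w', hw', huw⟩ := hr.after_top hv (F := K) le_rfl
  rw [hset] at hw'
  refine ⟨⟨v, hv, fun x => (hv.le hr.stab.top x).trans (hpu x), hset, ?_⟩, ?_⟩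
  · rw [survivors_eq hw']
    refine Finset.sum_congr rfl fun x hx => ?_
    have h1 : cnt E ρ (patch K u 0) x = cnt (single 0 n) ρ u x := by
      have e1 : patch K (patch K u 0) u = u := by
        funext z; by_cases hz : z ∈ (K : Set ℤ) <;> simp_all [patch]
      have h2 := cnt_inflow (K := K) (ρ := ρ) (η := single 0 n) (u := u)
        (patch_zero_off (K : Set ℤ) u) (x := x) hx
      rw [e1] at h2
      rw [← h2]
      unfold cnt
      rw [hinf x hx]
    rw [← h1, huw, cnt_add E (ind K) ρ v w' x, hfE x hx]
    simp [ind, hx]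
  -- If x did not fire, no site from x on would fire, and the last site of a block of at least two
  -- sites would receive no particle, although v0 fills it.
  · intro x hx0 hxw
    by_contra! hc
    obtain ⟨hc1, hc2⟩ := hc
    have hux : u x = 0 := by omega
    have hz : ∀ z, x ≤ z → u z = 0 := by
      intro z hz
      rcases hz.eq_or_lt with rfl | hz
      · exact hux
      · refine hu.zero_beyond (fun z hz => Or.inr ?_) hux hz
        have : z ≠ 0 := by omega
        simp [single, this]
    have h1 := hf0 (y + w - 1) (by rw [hKdef, Finset.mem_Icc]; omega)
    have h2 : v0 (y + w - 1 - 1) = 0 := by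
      have := (hv0.le (hr.stab.top.mono_init fun x _ => hsE x) (y + w - 1 - 1)).trans (hpu _)
      rw [hz _ (by omega)] at this
      omega
    have h3 : v0 (y + w - 1 + 1) = 0 := hv0.stab.off _ (by
      rw [hKdef, Finset.mem_coe, Finset.mem_Icc]; omega)
    have h4 : y + (w : ℤ) - 1 ≠ y := by omega
    unfold cnt at h1
    rw [h2, h3] at h1
    simp [single, h4] at h1
    omega

/-- Number of particles sufficient to fill `w` sites by Internal DLA from one end. -/
def fillNumber (δ : ℝ) (w : ℕ) : ℕ := ⌈(1 + δ) * (w : ℝ) ^ 2 / 2⌉₊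

/-- The hypotheses on the stacks under which the density to the right of the origin is at most
`z`. -/
structure GoodRight (lam : ℝ≥0∞) (ρ : Stacks) (n M t : ℕ) (z δ : ℝ) : Prop where
  total : ∀ u, IsOdo lam (Finset.Icc (-M : ℤ) M : Finset ℤ) ρ (single 0 n) u →
    ∑ x ∈ Finset.Icc (-M : ℤ) M, u x < t
  balanced : ∀ u, IsOdo lam (Finset.Icc (-M : ℤ) M : Finset ℤ) ρ (single 0 n) u →
    ∀ y : ℤ, 1 ≤ y → y ≤ M →
      |((∑ x ∈ Finset.Icc y M, net ρ x (u x) : ℤ) : ℝ)| ≤ δ ^ 3 * n ^ 2 / 2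
  fill : ∀ (y : ℤ) (w : ℕ), 1 ≤ y → y + w - 1 ≤ M → δ * n / 4 ≤ w → ∀ v,
    IsOdo ∞ (Finset.Icc y (y + w - 1) : Finset ℤ) ρ (single y (fillNumber δ w)) v →
      ∀ x ∈ Finset.Icc y (y + w - 1), 1 ≤ cnt (single y (fillNumber δ w)) ρ v x
  -- The true inflows are random and depend on the stacks, whereas freshness holds for a fixed
  -- initial configuration; so all values of l and r are required.
  surv : ∀ (y : ℤ) (w l r : ℕ), 1 ≤ y → y + w - 1 ≤ M → δ * n / 4 ≤ w → l < t → r < t → ∀ v,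
    IsOdo ∞ (Finset.Icc y (y + w - 1) : Finset ℤ) ρ (edge y w l r) v →
    ∑ x ∈ Finset.Icc y (y + w - 1), v x < t →
    settle (Finset.Icc y (y + w - 1) : Finset ℤ) ρ (edge y w l r) v
      = ind (Finset.Icc y (y + w - 1)) →
    (survivors lam (shiftBy v ρ) (Finset.Icc y (y + w - 1)) : ℝ) ≤ z * w

/-- One step of the propagation. -/
theorem GoodRight.step {lam : ℝ≥0∞} {ρ : Stacks} {n M t : ℕ} {z δ : ℝ} {u : ℤ → ℕ}
    (hg : GoodRight lam ρ n M t z δ) (hδ : 0 < δ) (hδ2 : δ ≤ 1 / 2) (hn : 8 ≤ δ * n)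
    (hu : IsOdo lam (Finset.Icc (-M : ℤ) M : Finset ℤ) ρ (single 0 n) u) (hM : u M = 0)
    {y : ℤ} (hy : 1 ≤ y) (hf : δ * n ≤ flux ρ u y) :
    ∃ w : ℕ, 0 < w ∧ y + w - 1 ≤ M ∧ (flux ρ u y - z * w : ℝ) ≤ flux ρ u (y + w) ∧
      ∀ x, 0 ≤ x → x < y + w - 1 → 0 < u x := by
  set N : ℝ := ((flux ρ u y : ℤ) : ℝ) with hN
  have hM1 : u (M + 1) = 0 := hu.stab.off _ (by rw [Finset.mem_coe, Finset.mem_Icc]; omega)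
  have hyM : y ≤ M := by
    by_contra hc
    have h1 : u (y - 1) = 0 := by
      rcases (show (M : ℤ) ≤ y - 1 by omega).eq_or_lt with h | h
      · rw [← h]; exact hM
      · exact hu.stab.off _ (by rw [Finset.mem_coe, Finset.mem_Icc]; omega)
    have h2 : flux ρ u y ≤ 0 := by unfold flux; rw [h1]; simp
    have : N ≤ 0 := by rw [hN]; exact_mod_cast h2
    linarith
  obtain ⟨k, hk⟩ : ∃ k : ℕ, y + k - 1 = M := ⟨(M + 1 - y).toNat, by omega⟩
  have hykM : y + (k : ℤ) = M + 1 := by omega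
  have hrange : ∀ i < k, y + (i : ℤ) ∈ ((Finset.Icc (-M : ℤ) M : Finset ℤ) : Set ℤ) := by
    intro i hi; rw [Finset.mem_coe, Finset.mem_Icc]; omega
  have hflux : flux ρ u y = ∑ i ∈ Finset.range k, cnt (single 0 n) ρ u (y + i) := by
    rw [flux_eq (n := n) hy k, hykM]
    have : flux ρ u (M + 1) = 0 := by
      unfold flux; rw [hM1, show (M : ℤ) + 1 - 1 = M by ring, hM]; simp
    rw [this, add_zero]
  obtain ⟨hsq, hNk⟩ := sum_pos_ge (fun i => cnt (single 0 n) ρ u (y + i)) k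
    (fun i hi => hu.cnt_nonneg (hrange i hi)) fun i hi => hu.cnt_le_one (hrange i hi)
  rw [← hflux] at hsq hNk
  have hpos := sum_pos_cnt (single 0 n) ρ u y k
  have hz0 : ∑ i ∈ Finset.range k, ((i : ℤ) + 1) * (single 0 n (y + i) : ℤ) = 0 :=
    Finset.sum_eq_zero fun i _ => by
      have : y + (i : ℤ) ≠ 0 := by omega
      simp [single, this]
  rw [hz0, hk, hM, hykM, hM1, ← sum_Icc_eq_sum_range (fun x => net ρ x (u x)), hk] at hpos
  simp only [rights_zero, lefts_zero] at hpos
  have hb := hg.balanced u hu y hy hyM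
  set l := rights ρ (y - 1) (u (y - 1)) with hl
  set S := ∑ x ∈ Finset.Icc y M, net ρ x (u x) with hS
  -- The N particles that end to the right of the edge have first moment at least N(N + 1)/2,
  -- supplied by the l arrivals at y and the net displacement.
  have hl1 : N * (N + 1) ≤ 2 * l + δ ^ 3 * n ^ 2 := by
    have h1 : flux ρ u y * (flux ρ u y + 1) ≤ 2 * (l + S) := by
      rw [hpos] at hsq; push_cast at hsq; linarith
    have h2 : N * (N + 1) ≤ 2 * ((l : ℝ) + S) := by rw [hN]; exact_mod_cast h1
    have h3 := le_abs_self (S : ℝ)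
    linarith
  have hN0 : 0 ≤ (1 - δ) * N := by
    have : 0 ≤ N := by linarith
    have : 0 ≤ 1 - δ := by linarith
    positivity
  -- Filling w sites takes about (1 + δ)w²/2 ≤ (1 - δ)N²/2 particles; the loss δN² covers the noise
  -- δ³n², since N ≥ δn.
  set w := ⌊(1 - δ) * N⌋₊ with hw
  have hw1 : (w : ℝ) ≤ (1 - δ) * N := Nat.floor_le hN0
  have hw2 : (1 - δ) * N < w + 1 := Nat.lt_floor_add_one _
  have hwn : δ * n / 4 ≤ w := by nlinarith
  have hw2' : (2 : ℝ) ≤ w := by linarith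
  have hw2n : 2 ≤ w := by exact_mod_cast hw2'
  have hwk : w ≤ k := by
    have h1 : N ≤ k := by rw [hN]; exact_mod_cast hNk
    have h2 : (w : ℝ) ≤ k := by nlinarith
    exact_mod_cast h2
  have hywM : y + (w : ℤ) - 1 ≤ M := by omega
  have hfl : fillNumber δ w ≤ l := by
    refine Nat.ceil_le.2 ?_
    have h1 : (w : ℝ) ^ 2 ≤ ((1 - δ) * N) ^ 2 := by
      have : (0 : ℝ) ≤ w := by positivity
      nlinarith
    have h2 : (1 + δ) * (1 - δ) ^ 2 ≤ 1 - δ := by nlinarith [sq_nonneg δ]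
    have h3 : (δ * n) ^ 2 ≤ N ^ 2 := by
      have : 0 ≤ δ * n := by linarith
      nlinarith
    have h4 : (1 + δ) * (w : ℝ) ^ 2 ≤ (1 - δ) * N ^ 2 := by
      calc (1 + δ) * (w : ℝ) ^ 2 ≤ (1 + δ) * ((1 - δ) * N) ^ 2 := by
            apply mul_le_mul_of_nonneg_left h1; linarith
        _ = ((1 + δ) * (1 - δ) ^ 2) * N ^ 2 := by ring
        _ ≤ (1 - δ) * N ^ 2 := mul_le_mul_of_nonneg_right h2 (sq_nonneg _)
    have h5 : δ * (δ * n) ^ 2 ≤ δ * N ^ 2 := mul_le_mul_of_nonneg_left h3 hδ.le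
    have : 0 ≤ N := by linarith
    nlinarith
  have hK : ((Finset.Icc y (y + w - 1) : Finset ℤ) : Set ℤ)
      ⊆ (Finset.Icc (-M : ℤ) M : Finset ℤ) := by
    intro x hx
    rw [Finset.mem_coe, Finset.mem_Icc] at hx ⊢
    omega
  obtain ⟨⟨v, hv, hvu, hset, hsum⟩, hfired⟩ := sum_block_eq_survivors hu (by omega) hy hK hfl
    (hg.fill y w hy hywM hwn)
  have htot := hg.total u hu
  have hle : ∀ x, u x ≤ ∑ x ∈ Finset.Icc (-M : ℤ) M, u x := by
    intro x
    by_cases hx : x ∈ Finset.Icc (-M : ℤ) M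
    · exact Finset.single_le_sum (fun _ _ => Nat.zero_le _) hx
    · rw [hu.stab.off x (by exact_mod_cast hx)]; exact Nat.zero_le _
  have hvt : ∑ x ∈ Finset.Icc y (y + w - 1), v x < t :=
    lt_of_le_of_lt ((Finset.sum_le_sum fun x _ => hvu x).trans
      (Finset.sum_le_sum_of_subset (by exact_mod_cast hK))) htot
  have hs := hg.surv y w _ _ hy hywM hwn
    (lt_of_le_of_lt ((rights_le _ _ _).trans (hle _)) htot)
    (lt_of_le_of_lt ((lefts_le _ _ _).trans (hle _)) htot) v hv hvt hset
  refine ⟨w, by omega, hywM, ?_, fun x hx0 hx => ?_⟩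
  · have h1 := flux_eq (ρ := ρ) (u := u) (n := n) hy w
    rw [← sum_Icc_eq_sum_range (fun x => cnt (single 0 n) ρ u x), hsum] at h1
    have h2 : N = survivors lam (shiftBy v ρ) (Finset.Icc y (y + w - 1))
        + (flux ρ u (y + w) : ℝ) := by rw [hN]; exact_mod_cast h1
    linarith
  · rcases hfired x hx0 hx with h | h
    · exact h
    · omega

/-- The density to the right of the origin is at most `z`. -/
theorem GoodRight.density {lam : ℝ≥0∞} {ρ : Stacks} {n M t : ℕ} {z δ : ℝ} {u : ℤ → ℕ}
    (hg : GoodRight lam ρ n M t z δ) (hδ : 0 < δ) (hδ2 : δ ≤ 1 / 2) (hn : 8 ≤ δ * n)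
    (hu : IsOdo lam (Finset.Icc (-M : ℤ) M : Finset ℤ) ρ (single 0 n) u) (hM : u M = 0) :
    ∃ Y : ℕ, (∀ x : ℤ, 0 ≤ x → x < Y → 0 < u x) ∧ (flux ρ u 1 : ℝ) ≤ z * Y + δ * n := by
  -- Y counts the sites covered by filled blocks and 1 + Y is the next edge; m bounds the number of
  -- remaining sites, and every block is nonempty.
  have main : ∀ m : ℕ, ∀ Y : ℕ, M + 1 ≤ Y + m → (Y : ℤ) ≤ M →
      (∀ x : ℤ, 0 ≤ x → x < Y → 0 < u x) → (flux ρ u 1 - z * Y : ℝ) ≤ flux ρ u (1 + Y) →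
      ∃ Y : ℕ, (∀ x : ℤ, 0 ≤ x → x < Y → 0 < u x) ∧ (flux ρ u 1 : ℝ) ≤ z * Y + δ * n := by
    intro m
    induction m with
    | zero => intro Y h1 h2; omega
    | succ m ih =>
      intro Y h1 h2 h3 h4
      by_cases hf : δ * n ≤ flux ρ u (1 + Y)
      · obtain ⟨w, hw, hwM, hfl, hfired⟩ := hg.step hδ hδ2 hn hu hM (y := 1 + Y) (by omega) hf
        refine ih (Y + w) (by omega) (by push_cast; omega) (fun x hx0 hx => ?_) ?_
        · exact hfired x hx0 (by push_cast at hx; omega)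
        · have e : (1 : ℤ) + ((Y + w : ℕ) : ℤ) = 1 + Y + w := by push_cast; ring
          rw [e]
          push_cast
          linarith
      · push Not at hf
        exact ⟨Y, h3, by linarith⟩
  refine main (M + 1) 0 (by omega) (by omega) (fun x h1 h2 => ?_) ?_
  · push_cast at h2; omega
  · simp

/-! ### Summable families of events -/

/-- The probabilities of the events `E n` are summable. -/
def Small (lam : ℝ≥0∞) (E : ℕ → Set Stacks) : Prop := ∑' n, stackLaw lam (E n) ≠ ∞

theorem tsum_ne_top_of_eventually_le {f g : ℕ → ℝ≥0∞} (hf : ∀ n, f n ≠ ∞)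
    (h : ∀ᶠ n in atTop, f n ≤ g n) (hg : ∑' n, g n ≠ ∞) : ∑' n, f n ≠ ∞ := by
  obtain ⟨N, hN⟩ := eventually_atTop.1 h
  rw [← ENNReal.summable.sum_add_tsum_nat_add' (k := N)]
  refine ENNReal.add_ne_top.2 ⟨ENNReal.sum_ne_top.2 fun i _ => hf i, ?_⟩
  refine ne_top_of_le_ne_top hg ?_
  refine (ENNReal.tsum_le_tsum fun n => hN (n + N) (by omega)).trans ?_
  exact ENNReal.tsum_comp_le_tsum_of_injective (add_left_injective N) g

theorem Small.mono {lam : ℝ≥0∞} {E F : ℕ → Set Stacks} (hF : Small lam F)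
    (h : ∀ᶠ n in atTop, E n ⊆ F n) : Small lam E :=
  tsum_ne_top_of_eventually_le (fun _ => measure_ne_top _ _)
    (h.mono fun _ hn => measure_mono hn) hF

theorem Small.union {lam : ℝ≥0∞} {E F : ℕ → Set Stacks} (hE : Small lam E) (hF : Small lam F) :
    Small lam fun n => E n ∪ F n := by
  refine ne_top_of_le_ne_top (ENNReal.add_ne_top.2 ⟨hE, hF⟩) ?_
  rw [← ENNReal.tsum_add]
  exact ENNReal.tsum_le_tsum fun n => measure_union_le _ _

theorem Small.of_le {lam : ℝ≥0∞} {E : ℕ → Set Stacks} {K : ℝ}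
    (h : ∀ᶠ n : ℕ in atTop, stackLaw lam (E n) ≤ ENNReal.ofReal (K / (n : ℝ) ^ 2)) :
    Small lam E := by
  refine tsum_ne_top_of_eventually_le (fun _ => measure_ne_top _ _) (h.mono fun n hn => hn.trans
    (ENNReal.ofReal_le_ofReal (le_abs_self _))) ?_
  have hs : Summable fun n : ℕ => |K / (n : ℝ) ^ 2| := by
    have := ((Real.summable_nat_pow_inv (p := 2)).2 (by norm_num)).mul_left |K|
    refine this.congr fun n => ?_
    rw [abs_div, abs_of_nonneg (a := (n : ℝ) ^ 2) (by positivity), div_eq_mul_inv]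
  rw [← ENNReal.ofReal_tsum_of_nonneg (fun n => abs_nonneg _) hs]
  exact ENNReal.ofReal_ne_top

theorem eventually_pow_mul_exp_le (K : ℝ) (k : ℕ) {c : ℝ} (hc : 0 < c) :
    ∀ᶠ n : ℕ in atTop, K * (n : ℝ) ^ k * Real.exp (-c * n) ≤ 1 / (n : ℝ) ^ 2 := by
  have h1 := (Real.tendsto_pow_mul_exp_neg_atTop_nhds_zero (k + 2)).comp
    (tendsto_natCast_atTop_atTop.const_mul_atTop hc)
  have h2 := h1.const_mul (K / c ^ (k + 2))
  rw [mul_zero] at h2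
  filter_upwards [h2.eventually (eventually_le_nhds (b := 1) zero_lt_one), eventually_gt_atTop 0]
    with n hn hpos
  have hn0 : (0 : ℝ) < n := by exact_mod_cast hpos
  rw [le_div_iff₀ (by positivity)]
  refine le_trans (le_of_eq ?_) hn
  simp only [Function.comp]
  rw [mul_pow, neg_mul]
  field_simp
  ring

theorem stackLaw_biUnion_le {ι : Type*} {lam : ℝ≥0∞} (s : Finset ι) (E : ι → Set Stacks) {q k : ℝ}
    (hq : 0 ≤ q) (hk : (s.card : ℝ) ≤ k) (h : ∀ i ∈ s, stackLaw lam (E i) ≤ ENNReal.ofReal q) :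
    stackLaw lam (⋃ i ∈ s, E i) ≤ ENNReal.ofReal (k * q) := by
  refine (measure_biUnion_finset_le s E).trans ((Finset.sum_le_card_nsmul s _ _ h).trans ?_)
  rw [nsmul_eq_mul, ← ENNReal.ofReal_natCast, ← ENNReal.ofReal_mul (by positivity)]
  exact ENNReal.ofReal_le_ofReal (mul_le_mul_of_nonneg_right hk hq)

/-! ### The inner density -/

/-- This covers the default value of `stabilization` too, which is 1_I itself. -/
theorem survivors_le_card (lam : ℝ≥0∞) (ρ : Stacks) (I : Finset ℤ) :
    survivors lam ρ I ≤ I.card := by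
  by_cases hex : ∃ α, Stabilizes lam I ρ (act (ind I)) α
  · obtain ⟨α, hα⟩ := hex
    have hi : IsOdo lam I ρ (ind I) (odo α) := ⟨α, hα, rfl⟩
    have h1 := survivors_eq hi
    have h2 : ∑ x ∈ I, cnt (ind I) ρ (odo α) x ≤ ∑ x ∈ I, (1 : ℤ) :=
      Finset.sum_le_sum fun x hx => hi.cnt_le_one hx
    rw [← h1] at h2
    simp at h2
    exact h2
  · unfold survivors stabilization
    rw [ones_eq, dif_neg hex]
    refine (Finset.sum_le_card_nsmul I _ 1 fun x hx => ?_).trans (by simp)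
    simp [act, ind, hx, NatS.size]

theorem zetaInOn_mem_Icc (lam : ℝ≥0∞) (I : Finset ℤ) : 0 ≤ zetaInOn lam I ∧ zetaInOn lam I ≤ 1 ∧
    Set.Nonempty {z : ℝ | 0 < z ∧ stackLaw lam {ρ | z * (I.card : ℝ) < (survivors lam ρ I : ℝ)}
      ≤ ((I.card : ℝ≥0∞) ^ 20)⁻¹} := by
  have h1 : (1 : ℝ) ∈ {z : ℝ | 0 < z ∧ stackLaw lam
      {ρ | z * (I.card : ℝ) < (survivors lam ρ I : ℝ)} ≤ ((I.card : ℝ≥0∞) ^ 20)⁻¹} := by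
    refine ⟨one_pos, ?_⟩
    refine le_of_eq_of_le ?_ zero_le
    convert measure_empty (μ := stackLaw lam)
    ext ρ
    have : (survivors lam ρ I : ℝ) ≤ I.card := by exact_mod_cast survivors_le_card lam ρ I
    simp only [Set.mem_ofPred_eq, Set.mem_empty_iff_false, iff_false, not_lt]
    linarith
  refine ⟨Real.sInf_nonneg fun z hz => hz.1.le, csInf_le ⟨0, fun z hz => hz.1.le⟩ h1, ⟨1, h1⟩⟩

/-- The limit superior is along the length only, so the threshold W is uniform in the position y. It
is a genuine one because all the finite-volume densities lie in [0, 1]. -/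
theorem survivors_tail {lam : ℝ≥0∞} {z : ℝ} (hz : zetaIn lam < z) :
    ∃ W : ℕ, ∀ (y : ℤ) (w : ℕ), W ≤ w →
      stackLaw lam {ρ | z * w < (survivors lam ρ (Finset.Icc y (y + w - 1)) : ℝ)}
        ≤ ((w : ℝ≥0∞) ^ 20)⁻¹ := by
  have hb : IsBoundedUnder (· ≤ ·) (comap (fun I : ℤ × ℤ => (Finset.Icc I.1 I.2).card) atTop)
      (fun I : ℤ × ℤ => zetaInOn lam (Finset.Icc I.1 I.2)) :=
    isBoundedUnder_of ⟨1, fun I => (zetaInOn_mem_Icc lam _).2.1⟩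
  have h := eventually_lt_of_limsup_lt hz hb
  rw [eventually_comap] at h
  obtain ⟨W, hW⟩ := eventually_atTop.1 h
  refine ⟨W, fun y w hw => ?_⟩
  have h1 := hW w hw (y, y + w - 1) (card_Icc_block y w)
  obtain ⟨z', ⟨hz0, hz1⟩, hz2⟩ := exists_lt_of_csInf_lt (zetaInOn_mem_Icc lam _).2.2 h1
  simp only [card_Icc_block] at hz1
  refine le_trans (measure_mono fun ρ hρ => ?_) hz1
  simp only [Set.mem_ofPred_eq] at hρ ⊢
  refine lt_of_le_of_lt ?_ hρ
  exact mul_le_mul_of_nonneg_right hz2.le (by positivity)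

/-! ### Good stacks are likely -/

/-- A weight of the law of the instructions: the probability of a step to the left. -/
def stepProb (lam : ℝ≥0∞) : ℝ := (exists_weights lam).choose

theorem stepProb_pos (lam : ℝ≥0∞) : 0 < stepProb lam :=
  (exists_weights lam).choose_spec.choose_spec.1

theorem total_bound' (lam lam' : ℝ≥0∞) {a b : ℤ} {L : ℝ}
    (hL1 : 1 ≤ L) (hL : (b - a : ℝ) ≤ L) (η : ℤ → ℕ) (t : ℕ) :
    stackLaw lam {ρ | ¬ ∃ u, IsOdo lam' (Finset.Icc a b : Finset ℤ) ρ η u ∧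
      ∑ x ∈ Finset.Icc a b, u x < t}
      ≤ ENNReal.ofReal (Real.exp ((potOf a b η - stepProb lam / 2 * t) / L ^ 2)) := by
  obtain ⟨hp, hs, h1, e1, e2, e3⟩ := (exists_weights lam).choose_spec.choose_spec
  exact total_bound hp hs h1 e1 e2 e3 lam' hL1 hL η t

theorem potOf_single {a b y : ℤ} (hy : y ∈ Finset.Icc a b) (n : ℕ) :
    potOf a b (single y n) = n * pot a b y := by
  unfold potOf
  rw [Finset.sum_eq_single y]
  · simp [single]
  · intro x _ hx; simp [single, hx]
  · intro h; exact absurd hy h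

/-- Internal DLA fills an interval with overwhelming probability. -/
theorem fill_bound (lam : ℝ≥0∞) {δ : ℝ} (hδ : 0 < δ) (hδ2 : δ ≤ 1 / 2) :
    ∃ c : ℝ, 0 < c ∧ ∀ (y : ℤ) (w : ℕ), 2 / δ ≤ w →
      stackLaw lam {ρ | ∃ v, IsOdo ∞ (Finset.Icc y (y + w - 1) : Finset ℤ) ρ
        (single y (fillNumber δ w)) v ∧
        ∃ x ∈ Finset.Icc y (y + w - 1), cnt (single y (fillNumber δ w)) ρ v x < 1}
      ≤ ENNReal.ofReal ((2 * w + 1) * Real.exp (-c * w)) := by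
  have hp := stepProb_pos lam
  set p := stepProb lam with hpdef
  -- The initial potential is lw ≤ 2w³, and (p/2)Cw³ ≥ 3w³; divided by L² = w², this leaves an
  -- exponent of at most -w.
  obtain ⟨C, hC⟩ := exists_nat_ge (6 / p)
  have hC0 : (0 : ℝ) < C := lt_of_lt_of_le (by positivity) hC
  refine ⟨min 1 (δ ^ 2 / (32 * C)), by positivity, fun y w hw => ?_⟩
  set c := min 1 (δ ^ 2 / (32 * C)) with hc
  have hw2 : (4 : ℝ) ≤ w := by
    refine le_trans ?_ hw
    rw [le_div_iff₀ hδ]; linarith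
  have hw0 : 0 < w := by
    have : (0 : ℝ) < w := by linarith
    exact_mod_cast this
  have hδw : 2 ≤ δ * w := by rwa [div_le_iff₀' hδ] at hw
  set l := fillNumber δ w with hl
  have hl1 : (1 + δ) * (w : ℝ) ^ 2 / 2 ≤ l := Nat.le_ceil _
  have hl2 : (l : ℝ) ≤ 2 * w ^ 2 := by
    have h1 : (l : ℝ) < (1 + δ) * (w : ℝ) ^ 2 / 2 + 1 := Nat.ceil_lt_add_one (by positivity)
    nlinarith
  set t : ℕ := C * w ^ 3 with ht
  set E1 : Set Stacks := {ρ | ¬ ∃ u, IsOdo ∞ (Finset.Icc y (y + w - 1) : Finset ℤ) ρ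
      (single y l) u ∧ ∑ x ∈ Finset.Icc y (y + w - 1), u x < t} with hE1
  -- Since 2l - w(w + 1) ≥ δw² - w ≥ δw²/2, a failure to fill requires an imbalance of at least
  -- δw²/4. Its Gaussian exponent with at most Cw³ firings is δ²w/(32C).
  set E2 : ℕ → Set Stacks := fun h => {ρ | ∃ u, IsOdo ∞ (Finset.Icc y (y + w - 1) : Finset ℤ) ρ
      (single y l) u ∧ ∑ x ∈ Finset.Icc y (y + w - 1), u x < t ∧
      δ * (w : ℝ) ^ 2 / 4 ≤ |((∑ x ∈ Finset.Icc y (y + h - 1), net ρ x (u x) : ℤ) : ℝ)| ∧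
      ((∑ x ∈ Finset.Icc y (y + h - 1), u x : ℕ) : ℝ) ≤ C * (w : ℝ) ^ 3} with hE2
  have b1 : stackLaw lam E1 ≤ ENNReal.ofReal (Real.exp (-c * w)) := by
    refine (total_bound' lam ∞ (L := w) (by linarith) (by push_cast; linarith) _ t).trans
      (ENNReal.ofReal_le_ofReal (Real.exp_le_exp.2 ?_))
    rw [potOf_single (by rw [Finset.mem_Icc]; omega), div_le_iff₀ (by positivity)]
    have e : (pot y (y + w - 1) y : ℝ) = w := by unfold pot; push_cast; ring
    have et : (t : ℝ) = C * (w : ℝ) ^ 3 := by rw [ht]; push_cast; ring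
    rw [Int.cast_mul, Int.cast_natCast, e, ← hpdef, et]
    have h1 : 6 ≤ p * C := by rwa [div_le_iff₀' hp] at hC
    have h2 : (l : ℝ) * w ≤ 2 * w ^ 3 := by nlinarith
    have h3 : c ≤ 1 := min_le_left _ _
    have h4 : (0 : ℝ) ≤ (w : ℝ) ^ 3 := by positivity
    have h5 : 6 * (w : ℝ) ^ 3 ≤ p * C * w ^ 3 := mul_le_mul_of_nonneg_right h1 h4
    have h6 : c * (w : ℝ) ^ 3 ≤ 1 * w ^ 3 := mul_le_mul_of_nonneg_right h3 h4
    have e1 : -c * (w : ℝ) * (w : ℝ) ^ 2 = -(c * (w : ℝ) ^ 3) := by ring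
    rw [e1]
    linarith
  have b2 : ∀ h ∈ Finset.range w, stackLaw lam (E2 h) ≤ ENNReal.ofReal (2 * Real.exp (-c * w)) := by
    intro h _
    refine (net_bound lam ∞ (Finset.Icc y (y + w - 1)) (Finset.Icc y (y + h - 1)) _ t
      (by positivity) (by positivity)).trans ?_
    rw [ENNReal.ofReal_mul (by norm_num), ENNReal.ofReal_ofNat]
    refine mul_le_mul_right (ENNReal.ofReal_le_ofReal (Real.exp_le_exp.2 ?_)) _
    have h3 : c ≤ δ ^ 2 / (32 * C) := min_le_right _ _
    have e : -(δ * (w : ℝ) ^ 2 / 4) ^ 2 / (2 * (C * (w : ℝ) ^ 3)) = -(δ ^ 2 / (32 * C)) * w := by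
      field_simp
      ring
    rw [e]
    nlinarith
  have hsub : {ρ | ∃ v, IsOdo ∞ (Finset.Icc y (y + w - 1) : Finset ℤ) ρ (single y l) v ∧
      ∃ x ∈ Finset.Icc y (y + w - 1), cnt (single y l) ρ v x < 1}
      ⊆ E1 ∪ ⋃ h ∈ Finset.range w, E2 h := by
    rintro ρ ⟨v, hv, x, hx, hcx⟩
    by_cases hE : ρ ∈ E1
    · exact Or.inl hE
    right
    have htot : ∑ x ∈ Finset.Icc y (y + w - 1), v x < t := by
      obtain ⟨v', hv', hlt⟩ := not_not.1 hE
      rwa [hv.unique hv']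
    have hlpos : 0 < l := by
      have : (0 : ℝ) < l := lt_of_lt_of_le (by positivity) hl1
      exact_mod_cast this
    by_contra hcon
    have := fill_of_balanced hlpos hv (fun h hh => ?_) hx
    · omega
    · by_contra hbad
      apply hcon
      simp only [Set.mem_iUnion]
      refine ⟨h, Finset.mem_range.2 hh, v, hv, htot, ?_, ?_⟩
      · have h1 : (2 * l : ℝ) ≤ 2 * |((∑ x ∈ Finset.Icc y (y + h - 1), net ρ x (v x) : ℤ) : ℝ)|
            + w * (w + 1) := by exact_mod_cast not_lt.1 hbad
        nlinarith
      · have h1 : ∑ x ∈ Finset.Icc y (y + h - 1), v x ≤ ∑ x ∈ Finset.Icc y (y + w - 1), v x :=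
          Finset.sum_le_sum_of_subset (Finset.Icc_subset_Icc le_rfl (by omega))
        have h2 : ∑ x ∈ Finset.Icc y (y + h - 1), v x ≤ C * w ^ 3 := by omega
        exact_mod_cast h2
  refine (measure_mono hsub).trans ((measure_union_le _ _).trans ((add_le_add b1
    (stackLaw_biUnion_le _ E2 (k := w) (by positivity) (by simp) b2)).trans ?_))
  rw [← ENNReal.ofReal_add (by positivity) (by positivity)]
  exact ENNReal.ofReal_le_ofReal (by linarith [Real.exp_nonneg (-c * w)])

/-- Long stabilizations have summable probabilities. -/
theorem long_small (lam : ℝ≥0∞) (C : ℕ) : ∃ C1 : ℕ, 0 < C1 ∧ ∀ (lam' : ℝ≥0∞) (M : ℕ → ℕ)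
    (η : ℕ → ℤ → ℕ), (∀ᶠ n : ℕ in atTop, M n ≤ C * n ∧
      ∑ x ∈ Finset.Icc (-M n : ℤ) (M n), η n x ≤ C * n) →
    Small lam fun n => {ρ | ¬ ∃ u, IsOdo lam' (Finset.Icc (-M n : ℤ) (M n) : Finset ℤ) ρ (η n) u ∧
      ∑ x ∈ Finset.Icc (-M n : ℤ) (M n), u x < C1 * n ^ 3} := by
  have hp := stepProb_pos lam
  -- The potential is at most C(C + 1)²n³ and L = 3(C + 1)n, so this constant makes the exponent at
  -- most -n.
  obtain ⟨C1, hC1⟩ := exists_nat_ge (2 * ((4 * (C : ℝ) + 9) * (C + 1) ^ 2) / stepProb lam)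
  have hC1p : 2 * ((4 * (C : ℝ) + 9) * (C + 1) ^ 2) ≤ stepProb lam * C1 := by
    rwa [div_le_iff₀' hp] at hC1
  refine ⟨C1, ?_, fun lam' M η h => Small.of_le (K := 1) ?_⟩
  · have : (0 : ℝ) < C1 := lt_of_lt_of_le (by positivity) hC1
    exact_mod_cast this
  filter_upwards [h, eventually_ge_atTop 1, eventually_pow_mul_exp_le 1 0 one_pos]
    with n ⟨hM, hη⟩ hn hexp
  have hn1 : (1 : ℝ) ≤ n := by exact_mod_cast hn
  have hM' : (M n : ℝ) ≤ C * n := by exact_mod_cast hM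
  have hC0 : (0 : ℝ) ≤ C := by positivity
  have hL : (M n : ℝ) + 1 ≤ (C + 1) * n := by nlinarith
  have hL1 : (1 : ℝ) ≤ (C + 1) * n := by nlinarith
  refine (total_bound' lam lam' (L := 3 * ((C + 1) * n)) (by linarith) (by push_cast; linarith)
    _ _).trans ((ENNReal.ofReal_le_ofReal ?_).trans (ENNReal.ofReal_le_ofReal hexp))
  rw [pow_zero, one_mul, one_mul]
  refine Real.exp_le_exp.2 ?_
  have hpot : (potOf (-M n : ℤ) (M n) (η n) : ℝ) ≤ C * n * ((C + 1) * n) ^ 2 := by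
    have h1 : potOf (-M n : ℤ) (M n) (η n) ≤
        ∑ x ∈ Finset.Icc (-M n : ℤ) (M n), (η n x : ℤ) * (M n + 1) ^ 2 := by
      refine Finset.sum_le_sum fun x _ => mul_le_mul_of_nonneg_left ?_ (by positivity)
      unfold pot
      nlinarith [sq_nonneg x]
    rw [← Finset.sum_mul] at h1
    have h2 : (potOf (-M n : ℤ) (M n) (η n) : ℝ) ≤
        (∑ x ∈ Finset.Icc (-M n : ℤ) (M n), η n x : ℕ) * ((M n : ℝ) + 1) ^ 2 := by
      exact_mod_cast h1
    have h3 : ((∑ x ∈ Finset.Icc (-M n : ℤ) (M n), η n x : ℕ) : ℝ) ≤ C * n := by exact_mod_cast hη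
    exact h2.trans (mul_le_mul h3 (pow_le_pow_left₀ (by positivity) hL 2) (by positivity)
      (by positivity))
  rw [div_le_iff₀ (by positivity)]
  push_cast
  have h4 : 2 * ((4 * (C : ℝ) + 9) * (C + 1) ^ 2) * (n : ℝ) ^ 3 ≤ stepProb lam * C1 * (n : ℝ) ^ 3 :=
    mul_le_mul_of_nonneg_right hC1p (by positivity)
  have h5 : (C : ℝ) * n * ((C + 1) * n) ^ 2 = C * (C + 1) ^ 2 * (n : ℝ) ^ 3 := by ring
  have h6 : 0 ≤ (C : ℝ) * (C + 1) ^ 2 * (n : ℝ) ^ 3 := by positivity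
  have h7 : -1 * (n : ℝ) * (3 * ((C + 1) * n)) ^ 2 = -(9 * (C + 1) ^ 2 * (n : ℝ) ^ 3) := by ring
  rw [h7]
  linarith

/-- Large imbalances between steps to the right and to the left have summable probabilities. -/
theorem unbalanced_small (lam lam' : ℝ≥0∞) {C1 : ℕ} (hC1 : 0 < C1) (C : ℕ) {c : ℝ} (hc : 0 < c)
    (D : ℕ → Finset ℤ) (η : ℕ → ℤ → ℕ) (A : ℕ → ℕ → Finset ℤ) :
    Small lam fun n => {ρ | ∃ u, IsOdo lam' (D n) ρ (η n) u ∧ ∑ x ∈ D n, u x < C1 * n ^ 3 ∧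
      ∃ i < C * n, A n i ⊆ D n ∧
        c * (n : ℝ) ^ 2 < |((∑ x ∈ A n i, net ρ x (u x) : ℤ) : ℝ)|} := by
  refine Small.of_le (K := 1) ?_
  have hC1' : (0 : ℝ) < C1 := by exact_mod_cast hC1
  filter_upwards [eventually_ge_atTop 1,
    eventually_pow_mul_exp_le (2 * C) 1 (c := c ^ 2 / (2 * C1)) (by positivity)] with n hn hexp
  have hn1 : (0 : ℝ) < n := by exact_mod_cast hn
  set E : ℕ → Set Stacks := fun i => {ρ | ∃ u, IsOdo lam' (D n) ρ (η n) u ∧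
    ∑ x ∈ D n, u x < C1 * n ^ 3 ∧ c * (n : ℝ) ^ 2 ≤ |((∑ x ∈ A n i, net ρ x (u x) : ℤ) : ℝ)| ∧
    ((∑ x ∈ A n i, u x : ℕ) : ℝ) ≤ C1 * (n : ℝ) ^ 3} with hE
  have hsub : {ρ | ∃ u, IsOdo lam' (D n) ρ (η n) u ∧ ∑ x ∈ D n, u x < C1 * n ^ 3 ∧
      ∃ i < C * n, A n i ⊆ D n ∧
        c * (n : ℝ) ^ 2 < |((∑ x ∈ A n i, net ρ x (u x) : ℤ) : ℝ)|}
      ⊆ ⋃ i ∈ Finset.range (C * n), E i := by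
    rintro ρ ⟨u, hu, ht, i, hi, hA, hnet⟩
    simp only [Set.mem_iUnion]
    refine ⟨i, Finset.mem_range.2 hi, u, hu, ht, hnet.le, ?_⟩
    have h1 := (Finset.sum_le_sum_of_subset (f := u) hA).trans ht.le
    exact_mod_cast h1
  refine (measure_mono hsub).trans ((stackLaw_biUnion_le _ E (k := C * n)
    (q := 2 * Real.exp (-(c ^ 2 / (2 * C1)) * n)) (by positivity) (by simp) fun i _ => ?_).trans
    (ENNReal.ofReal_le_ofReal (le_trans (le_of_eq ?_) hexp)))
  · refine (net_bound lam lam' (D n) (A n i) _ _ (by positivity) (by positivity)).trans ?_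
    rw [ENNReal.ofReal_mul (by norm_num), ENNReal.ofReal_ofNat]
    refine le_of_eq ?_
    congr 3
    field_simp
  · ring

/-- There are O(n²) blocks, each of length at least δn/4, and failing to fill one of them is
exponentially unlikely. -/
theorem unfilled_small (lam : ℝ≥0∞) {δ : ℝ} (hδ : 0 < δ) (hδ2 : δ ≤ 1 / 2) (C : ℕ) :
    Small lam fun n => {ρ | ∃ (y : ℤ) (w : ℕ), 1 ≤ y ∧ y + w - 1 ≤ C * n ∧ δ * n / 4 ≤ w ∧ ∃ v,
      IsOdo ∞ (Finset.Icc y (y + w - 1) : Finset ℤ) ρ (single y (fillNumber δ w)) v ∧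
      ∃ x ∈ Finset.Icc y (y + w - 1), cnt (single y (fillNumber δ w)) ρ v x < 1} := by
  obtain ⟨c, hc, hb⟩ := fill_bound lam hδ hδ2
  refine Small.of_le (K := 1) ?_
  -- This makes δn/4 at least 2/δ, as `fill_bound` requires.
  obtain ⟨N, hN⟩ := exists_nat_ge (8 / δ ^ 2)
  filter_upwards [eventually_ge_atTop 1, eventually_ge_atTop N,
    eventually_pow_mul_exp_le ((C + 1) ^ 2 * (2 * C + 1)) 3 (c := c * δ / 4) (by positivity)]
    with n hn hnN hexp
  have hn1 : (1 : ℝ) ≤ n := by exact_mod_cast hn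
  have hnN' : 8 / δ ^ 2 ≤ n := hN.trans (by exact_mod_cast hnN)
  set E : ℕ × ℕ → Set Stacks := fun i => {ρ | δ * n / 4 ≤ i.2 ∧ i.2 ≤ C * n ∧
    ∃ v, IsOdo ∞ (Finset.Icc (i.1 : ℤ) (i.1 + i.2 - 1) : Finset ℤ) ρ
      (single i.1 (fillNumber δ i.2)) v ∧
      ∃ x ∈ Finset.Icc (i.1 : ℤ) (i.1 + i.2 - 1), cnt (single i.1 (fillNumber δ i.2)) ρ v x < 1}
    with hE
  set s := Finset.range (C * n + 1) ×ˢ Finset.range (C * n + 1) with hs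
  refine (measure_mono (t := ⋃ i ∈ s, E i) ?_).trans ((stackLaw_biUnion_le s E
    (k := ((C + 1) * n) ^ 2) (q := (2 * C + 1) * n * Real.exp (-(c * δ / 4) * n))
    (by positivity) ?_ ?_).trans (ENNReal.ofReal_le_ofReal (le_trans (le_of_eq ?_) hexp)))
  · rintro ρ ⟨y, w, hy, hyw, hw, v, hv, x, hx, hcx⟩
    obtain ⟨k, rfl⟩ := Int.eq_ofNat_of_zero_le (show 0 ≤ y by omega)
    have hyw' : k + w ≤ C * n + 1 := by
      have : (k : ℤ) + w ≤ C * n + 1 := by linarith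
      exact_mod_cast this
    simp only [Set.mem_iUnion]
    have hk : 1 ≤ k := by omega
    have hw1 : 0 < w := by
      have : (0 : ℝ) < w := lt_of_lt_of_le (by positivity) hw
      exact_mod_cast this
    exact ⟨(k, w), by rw [hs, Finset.mem_product, Finset.mem_range, Finset.mem_range]; omega,
      hw, by dsimp only; omega, v, hv, x, hx, hcx⟩
  · rw [hs, Finset.card_product, Finset.card_range]
    push_cast
    rw [pow_two]
    gcongr <;> nlinarith
  · rintro ⟨k, w⟩ _
    by_cases hw : δ * n / 4 ≤ w ∧ w ≤ C * n
    · refine (measure_mono fun ρ hρ => hρ.2.2).trans ((hb k w ?_).trans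
        (ENNReal.ofReal_le_ofReal ?_))
      · refine le_trans ?_ hw.1
        rw [div_le_iff₀ hδ]
        rw [div_le_iff₀ (by positivity)] at hnN'
        nlinarith
      · have h2 : (w : ℝ) ≤ C * n := by exact_mod_cast hw.2
        refine mul_le_mul (by nlinarith) (Real.exp_le_exp.2 ?_) (Real.exp_nonneg _) (by positivity)
        have h3 := mul_le_mul_of_nonneg_left hw.1 hc.le
        linarith
    · refine le_of_eq_of_le ?_ zero_le
      rw [show E (k, w) = ∅ from Set.eq_empty_of_forall_notMem fun ρ hρ => hw ⟨hρ.1, hρ.2.1⟩]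
      exact measure_empty
  · ring

/-- Once Internal DLA has filled the block, the unused instructions are fresh, so the survivors obey
the tail bound defining ζ_in. The union is over O(n²) blocks and O(n⁶) pairs of inflows, against a
probability of order n⁻²⁰. -/
theorem crowded_small {lam : ℝ≥0∞} {z δ : ℝ} (hz : zetaIn lam < z) (hδ : 0 < δ) (C C1 : ℕ) :
    Small lam fun n => {ρ | ∃ (y : ℤ) (w l r : ℕ), 1 ≤ y ∧ y + w - 1 ≤ C * n ∧ δ * n / 4 ≤ w ∧
      l < C1 * n ^ 3 ∧ r < C1 * n ^ 3 ∧ ∃ v,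
      IsOdo ∞ (Finset.Icc y (y + w - 1) : Finset ℤ) ρ (edge y w l r) v ∧
      ∑ x ∈ Finset.Icc y (y + w - 1), v x < C1 * n ^ 3 ∧
      settle (Finset.Icc y (y + w - 1) : Finset ℤ) ρ (edge y w l r) v
        = ind (Finset.Icc y (y + w - 1)) ∧
      z * w < (survivors lam (shiftBy v ρ) (Finset.Icc y (y + w - 1)) : ℝ)} := by
  obtain ⟨W, hW⟩ := survivors_tail hz
  refine Small.of_le (K := ((C + 1) * C1) ^ 2 * (4 / δ) ^ 20) ?_
  obtain ⟨N, hN⟩ := exists_nat_ge (4 * W / δ)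
  filter_upwards [eventually_ge_atTop 1, eventually_ge_atTop N] with n hn hnN
  have hn1 : (1 : ℝ) ≤ n := by exact_mod_cast hn
  have hnN' : 4 * W / δ ≤ n := hN.trans (by exact_mod_cast hnN)
  set t := C1 * n ^ 3 with ht
  set E : (ℕ × ℕ) × (ℕ × ℕ) → Set Stacks := fun i => {ρ | δ * n / 4 ≤ i.1.2 ∧
    ∃ v, IsOdo ∞ (Finset.Icc (i.1.1 : ℤ) (i.1.1 + i.1.2 - 1) : Finset ℤ) ρ
      (edge i.1.1 i.1.2 i.2.1 i.2.2) v ∧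
      ∑ x ∈ Finset.Icc (i.1.1 : ℤ) (i.1.1 + i.1.2 - 1), v x < t ∧
      settle (Finset.Icc (i.1.1 : ℤ) (i.1.1 + i.1.2 - 1) : Finset ℤ) ρ
        (edge i.1.1 i.1.2 i.2.1 i.2.2) v = ind (Finset.Icc (i.1.1 : ℤ) (i.1.1 + i.1.2 - 1)) ∧
      z * i.1.2 < (survivors lam (shiftBy v ρ)
        (Finset.Icc (i.1.1 : ℤ) (i.1.1 + i.1.2 - 1)) : ℝ)} with hE
  set s := (Finset.range (C * n + 1) ×ˢ Finset.range (C * n + 1)) ×ˢ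
    (Finset.range t ×ˢ Finset.range t) with hs
  refine (measure_mono (t := ⋃ i ∈ s, E i) ?_).trans ((stackLaw_biUnion_le s E
    (k := ((C + 1) * n) ^ 2 * (C1 * n ^ 3) ^ 2) (q := (4 / (δ * n)) ^ 20)
    (by positivity) ?_ ?_).trans (ENNReal.ofReal_le_ofReal ?_))
  · rintro ρ ⟨y, w, l, r, hy, hyw, hw, hl, hr, v, hv⟩
    obtain ⟨k, rfl⟩ := Int.eq_ofNat_of_zero_le (show 0 ≤ y by omega)
    have hyw' : k + w ≤ C * n + 1 := by
      have : (k : ℤ) + w ≤ C * n + 1 := by linarith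
      exact_mod_cast this
    simp only [Set.mem_iUnion]
    have hk : 1 ≤ k := by omega
    have hw1 : 0 < w := by
      have : (0 : ℝ) < w := lt_of_lt_of_le (by positivity) hw
      exact_mod_cast this
    refine ⟨((k, w), (l, r)), ?_, hw, v, hv⟩
    simp only [hs, Finset.mem_product, Finset.mem_range]
    omega
  · simp only [hs, Finset.card_product, Finset.card_range]
    rw [ht]
    push_cast
    have h1 : (C : ℝ) * n + 1 ≤ (C + 1) * n := by nlinarith
    have h0 : (0 : ℝ) ≤ C * n + 1 := by positivity
    refine mul_le_mul ?_ (le_of_eq (by ring)) (by positivity) (by positivity)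
    rw [pow_two]
    exact mul_le_mul h1 h1 h0 (by positivity)
  · rintro ⟨⟨k, w⟩, ⟨l, r⟩⟩ _
    by_cases hw : δ * n / 4 ≤ w
    · have hw0 : (0 : ℝ) < δ * n / 4 := by positivity
      have hWw : W ≤ w := by
        have : (W : ℝ) ≤ w := by
          rw [div_le_iff₀ hδ] at hnN'
          linarith
        exact_mod_cast this
      set K := Finset.Icc (k : ℤ) (k + w - 1) with hK
      have h1 : ∀ ξ : ℤ → ℕ, stackLaw lam {ρ | ξ = ind K ∧ z * w < (survivors lam ρ K : ℝ)}
          ≤ ((w : ℝ≥0∞) ^ 20)⁻¹ := fun ξ =>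
        (measure_mono fun ρ hρ => hρ.2).trans (hW k w hWw)
      refine (measure_mono ?_).trans ((fresh_after_top (lam := lam) (D := K)
        (η := edge k w l r) h1 t).trans ?_)
      · rintro ρ ⟨_, v, h1, h2, h3, h4⟩
        exact ⟨v, h1, h2, h3, h4⟩
      · have hwpos : (0 : ℝ) < w := lt_of_lt_of_le hw0 hw
        rw [← ENNReal.ofReal_natCast, ← ENNReal.ofReal_pow hwpos.le,
          ← ENNReal.ofReal_inv_of_pos (by positivity)]
        refine ENNReal.ofReal_le_ofReal ?_
        rw [← inv_pow]
        refine pow_le_pow_left₀ (by positivity) ?_ 20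
        rw [inv_le_comm₀ hwpos (by positivity), inv_div]
        exact hw
    · refine le_of_eq_of_le ?_ zero_le
      rw [show E ((k, w), (l, r)) = ∅ from Set.eq_empty_of_forall_notMem fun ρ hρ => hw hρ.1]
      exact measure_empty
  · rw [le_div_iff₀ (by positivity)]
    have e : ((C + 1) * n : ℝ) ^ 2 * (C1 * n ^ 3) ^ 2 * (4 / (δ * n)) ^ 20 * n ^ 2
        = ((C + 1) * C1) ^ 2 * (4 / δ) ^ 20 * (1 / n ^ 10) := by
      field_simp
    rw [e]
    refine mul_le_of_le_one_right (by positivity) ?_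
    rw [div_le_one (by positivity)]
    exact one_le_pow₀ hn1

theorem goodRight_small {lam : ℝ≥0∞} {z δ : ℝ} (hz : zetaIn lam < z) (hδ : 0 < δ)
    (hδ2 : δ ≤ 1 / 2) {C : ℕ} (hC : 1 ≤ C) : ∃ C1 : ℕ, Small lam fun n =>
      {ρ | ¬ GoodRight lam ρ n (C * n) (C1 * n ^ 3) z δ} := by
  obtain ⟨C1, hC1, h1⟩ := long_small lam C
  refine ⟨C1, ?_⟩
  have s1 := h1 lam (fun n => C * n) (fun n => single 0 n) (Eventually.of_forall fun n =>
    ⟨le_rfl, by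
      rw [Finset.sum_eq_single_of_mem 0 (by rw [Finset.mem_Icc]; omega)
        (fun x _ hx => by simp [single, hx])]
      simp only [single, if_true]
      exact Nat.le_mul_of_pos_left n hC⟩)
  have s2 := unbalanced_small lam lam hC1 C (c := δ ^ 3 / 2) (by positivity)
    (fun n => Finset.Icc (-(C * n : ℕ) : ℤ) (C * n : ℕ)) (fun n => single 0 n)
    (fun n i => Finset.Icc (i + 1 : ℤ) (C * n : ℕ))
  have s3 := unfilled_small lam hδ hδ2 C
  have s4 := crowded_small hz hδ C C1
  refine (((s1.union s2).union s3).union s4).mono (Eventually.of_forall fun n ρ hρ => ?_)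
  by_contra hcon
  simp only [Set.mem_union, not_or] at hcon
  obtain ⟨⟨⟨g1, g2⟩, g3⟩, g4⟩ := hcon
  have ht : ∀ u, IsOdo lam (Finset.Icc (-(C * n : ℕ) : ℤ) (C * n : ℕ) : Finset ℤ) ρ (single 0 n) u →
    ∑ x ∈ Finset.Icc (-(C * n : ℕ) : ℤ) (C * n : ℕ), u x < C1 * n ^ 3 := fun u hu => by
      obtain ⟨u', hu', hlt⟩ := not_not.1 g1
      rwa [hu.unique hu']
  refine hρ ⟨ht, fun u hu y hy1 hy2 => ?_, fun y w hy hyw hw v hv x hx => ?_,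
    fun y w l r hy hyw hw hl hr v hv hvt hs => ?_⟩
  · by_contra hbad
    obtain ⟨i, rfl⟩ : ∃ i : ℕ, y = i + 1 := ⟨(y - 1).toNat, by omega⟩
    refine g2 ⟨u, hu, ht u hu, i, by omega, Finset.Icc_subset_Icc (by omega) le_rfl, ?_⟩
    have := not_le.1 hbad
    refine lt_of_eq_of_lt ?_ this
    ring
  · by_contra hbad
    exact g3 ⟨y, w, hy, by push_cast at hyw; exact hyw, hw, v, hv, x, hx, not_le.1 hbad⟩
  · by_contra hbad
    exact g4 ⟨y, w, l, r, hy, by push_cast at hyw; exact hyw, hw, hl, hr, v, hv, hvt, hs,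
      not_le.1 hbad⟩

/-! ### Symmetries -/

/-- `e` maps the stacks `ρ` and the configuration `η` to `ρ'` and `η'`. -/
structure Intertwines (lam : ℝ≥0∞) (e : ℤ ≃ ℤ) (ρ ρ' : Stacks) (η η' : ℤ → ℕ) : Prop where
  cnt_eq : ∀ u x, cnt η' ρ' (u ∘ e.symm) (e x) = cnt η ρ u x
  stable_iff : ∀ x k c, StableAt lam ρ' (e x) k c ↔ StableAt lam ρ x k c

theorem Intertwines.symm {lam : ℝ≥0∞} {e : ℤ ≃ ℤ} {ρ ρ' : Stacks} {η η' : ℤ → ℕ}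
    (h : Intertwines lam e ρ ρ' η η') : Intertwines lam e.symm ρ' ρ η' η where
  cnt_eq u x := by
    have := h.cnt_eq (u ∘ e) (e.symm x)
    rw [e.apply_symm_apply, Function.comp_assoc, e.self_comp_symm, Function.comp_id] at this
    rw [this, Equiv.symm_symm]
  stable_iff x k c := by
    rw [← h.stable_iff, e.apply_symm_apply]

theorem odo_map (e : ℤ ≃ ℤ) (α : List ℤ) : odo (α.map e) = odo α ∘ e.symm := by
  funext x
  unfold odo
  simp only [Function.comp]
  conv_lhs => rw [← e.apply_symm_apply x]
  exact List.count_map_of_injective _ _ e.injective _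

theorem Intertwines.legal {lam : ℝ≥0∞} {e : ℤ ≃ ℤ} {ρ ρ' : Stacks} {η η' : ℤ → ℕ}
    (h : Intertwines lam e ρ ρ' η η') {D D' : Set ℤ} (hD : ∀ x ∈ D, e x ∈ D') {α : List ℤ}
    (hα : Legal lam D ρ (State.init (act η)) α) :
    Legal lam D' ρ' (State.init (act η')) (α.map e) := by
  induction α using List.reverseRecOn with
  | nil => trivial
  | append_singleton α x ih =>
    rw [legal_snoc_iff] at hα
    rw [List.map_append, List.map_singleton, legal_snoc_iff, odo_map, h.cnt_eq, h.stable_iff]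
    simp only [Function.comp, e.symm_apply_apply]
    exact ⟨ih hα.1, hD x hα.2.1, hα.2.2⟩

theorem Intertwines.isOdo {lam : ℝ≥0∞} {e : ℤ ≃ ℤ} {ρ ρ' : Stacks} {η η' : ℤ → ℕ}
    (h : Intertwines lam e ρ ρ' η η') {D D' : Set ℤ} (hD : ∀ x, e x ∈ D' ↔ x ∈ D) {u : ℤ → ℕ}
    (hu : IsOdo lam D ρ η u) : IsOdo lam D' ρ' η' (u ∘ e.symm) := by
  obtain ⟨α, hα, rfl⟩ := hu
  refine ⟨α.map e, (h.legal (fun x hx => (hD x).2 hx) hα.1).stabilizes ?_, odo_map e α⟩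
  rw [odo_map]
  refine ⟨fun x hx => hα.stab.off _ fun hc => hx ?_, fun x hx => ?_⟩
  · rw [← hD, e.apply_symm_apply] at hc
    exact hc
  · obtain ⟨y, rfl⟩ := e.surjective x
    rw [h.cnt_eq, h.stable_iff]
    simp only [Function.comp, e.symm_apply_apply]
    exact hα.stab.stable y ((hD y).1 hx)

theorem Intertwines.odometer_le {lam : ℝ≥0∞} {e : ℤ ≃ ℤ} {ρ ρ' : Stacks} {η η' : ℤ → ℕ}
    (h : Intertwines lam e ρ ρ' η η') (x : ℤ) :
    odometer lam ρ (act η) x ≤ odometer lam ρ' (act η') (e x) := by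
  unfold odometer
  refine iSup₂_le fun α hα => ?_
  refine le_trans (le_of_eq ?_) (le_iSup₂ (f := fun (α : List ℤ)
    (_ : Legal lam Set.univ ρ' (State.init (act η')) α) => (α.count (e x) : ℕ∞)) (α.map e)
    (h.legal (D' := Set.univ) (fun _ _ => trivial) hα))
  rw [List.count_map_of_injective _ _ e.injective]

theorem Intertwines.odometer_eq {lam : ℝ≥0∞} {e : ℤ ≃ ℤ} {ρ ρ' : Stacks} {η η' : ℤ → ℕ}
    (h : Intertwines lam e ρ ρ' η η') (x : ℤ) :
    odometer lam ρ' (act η') (e x) = odometer lam ρ (act η) x := by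
  refine le_antisymm ((h.symm.odometer_le (e x)).trans (le_of_eq ?_)) (h.odometer_le x)
  rw [e.symm_apply_apply]

/-- The stacks seen from the site `y`. -/
def translate (y : ℤ) (ρ : Stacks) : Stacks := fun p => ρ (p.1 + y, p.2)

/-- Serves to move the moment hypothesis from the origin to any other site. -/
theorem intertwines_translate (lam : ℝ≥0∞) (y : ℤ) (ρ : Stacks) (η : ℤ → ℕ) :
    Intertwines lam (Equiv.subRight y) ρ (translate y ρ) η (fun x => η (x + y)) where
  cnt_eq u x := by
    have e1 : x - y - 1 + y = x - 1 := by ring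
    have e2 : x - y + 1 + y = x + 1 := by ring
    have e3 : x - y + y = x := by ring
    simp [cnt, rights, lefts, translate, e1, e2, e3]
  stable_iff x k c := by
    simp [StableAt, translate]

theorem measurePreserving_translate (lam : ℝ≥0∞) (y : ℤ) :
    MeasurePreserving (translate y) (stackLaw lam) (stackLaw lam) := by
  refine ⟨measurable_pi_iff.2 fun p => measurable_pi_apply (p.1 + y, p.2), ?_⟩
  have hinj : Function.Injective fun p : ℤ × ℕ => (p.1 + y, p.2) := by
    rintro ⟨a, b⟩ ⟨c, d⟩ h
    simp only [Prod.mk.injEq, add_left_inj] at h ⊢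
    exact h
  exact Measure.map_infinitePi_infinitePi_of_inj (P := fun _ : ℤ × ℕ => instrLaw lam) hinj

/-- Exchange of right and left. -/
def Instr.flip : Instr → Instr
  | .sleep => .sleep
  | .left => .right
  | .right => .left

/-- The mirror image of the stacks. -/
def mirror (ρ : Stacks) : Stacks := fun p => (ρ (-p.1, p.2)).flip

theorem rights_mirror (ρ : Stacks) (x : ℤ) (k : ℕ) : rights (mirror ρ) x k = lefts ρ (-x) k := by
  unfold rights lefts mirror
  refine Finset.sum_congr rfl fun j _ => ?_
  cases ρ (-x, j) <;> rfl

theorem lefts_mirror (ρ : Stacks) (x : ℤ) (k : ℕ) : lefts (mirror ρ) x k = rights ρ (-x) k := by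
  unfold rights lefts mirror
  refine Finset.sum_congr rfl fun j _ => ?_
  cases ρ (-x, j) <;> rfl

theorem net_mirror (ρ : Stacks) (x : ℤ) (k : ℕ) : net (mirror ρ) x k = -net ρ (-x) k := by
  unfold net
  rw [rights_mirror, lefts_mirror]
  ring

/-- Reduces every statement about the left of the origin to one about its right. -/
theorem intertwines_mirror (lam : ℝ≥0∞) (ρ : Stacks) (η : ℤ → ℕ) :
    Intertwines lam (Equiv.neg ℤ) ρ (mirror ρ) η (fun x => η (-x)) where
  cnt_eq u x := by
    have e1 : -(-x - 1) = x + 1 := by ring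
    have e2 : -(-x + 1) = x - 1 := by ring
    simp only [cnt, rights_mirror, lefts_mirror, Equiv.neg_apply, Equiv.neg_symm, Function.comp,
      neg_neg, e1, e2]
    ring
  stable_iff x k c := by
    have : (ρ (x, k - 1)).flip = .sleep ↔ ρ (x, k - 1) = .sleep := by
      cases ρ (x, k - 1) <;> simp [Instr.flip]
    simp only [StableAt, mirror, Equiv.neg_apply, neg_neg, this]

theorem IsOdo.mirror {lam : ℝ≥0∞} {M : ℕ} {ρ : Stacks} {η u : ℤ → ℕ}
    (h : IsOdo lam (Finset.Icc (-M : ℤ) M : Finset ℤ) ρ η u) :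
    IsOdo lam (Finset.Icc (-M : ℤ) M : Finset ℤ) (mirror ρ) (fun x => η (-x)) (fun x => u (-x)) :=
  (intertwines_mirror lam ρ η).isOdo (fun x => by simp [neg_le, and_comm]) h

theorem instrLaw_flip (lam : ℝ≥0∞) : (instrLaw lam).map Instr.flip = instrLaw lam := by
  have hm : Measurable Instr.flip := measurable_from_top
  unfold instrLaw
  rw [Measure.map_add _ _ hm, Measure.map_add _ _ hm, Measure.map_smul, Measure.map_smul,
    Measure.map_smul, Measure.map_dirac' hm, Measure.map_dirac' hm, Measure.map_dirac' hm]
  simp only [Instr.flip]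
  have : instrWeight lam .left = instrWeight lam .right := rfl
  rw [this, add_assoc, add_comm (_ • Measure.dirac Instr.right), ← add_assoc]

theorem measurePreserving_mirror (lam : ℝ≥0∞) :
    MeasurePreserving mirror (stackLaw lam) (stackLaw lam) := by
  have hm : Measurable Instr.flip := measurable_from_top
  have h1 : MeasurePreserving (fun (ρ : Stacks) (p : ℤ × ℕ) => (ρ p).flip)
      (stackLaw lam) (stackLaw lam) := by
    refine ⟨measurable_pi_iff.2 fun p => hm.comp (measurable_pi_apply p), ?_⟩
    unfold stackLaw
    rw [Measure.infinitePi_map_pi _ fun _ => hm]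
    simp only [instrLaw_flip]
  have h2 : MeasurePreserving (fun (ρ : Stacks) (p : ℤ × ℕ) => ρ (-p.1, p.2))
      (stackLaw lam) (stackLaw lam) := by
    refine ⟨measurable_pi_iff.2 fun p => measurable_pi_apply (-p.1, p.2), ?_⟩
    have hinj : Function.Injective fun p : ℤ × ℕ => (-p.1, p.2) := by
      rintro ⟨a, b⟩ ⟨c, d⟩ h
      simp only [Prod.mk.injEq, neg_inj] at h ⊢
      exact h
    exact Measure.map_infinitePi_infinitePi_of_inj (P := fun _ : ℤ × ℕ => instrLaw lam) hinj
  exact h1.comp h2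

theorem Small.comp {lam : ℝ≥0∞} {E : ℕ → Set Stacks} (hE : Small lam E) {f : Stacks → Stacks}
    (hf : MeasurePreserving f (stackLaw lam) (stackLaw lam)) : Small lam fun n => f ⁻¹' E n := by
  refine ne_top_of_le_ne_top hE (ENNReal.tsum_le_tsum fun n => ?_)
  rw [← measure_toMeasurable (E n),
    ← hf.measure_preimage (measurableSet_toMeasurable _ _).nullMeasurableSet]
  exact measure_mono (Set.preimage_mono (subset_toMeasurable _ _))

/-! ### Internal DLA in an environment -/

theorem sum_symm_range {R : Type*} [AddCommMonoid R] (f : ℤ → R) (m : ℕ) :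
    ∑ i ∈ Finset.range (2 * m + 1), f (-m + i)
      = f 0 + (∑ i ∈ Finset.range m, f (1 + i) + ∑ i ∈ Finset.range m, f (-(1 + i))) := by
  induction m with
  | zero => simp
  | succ m ih =>
    rw [show 2 * (m + 1) + 1 = (2 * m + 1) + 1 + 1 by ring, Finset.sum_range_succ,
      Finset.sum_range_succ', Finset.sum_range_succ (fun i : ℕ => f (1 + i)),
      Finset.sum_range_succ (fun i : ℕ => f (-(1 + i)))]
    have h : ∑ i ∈ Finset.range (2 * m + 1), f (-((m + 1 : ℕ) : ℤ) + ((i + 1 : ℕ) : ℤ))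
        = ∑ i ∈ Finset.range (2 * m + 1), f (-m + i) :=
      Finset.sum_congr rfl fun i _ => by congr 1; push_cast; ring
    rw [h, ih]
    have e1 : -((m + 1 : ℕ) : ℤ) + ((0 : ℕ) : ℤ) = -(1 + m) := by push_cast; ring
    have e2 : -((m + 1 : ℕ) : ℤ) + ((2 * m + 1 + 1 : ℕ) : ℤ) = 1 + m := by push_cast; ring
    rw [e1, e2]
    abel

/-- Summation by parts. -/
theorem sum_pos_estimate {f : ℕ → ℝ} {z e : ℝ} {m : ℕ}
    (h : ∀ j ≤ m, |∑ i ∈ Finset.range j, f i - z * j| ≤ e) :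
    ∀ j ≤ m, |∑ i ∈ Finset.range j, (i + 1) * f i - z * (j * (j + 1) / 2)| ≤ 2 * e * j := by
  have key : ∀ j : ℕ, ∑ i ∈ Finset.range j, ((i : ℝ) + 1) * f i
      = j * ∑ i ∈ Finset.range j, f i - ∑ i ∈ Finset.range j, ∑ k ∈ Finset.range i, f k := by
    intro j
    induction j with
    | zero => simp
    | succ j ih =>
      rw [Finset.sum_range_succ, ih, Finset.sum_range_succ (fun i => ∑ k ∈ Finset.range i, f k),
        Finset.sum_range_succ f]
      push_cast
      ring
  intro j hj
  have h1 : |∑ i ∈ Finset.range j, (∑ k ∈ Finset.range i, f k - z * i)| ≤ e * j := by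
    refine (Finset.abs_sum_le_sum_abs _ _).trans ((Finset.sum_le_card_nsmul _ _ e fun i hi =>
      h i ((Finset.mem_range.1 hi).le.trans hj)).trans (le_of_eq ?_))
    rw [Finset.card_range, nsmul_eq_mul, mul_comm]
  have h2 : ∑ i ∈ Finset.range j, (z * (i : ℝ)) = z * (j * (j - 1) / 2) := by
    clear hj h1
    induction j with
    | zero => simp
    | succ j ih => rw [Finset.sum_range_succ, ih]; push_cast; ring
  rw [Finset.sum_sub_distrib, h2] at h1
  have h3 := h j hj
  have h4 : |(j : ℝ) * (∑ i ∈ Finset.range j, f i - z * j)| ≤ j * e := by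
    rw [abs_mul, Nat.abs_cast]
    exact mul_le_mul_of_nonneg_left h3 (by positivity)
  rw [key]
  rw [abs_le] at *
  constructor <;> linarith

/-- `n` particles at the origin, and one particle at each site not occupied by `η`. -/
def holes (n : ℕ) (η : ℤ → ℕ) : ℤ → ℕ := fun x => single 0 n x + (1 - η x)

/-- The counts of `η` on `m` sites on each side of the origin are close to their mean. -/
structure Regular (η : ℤ → ℕ) (z e : ℝ) (m : ℕ) : Prop where
  right : ∀ j ≤ m, |∑ i ∈ Finset.range j, (η (1 + i) : ℝ) - z * j| ≤ e
  left : ∀ j ≤ m, |∑ i ∈ Finset.range j, (η (-(1 + i)) : ℝ) - z * j| ≤ e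

theorem Regular.mirror {η : ℤ → ℕ} {z e : ℝ} {m : ℕ} (h : Regular η z e m) :
    Regular (fun x => η (-x)) z e m :=
  ⟨h.left, by simpa only [neg_neg] using h.right⟩

theorem IsOdo.mass {lam : ℝ≥0∞} {m : ℕ} {ρ : Stacks} {η v : ℤ → ℕ}
    (hv : IsOdo lam (Finset.Icc (-m : ℤ) m : Finset ℤ) ρ η v) :
    ∑ i ∈ Finset.range (2 * m + 1), (cnt η ρ v (-m + i) - η (-m + i))
      = -(rights ρ m (v m) : ℤ) - lefts ρ (-m) (v (-m)) := by
  have hr : v (m + 1) = 0 := hv.stab.off _ (by rw [Finset.mem_coe, Finset.mem_Icc]; omega)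
  have hl : v (-m - 1) = 0 := hv.stab.off _ (by rw [Finset.mem_coe, Finset.mem_Icc]; omega)
  rw [Finset.sum_sub_distrib, sum_cnt]
  have e1 : (-m : ℤ) + ((2 * m + 1 : ℕ) : ℤ) = m + 1 := by push_cast; ring
  rw [e1, hr, hl, add_sub_cancel_right]
  simp only [rights_zero, lefts_zero]
  push_cast
  ring

/-- First moment about the origin, that is, the moment from the left end minus m + 1 times the mass
balance; exits count at positions ±(m + 1). -/
theorem IsOdo.moment {lam : ℝ≥0∞} {m : ℕ} {ρ : Stacks} {η v : ℤ → ℕ}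
    (hv : IsOdo lam (Finset.Icc (-m : ℤ) m : Finset ℤ) ρ η v) :
    ∑ i ∈ Finset.range (2 * m + 1), (-m + i) * (cnt η ρ v (-m + i) - η (-m + i))
      = ∑ x ∈ Finset.Icc (-m : ℤ) m, net ρ x (v x)
        - (m + 1) * (rights ρ m (v m) : ℤ) + (m + 1) * lefts ρ (-m) (v (-m)) := by
  have hr : v (m + 1) = 0 := hv.stab.off _ (by rw [Finset.mem_coe, Finset.mem_Icc]; omega)
  have hl : v (-m - 1) = 0 := hv.stab.off _ (by rw [Finset.mem_coe, Finset.mem_Icc]; omega)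
  have h1 := sum_pos_cnt η ρ v (-m) (2 * m + 1)
  have h2 := hv.mass
  have e1 : (-m : ℤ) + ((2 * m + 1 : ℕ) : ℤ) = m + 1 := by push_cast; ring
  have e2 : ∑ x ∈ Finset.Icc (-m : ℤ) m, net ρ x (v x)
      = ∑ i ∈ Finset.range (2 * m + 1), net ρ (-m + i) (v (-m + i)) := by
    rw [← sum_Icc_eq_sum_range (fun x => net ρ x (v x)), e1, add_sub_cancel_right]
  rw [e1, hr, hl, add_sub_cancel_right] at h1
  simp only [rights_zero, lefts_zero] at h1
  rw [e2]
  have e3 : ∀ i : ℕ, (-m + i : ℤ) * (cnt η ρ v (-m + i) - η (-m + i))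
      = ((i : ℤ) + 1) * cnt η ρ v (-m + i) - ((i : ℤ) + 1) * η (-m + i)
        - (m + 1) * (cnt η ρ v (-m + i) - η (-m + i)) := fun i => by ring
  rw [Finset.sum_congr rfl fun i _ => e3 i, Finset.sum_sub_distrib, Finset.sum_sub_distrib,
    ← Finset.mul_sum, h1, h2]
  push_cast
  ring

theorem cnt_sub_of_zero {η v : ℤ → ℕ} {ρ : Stacks} {x : ℤ} (h : v x = 0) :
    cnt η ρ v x - η x = rights ρ (x - 1) (v (x - 1)) + lefts ρ (x + 1) (v (x + 1)) := by
  unfold cnt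
  rw [h, rights_zero, lefts_zero]
  push_cast
  ring

/-- If m fires, then so do all sites of [0, m], each ends with one particle, and the pile leaves
about zm particles there. Suppose that on the left the firing stops at -Y, with Y < m. The first
moment says that m² and Y² are close, hence so are Y and m, and the mass z(m + Y) exceeds n since
2zm ≥ (1 + δ)n. If -m fires too, the mass balance alone is contradictory. -/
theorem IsOdo.no_exit_right {ρ : Stacks} {η v : ℤ → ℕ} {n m : ℕ} {z e δ : ℝ}
    (hη : ∀ x, η x ≤ 1) (hz : 0 < z) (hδ : 0 < δ) (hδ1 : δ ≤ 1) (hreg : Regular η z e m)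
    (hm : n * (1 + δ) ≤ 2 * z * m) (he : 12 * e + 2 < δ * z * m)
    (hv : IsOdo ∞ (Finset.Icc (-m : ℤ) m : Finset ℤ) ρ (holes n η) v)
    (hnet : |((∑ x ∈ Finset.Icc (-m : ℤ) m, net ρ x (v x) : ℤ) : ℝ)| ≤ e * m) : v m = 0 := by
  by_contra hvm
  have he0 : 0 ≤ e := (abs_nonneg _).trans (hreg.right 0 (Nat.zero_le _))
  have hm0 : (0 : ℝ) < m := by
    rcases Nat.eq_zero_or_pos m with h | h
    · subst h; simp at he; linarith
    · exact_mod_cast h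
  have hh : ∀ x : ℤ, x ≠ 0 → holes n η x ≤ 1 := fun x hx => by simp [holes, single, hx]
  have hpos : ∀ x : ℤ, 0 ≤ x → x ≤ m → 0 < v x := by
    intro x hx0 hxm
    by_contra hc
    have hx : v x = 0 := by omega
    rcases hxm.eq_or_lt with h | h
    · exact hvm (h ▸ hx)
    · exact hvm (hv.zero_beyond (fun y hy => Or.inl ⟨rfl, hh y (by omega)⟩) hx h)
  -- Gain of particles at x. Away from the origin it equals η x at a fired site, since a hole
  -- already held its virtual particle.
  set g : ℤ → ℤ := fun x => cnt (holes n η) ρ v x - holes n η x with hg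
  have hgx : ∀ x : ℤ, x ≠ 0 → g x = cnt (holes n η) ρ v x - 1 + η x := by
    intro x hx
    have := hη x
    simp only [hg, holes, single, hx, if_false]
    omega
  have hc1 : ∀ x ∈ Finset.Icc (-m : ℤ) m, 0 < v x → cnt (holes n η) ρ v x = 1 := fun x hx h =>
    le_antisymm (hv.cnt_le_one (by exact_mod_cast hx)) (hv.one_le_cnt x (Or.inl h))
  have hgη : ∀ x ∈ Finset.Icc (-m : ℤ) m, x ≠ 0 → 0 < v x → g x = η x := by
    intro x hx hx0 h
    rw [hgx x hx0, hc1 x hx h]; ring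
  have hg0 : -(n : ℤ) ≤ g 0 := by
    have := hc1 0 (by rw [Finset.mem_Icc]; omega) (hpos 0 le_rfl (by omega))
    simp only [hg, this, holes, single, if_true]
    have := hη 0
    omega
  have mass := hv.mass
  have mom := hv.moment
  rw [sum_symm_range (fun x => cnt (holes n η) ρ v x - holes n η x)] at mass
  rw [sum_symm_range (fun x => x * (cnt (holes n η) ρ v x - holes n η x))] at mom
  change g 0 + (∑ i ∈ Finset.range m, g (1 + i) + ∑ i ∈ Finset.range m, g (-(1 + i))) = _ at mass
  change 0 * g 0 + (∑ i ∈ Finset.range m, (1 + (i : ℤ)) * g (1 + i)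
    + ∑ i ∈ Finset.range m, -(1 + (i : ℤ)) * g (-(1 + i))) = _ at mom
  have hright : ∀ i ∈ Finset.range m, g (1 + i) = η (1 + i) := fun i hi => by
    rw [Finset.mem_range] at hi
    exact hgη _ (by rw [Finset.mem_Icc]; omega) (by omega) (hpos _ (by omega) (by omega))
  rw [Finset.sum_congr rfl hright] at mass
  have hright' : ∑ i ∈ Finset.range m, (1 + (i : ℤ)) * g (1 + i)
      = ∑ i ∈ Finset.range m, (1 + (i : ℤ)) * η (1 + i) :=
    Finset.sum_congr rfl fun i hi => by rw [hright i hi]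
  rw [hright'] at mom
  have hR := abs_le.1 (hreg.right m le_rfl)
  have hPR := abs_le.1 (sum_pos_estimate hreg.right m le_rfl)
  set R : ℝ := ∑ i ∈ Finset.range m, (η (1 + i) : ℝ) with hRdef
  set PR : ℝ := ∑ i ∈ Finset.range m, ((i : ℝ) + 1) * (η (1 + i) : ℝ) with hPRdef
  have hRc : ((∑ i ∈ Finset.range m, (η (1 + i) : ℤ) : ℤ) : ℝ) = R := by push_cast; rfl
  have hPRc : ((∑ i ∈ Finset.range m, (1 + (i : ℤ)) * (η (1 + i) : ℤ) : ℤ) : ℝ) = PR := by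
    push_cast
    exact Finset.sum_congr rfl fun i _ => by ring
  by_cases hvl : v (-m) = 0
  · obtain ⟨Y, hYm, hY1, hY2⟩ : ∃ Y : ℕ, Y < m ∧ (∀ x : ℕ, x ≤ Y → 0 < v (-x)) ∧
        ∀ x : ℕ, Y < x → v (-x) = 0 := by
      classical
      have hex : ∃ x : ℕ, v (-x) = 0 := ⟨m, hvl⟩
      have h0 : Nat.find hex ≠ 0 := by
        intro h
        have := Nat.find_spec hex
        rw [h] at this
        have h' := hpos 0 le_rfl (by omega)
        simp only [Nat.cast_zero, neg_zero] at this
        omega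
      have hlem := Nat.find_min' hex hvl
      refine ⟨Nat.find hex - 1, by omega, fun x hx => ?_, fun x hx => ?_⟩
      · exact Nat.pos_of_ne_zero (Nat.find_min hex (by omega))
      · rcases (show Nat.find hex ≤ x by omega).eq_or_lt with h | h
        · rw [← h]; exact Nat.find_spec hex
        · exact hv.mirror.zero_beyond (x := (Nat.find hex : ℤ))
            (fun y hy => Or.inl ⟨rfl, hh _ (by omega)⟩) (Nat.find_spec hex) (by exact_mod_cast h)
    have hl1 : ∀ i ∈ Finset.range Y, g (-(1 + i)) = η (-(1 + i)) := fun i hi => by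
      rw [Finset.mem_range] at hi
      refine hgη _ (by rw [Finset.mem_Icc]; omega) (by omega) ?_
      have := hY1 (1 + i) (by omega)
      push_cast at this
      exact this
    -- The first site that does not fire may still have received a particle from its neighbour; it
    -- contributes at most 1 + Y to the moment.
    have hl2 : 0 ≤ g (-(1 + Y)) ∧ g (-(1 + Y)) ≤ 1 := by
      have h0 : v (-(1 + Y)) = 0 := by
        have := hY2 (1 + Y) (by omega)
        push_cast at this
        exact this
      constructor
      · rw [hg]
        dsimp only
        rw [cnt_sub_of_zero h0]
        positivity
      · have h1 : cnt (holes n η) ρ v (-(1 + Y)) ≤ 1 :=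
          hv.cnt_le_one (by rw [Finset.mem_coe, Finset.mem_Icc]; omega)
        rw [hg]
        dsimp only
        omega
    have hl3 : ∀ i, Y < i → g (-(1 + i)) = 0 := by
      intro i hi
      have h0 := hY2 (1 + i) (by omega)
      have h1 := hY2 i hi
      have h2 := hY2 (2 + i) (by omega)
      push_cast at h0 h1 h2
      rw [hg]
      dsimp only
      rw [cnt_sub_of_zero h0, show -(1 + (i : ℤ)) - 1 = -(2 + i) by ring,
        show -(1 + (i : ℤ)) + 1 = -i by ring, h1, h2, rights_zero, lefts_zero]
      rfl
    have hsub : Finset.range (Y + 1) ⊆ Finset.range m := Finset.range_mono (by omega)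
    rw [← Finset.sum_subset hsub (f := fun i : ℕ => g (-(1 + i))) (fun i _ hi => hl3 i (by
      rw [Finset.mem_range] at hi; omega)), Finset.sum_range_succ, Finset.sum_congr rfl hl1] at mass
    rw [← Finset.sum_subset hsub (f := fun i : ℕ => -(1 + (i : ℤ)) * g (-(1 + i))) (fun i _ hi => by
      rw [hl3 i (by rw [Finset.mem_range] at hi; omega), mul_zero]), Finset.sum_range_succ] at mom
    have hl4 : ∑ i ∈ Finset.range Y, -(1 + (i : ℤ)) * g (-(1 + i))
        = ∑ i ∈ Finset.range Y, -(1 + (i : ℤ)) * η (-(1 + i)) :=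
      Finset.sum_congr rfl fun i hi => by rw [hl1 i hi]
    rw [hl4] at mom
    have hL := abs_le.1 (hreg.left Y hYm.le)
    have hPL := abs_le.1 (sum_pos_estimate hreg.left Y hYm.le)
    set LY : ℝ := ∑ i ∈ Finset.range Y, (η (-(1 + i)) : ℝ) with hLdef
    set PL : ℝ := ∑ i ∈ Finset.range Y, ((i : ℝ) + 1) * (η (-(1 + i)) : ℝ) with hPLdef
    have hLc : ((∑ i ∈ Finset.range Y, (η (-(1 + i)) : ℤ) : ℤ) : ℝ) = LY := by push_cast; rfl
    have hPLc : ((∑ i ∈ Finset.range Y, -(1 + (i : ℤ)) * (η (-(1 + i)) : ℤ) : ℤ) : ℝ) = -PL := by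
      push_cast
      rw [hPLdef, ← Finset.sum_neg_distrib]
      exact Finset.sum_congr rfl fun i _ => by ring
    rw [hvl, lefts_zero] at mass mom
    have mass' : ∑ i ∈ Finset.range m, (η (1 + i) : ℤ)
        + ∑ i ∈ Finset.range Y, (η (-(1 + i)) : ℤ) ≤ n := by
      have := hl2.1
      push_cast at mass
      linarith [Int.natCast_nonneg (rights ρ m (v m))]
    have mass'' : R + LY ≤ n := by
      rw [← hRc, ← hLc]; exact_mod_cast mass'
    have mom' : ∑ i ∈ Finset.range m, (1 + (i : ℤ)) * (η (1 + i) : ℤ)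
        + ∑ i ∈ Finset.range Y, -(1 + (i : ℤ)) * (η (-(1 + i)) : ℤ)
        ≤ ∑ x ∈ Finset.Icc (-m : ℤ) m, net ρ x (v x) + (1 + Y) := by
      have h1 : (1 + (Y : ℤ)) * g (-(1 + Y)) ≤ 1 + Y := mul_le_of_le_one_right (by omega) hl2.2
      have h2 : 0 ≤ ((m : ℤ) + 1) * (rights ρ m (v m) : ℤ) := by positivity
      simp only [Nat.cast_zero, mul_zero, zero_mul, add_zero, zero_add] at mom
      linarith
    have mom'' : PR + -PL ≤ ((∑ x ∈ Finset.Icc (-m : ℤ) m, net ρ x (v x) : ℤ) : ℝ) + (1 + Y) := by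
      rw [← hPRc, ← hPLc]; exact_mod_cast mom'
    have hYm' : (Y : ℝ) + 1 ≤ m := by exact_mod_cast hYm
    have hN := (abs_le.1 hnet).2
    have hY0 : (0 : ℝ) ≤ Y := by positivity
    -- Exits to the right enter the first moment with a favourable sign, so only noise and
    -- environment errors, of order em, remain. Dividing by m gives m - Y = O((e + 1)/z).
    have k1 : z * (m * (m + 1) / 2) - z * (Y * (Y + 1) / 2) ≤ (5 * e + 1) * m := by
      have : 2 * e * Y ≤ 2 * e * m := mul_le_mul_of_nonneg_left (by linarith) (by linarith)
      linarith
    have k2 : z * (m - Y) * m ≤ (10 * e + 2) * m := by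
      have : (0 : ℝ) ≤ z * ((m - Y) * (Y + 1)) :=
        mul_nonneg hz.le (mul_nonneg (by linarith) (by linarith))
      linarith
    have k3 : z * (m - Y) ≤ 10 * e + 2 := le_of_mul_le_mul_right k2 hm0
    have k4 : (z * m + z * Y - 2 * e) * (1 + δ) ≤ 2 * z * m :=
      (mul_le_mul_of_nonneg_right (by linarith) (by linarith)).trans hm
    have k5 : z * (m - Y) * (1 + δ) ≤ (10 * e + 2) * (1 + δ) :=
      mul_le_mul_of_nonneg_right k3 (by linarith)
    have k6 : (12 * e + 2) * (1 + δ) ≤ (12 * e + 2) * 2 :=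
      mul_le_mul_of_nonneg_left (by linarith) (by linarith)
    linarith
  · have hposl : ∀ x : ℕ, x ≤ m → 0 < v (-x) := by
      intro x hxm
      by_contra hc
      rcases hxm.eq_or_lt with h | h
      · subst h; omega
      · exact hvl (hv.mirror.zero_beyond (x := (x : ℤ))
          (fun y hy => Or.inl ⟨rfl, hh _ (by omega)⟩) (by omega)
          (y := m) (by exact_mod_cast h))
    have hleft : ∀ i ∈ Finset.range m, g (-(1 + i)) = η (-(1 + i)) := fun i hi => by
      rw [Finset.mem_range] at hi
      refine hgη _ (by rw [Finset.mem_Icc]; omega) (by omega) ?_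
      have := hposl (1 + i) (by omega)
      push_cast at this
      exact this
    rw [Finset.sum_congr rfl hleft] at mass
    have hL := abs_le.1 (hreg.left m le_rfl)
    set LY : ℝ := ∑ i ∈ Finset.range m, (η (-(1 + i)) : ℝ) with hLdef
    have hLc : ((∑ i ∈ Finset.range m, (η (-(1 + i)) : ℤ) : ℤ) : ℝ) = LY := by push_cast; rfl
    have mass' : ∑ i ∈ Finset.range m, (η (1 + i) : ℤ)
        + ∑ i ∈ Finset.range m, (η (-(1 + i)) : ℤ) ≤ n := by
      linarith [Int.natCast_nonneg (rights ρ m (v m)), Int.natCast_nonneg (lefts ρ (-m) (v (-m)))]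
    have mass'' : R + LY ≤ n := by
      rw [← hRc, ← hLc]; exact_mod_cast mass'
    have k4 : (2 * z * m - 2 * e) * (1 + δ) ≤ 2 * z * m :=
      (mul_le_mul_of_nonneg_right (by linarith) (by linarith)).trans hm
    have k6 : 2 * e * (1 + δ) ≤ 2 * e * 2 := mul_le_mul_of_nonneg_left (by linarith) (by linarith)
    linarith

theorem IsOdo.no_exit {ρ : Stacks} {η v : ℤ → ℕ} {n m : ℕ} {z e δ : ℝ}
    (hη : ∀ x, η x ≤ 1) (hz : 0 < z) (hδ : 0 < δ) (hδ1 : δ ≤ 1) (hreg : Regular η z e m)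
    (hm : n * (1 + δ) ≤ 2 * z * m) (he : 12 * e + 2 < δ * z * m)
    (hv : IsOdo ∞ (Finset.Icc (-m : ℤ) m : Finset ℤ) ρ (holes n η) v)
    (hnet : |((∑ x ∈ Finset.Icc (-m : ℤ) m, net ρ x (v x) : ℤ) : ℝ)| ≤ e * m) :
    v m = 0 ∧ v (-m) = 0 := by
  refine ⟨hv.no_exit_right hη hz hδ hδ1 hreg hm he hnet, ?_⟩
  have hv' := hv.mirror
  have e1 : (fun x => holes n η (-x)) = holes n fun x => η (-x) := by
    funext x; simp [holes, single]
  rw [e1] at hv'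
  refine hv'.no_exit_right (fun x => hη _) hz hδ hδ1 hreg.mirror hm he ?_
  have e2 : ∑ x ∈ Finset.Icc (-m : ℤ) m, net (ARW.mirror ρ) x (v (-x))
      = -∑ x ∈ Finset.Icc (-m : ℤ) m, net ρ x (v x) := by
    rw [← Finset.sum_neg_distrib]
    refine Finset.sum_nbij' (fun x => -x) (fun x => -x) ?_ ?_ ?_ ?_ ?_
    · intro x hx; rw [Finset.mem_Icc] at *; omega
    · intro x hx; rw [Finset.mem_Icc] at *; omega
    · intro x _; ring
    · intro x _; ring
    · intro x _; rw [net_mirror]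
  rw [e2]
  push_cast
  rw [abs_neg]
  exact_mod_cast hnet

/-! ### A typical environment -/

theorem measurable_rights (x : ℤ) (k : ℕ) : Measurable fun ρ : Stacks => rights ρ x k :=
  Finset.measurable_fun_sum _ fun j _ =>
    (measurable_from_top (f := Instr.toRight)).comp (measurable_pi_apply (x, j))

theorem measurable_lefts (x : ℤ) (k : ℕ) : Measurable fun ρ : Stacks => lefts ρ x k :=
  Finset.measurable_fun_sum _ fun j _ =>
    (measurable_from_top (f := Instr.toLeft)).comp (measurable_pi_apply (x, j))

theorem measurable_cnt (u : ℤ → ℕ) (x : ℤ) :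
    Measurable fun p : Stacks × (ℤ → ℕ) => cnt p.2 p.1 u x := by
  have h1 : Measurable fun p : Stacks × (ℤ → ℕ) => p.2 x :=
    (measurable_pi_apply x).comp measurable_snd
  have hr : ∀ y k, Measurable fun p : Stacks × (ℤ → ℕ) => rights p.1 y k :=
    fun y k => (measurable_rights y k).comp measurable_fst
  have hl : ∀ y k, Measurable fun p : Stacks × (ℤ → ℕ) => lefts p.1 y k :=
    fun y k => (measurable_lefts y k).comp measurable_fst
  have hc : Measurable fun k : ℕ => (k : ℤ) := measurable_from_top
  unfold cnt
  exact ((((hc.comp h1).add (hc.comp (hr _ _))).add (hc.comp (hl _ _))).sub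
    (hc.comp (hr _ _))).sub (hc.comp (hl _ _))

/-- Joint measurability in stacks and environment is needed to apply Fubini's theorem and freeze the
environment. -/
theorem measurableSet_legal (lam : ℝ≥0∞) (D : Set ℤ) (α : List ℤ) :
    MeasurableSet {p : Stacks × (ℤ → ℕ) | Legal lam D p.1 (State.init (act p.2)) α} := by
  induction α using List.reverseRecOn with
  | nil => exact MeasurableSet.univ
  | append_singleton α x ih =>
    simp only [legal_snoc_iff]
    refine ih.inter ((MeasurableSet.const _).inter (MeasurableSet.compl ?_))
    refine ((measurable_cnt _ x) (MeasurableSet.of_discrete (s := {c : ℤ | c ≤ 0}))).union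
      (((measurable_cnt _ x) (MeasurableSet.of_discrete (s := {c : ℤ | c ≤ 1}))).inter
      ((MeasurableSet.const _).union ((MeasurableSet.const _).inter ?_)))
    have hs : MeasurableSet ({.sleep} : Set Instr) := trivial
    have hf : Measurable fun p : Stacks × (ℤ → ℕ) => p.1 (x, odo α x - 1) :=
      (measurable_pi_apply (x, odo α x - 1)).comp measurable_fst
    exact hf hs

theorem measurableSet_lt_odometer (lam : ℝ≥0∞) (x : ℤ) (N : ℕ) :
    MeasurableSet {p : Stacks × (ℤ → ℕ) | (N : ℕ∞) < odometer lam p.1 (act p.2) x} := by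
  have : {p : Stacks × (ℤ → ℕ) | (N : ℕ∞) < odometer lam p.1 (act p.2) x}
      = ⋃ α : List ℤ, {p | Legal lam Set.univ p.1 (State.init (act p.2)) α ∧
        (N : ℕ∞) < (α.count x : ℕ∞)} := by
    ext p
    simp only [odometer, Set.mem_ofPred_eq, lt_iSup_iff, Set.mem_iUnion, exists_prop]
  rw [this]
  exact MeasurableSet.iUnion fun α => (measurableSet_legal lam _ α).inter (MeasurableSet.const _)

theorem measurePreserving_translate_occupation (z : unitInterval) (y : ℤ) :
    MeasurePreserving (fun (η : ℤ → ℕ) x => η (x + y)) (bernoulliLaw z) (bernoulliLaw z) := by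
  refine ⟨measurable_pi_iff.2 fun x => measurable_pi_apply (x + y), ?_⟩
  exact Measure.map_infinitePi_infinitePi_of_inj (P := fun _ : ℤ => bernoulliMeasure 1 0 z)
    (add_left_injective y)

instance (z : unitInterval) : IsProbabilityMeasure (bernoulliLaw z) := by
  unfold bernoulliLaw; infer_instance

/-- Markov's inequality for the cube of the odometer, after a translation to the origin. -/
theorem lt_odometer_le (lam : ℝ≥0∞) (z : unitInterval) (x : ℤ) (N : ℕ) :
    (stackLaw lam).prod (bernoulliLaw z) {p | (N : ℕ∞) < odometer lam p.1 (act p.2) x}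
      ≤ thirdMoment lam z / ((N + 1 : ℕ) : ℝ≥0∞) ^ 3 := by
  have h0 : (stackLaw lam).prod (bernoulliLaw z) {p | (N : ℕ∞) < odometer lam p.1 (act p.2) x}
      = (stackLaw lam).prod (bernoulliLaw z) {p | (N : ℕ∞) < odometer lam p.1 (act p.2) 0} := by
    rw [← ((measurePreserving_translate lam x).prod
      (measurePreserving_translate_occupation z x)).measure_preimage
      (measurableSet_lt_odometer lam 0 N).nullMeasurableSet]
    congr 1
    ext p
    have := (intertwines_translate lam x p.1 p.2).odometer_eq x
    rw [Equiv.subRight_apply, sub_self] at this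
    simp only [Set.mem_preimage, Set.mem_ofPred_eq, Prod.map, this]
  rw [h0, ENNReal.le_div_iff_mul_le (Or.inl (by simp)) (Or.inl (by finiteness)), mul_comm,
    ← lintegral_indicator_const (measurableSet_lt_odometer lam 0 N)]
  refine lintegral_mono fun p => ?_
  by_cases hp : (N : ℕ∞) < odometer lam p.1 (act p.2) 0
  · rw [Set.indicator_of_mem (by exact hp)]
    refine pow_le_pow_left₀ zero_le ?_ 3
    have h1 : ((N + 1 : ℕ) : ℕ∞) ≤ odometer lam p.1 (act p.2) 0 := by
      push_cast
      exact Order.add_one_le_of_lt hp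
    have h2 := ENat.toENNReal_le.2 h1
    rwa [ENat.toENNReal_coe] at h2
  · rw [Set.indicator_of_notMem (by exact hp)]
    exact zero_le

/-- Sites with a large odometer in the environment `η`. -/
def busy (lam : ℝ≥0∞) (η : ℤ → ℕ) (L N : ℕ) : Set Stacks :=
  {ρ | ∃ x ∈ Finset.Icc (-L : ℤ) L, (N : ℕ∞) < odometer lam ρ (act η) x}

/-- This is where three moments are needed: at level n^(3/4) a site is busy with probability
O(n^(-9/4)), so O(n) sites cost O(n^(-5/4)), which is summable. By Fubini's theorem the sum of the
conditional probabilities is finite for almost every η. -/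
theorem ae_small_busy {lam : ℝ≥0∞} {z : unitInterval} (h : thirdMoment lam z < ∞) (C : ℕ) :
    ∀ᵐ η ∂bernoulliLaw z,
      Small lam fun n => busy lam η (C * n) ⌊(n : ℝ) ^ (3 / 4 : ℝ)⌋₊ := by
  set F : ℕ → Set (Stacks × (ℤ → ℕ)) := fun n => ⋃ x ∈ Finset.Icc (-(C * n : ℕ) : ℤ) (C * n : ℕ),
    {p | (⌊(n : ℝ) ^ (3 / 4 : ℝ)⌋₊ : ℕ∞) < odometer lam p.1 (act p.2) x} with hF
  have hFm : ∀ n, MeasurableSet (F n) := fun n =>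
    Finset.measurableSet_biUnion _ fun x _ => measurableSet_lt_odometer lam x _
  set e := (thirdMoment lam z).toReal with he
  have heq : thirdMoment lam z = ENNReal.ofReal e := (ENNReal.ofReal_toReal h.ne).symm
  have hsum : ∑' n, (stackLaw lam).prod (bernoulliLaw z) (F n) ≠ ∞ := by
    have hs : Summable fun n : ℕ => (2 * C + 1) * e * (1 / (n : ℝ) ^ (5 / 4 : ℝ)) :=
      (Real.summable_one_div_nat_rpow.2 (by norm_num)).mul_left _
    refine tsum_ne_top_of_eventually_le (fun _ => measure_ne_top _ _) ?_
      (g := fun n => ENNReal.ofReal ((2 * C + 1) * e * (1 / (n : ℝ) ^ (5 / 4 : ℝ)))) ?_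
    · filter_upwards [eventually_ge_atTop 1] with n hn
      have hn1 : (1 : ℝ) ≤ n := by exact_mod_cast hn
      have hn0 : (0 : ℝ) < n := by linarith
      refine (measure_biUnion_finset_le _ _).trans ((Finset.sum_le_card_nsmul _ _ _ fun x _ =>
        lt_odometer_le lam z x _).trans ?_)
      have hc : (Finset.Icc (-(C * n : ℕ) : ℤ) (C * n : ℕ)).card = 2 * (C * n) + 1 := by
        rw [Int.card_Icc]; omega
      rw [hc, nsmul_eq_mul, heq, ← ENNReal.ofReal_natCast, ← ENNReal.ofReal_natCast (_ + 1),
        ← ENNReal.ofReal_pow (by positivity), ← ENNReal.ofReal_div_of_pos (by positivity),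
        ← ENNReal.ofReal_mul (by positivity)]
      refine ENNReal.ofReal_le_ofReal ?_
      have h1 : (n : ℝ) ^ (9 / 4 : ℝ) ≤ ((⌊(n : ℝ) ^ (3 / 4 : ℝ)⌋₊ + 1 : ℕ) : ℝ) ^ 3 := by
        have h2 : (n : ℝ) ^ (3 / 4 : ℝ) ≤ ((⌊(n : ℝ) ^ (3 / 4 : ℝ)⌋₊ + 1 : ℕ) : ℝ) := by
          push_cast
          exact (Nat.lt_floor_add_one _).le
        refine le_trans (le_of_eq ?_) (pow_le_pow_left₀ (by positivity) h2 3)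
        rw [← Real.rpow_natCast, ← Real.rpow_mul hn0.le]
        norm_num
      have h3 : ((2 * (C * n) + 1 : ℕ) : ℝ) ≤ (2 * C + 1) * n := by push_cast; nlinarith
      have he0 : 0 ≤ e := ENNReal.toReal_nonneg
      refine (mul_le_mul h3 (div_le_div_of_nonneg_left he0 (by positivity) h1) (by positivity)
        (by positivity)).trans (le_of_eq ?_)
      have h4 : (n : ℝ) ^ (9 / 4 : ℝ) = n * (n : ℝ) ^ (5 / 4 : ℝ) := by
        rw [show (9 / 4 : ℝ) = 1 + 5 / 4 by norm_num, Real.rpow_add hn0, Real.rpow_one]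
      rw [h4]
      field_simp
    · have he0 : 0 ≤ e := ENNReal.toReal_nonneg
      rw [← ENNReal.ofReal_tsum_of_nonneg (fun n => by positivity) hs]
      exact ENNReal.ofReal_ne_top
  have hmeas : ∀ n, Measurable fun η => stackLaw lam ((fun ρ => (ρ, η)) ⁻¹' F n) :=
    fun n => measurable_measure_prodMk_right (hFm n)
  have hint : ∫⁻ η, ∑' n, stackLaw lam ((fun ρ => (ρ, η)) ⁻¹' F n) ∂bernoulliLaw z ≠ ∞ := by
    rw [lintegral_tsum fun n => (hmeas n).aemeasurable]
    simpa only [Measure.prod_apply_symm (hFm _)] using hsum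
  filter_upwards [ae_lt_top (Measurable.tsum hmeas) hint] with η hη
  refine ne_top_of_le_ne_top hη.ne (ENNReal.tsum_le_tsum fun n => measure_mono ?_)
  rintro ρ ⟨x, hx, hlt⟩
  simp only [hF, Set.mem_preimage, Set.mem_iUnion]
  exact ⟨x, hx, hlt⟩

theorem ae_occupation_le_one (z : unitInterval) : ∀ᵐ η ∂bernoulliLaw z, ∀ x, η x ≤ 1 := by
  refine ae_all_iff.2 fun x => ?_
  have hm : MeasurableSet {k : ℕ | k ≤ 1} := MeasurableSet.of_discrete
  have h := measurePreserving_eval_infinitePi (fun _ : ℤ => bernoulliMeasure (1 : ℕ) 0 z) x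
  refine h.quasiMeasurePreserving.ae (p := fun k => k ≤ 1) ?_
  rw [ae_iff, bernoulliMeasure_def]
  simp

/-- The additive constant absorbs the finitely many j before the limit takes hold. -/
theorem exists_linear_bound {f : ℕ → ℝ} {z : ℝ}
    (h : Tendsto (fun j : ℕ => f j / j) atTop (nhds z)) {κ : ℝ} (hκ : 0 < κ) :
    ∃ K : ℝ, 0 ≤ K ∧ ∀ j : ℕ, |f j - z * j| ≤ κ * j + K := by
  obtain ⟨J, hJ⟩ := Metric.tendsto_atTop.1 h κ hκ
  refine ⟨∑ i ∈ Finset.range (J + 1), |f i - z * i|, Finset.sum_nonneg fun _ _ => abs_nonneg _,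
    fun j => ?_⟩
  by_cases hj : j < J + 1
  · have h1 := Finset.single_le_sum (f := fun i : ℕ => |f i - z * i|) (fun _ _ => abs_nonneg _)
      (Finset.mem_range.2 hj)
    have : 0 ≤ κ * j := by positivity
    linarith
  · have h1 := hJ j (by omega)
    have hj0 : (0 : ℝ) < j := by
      have : 0 < j := by omega
      exact_mod_cast this
    rw [Real.dist_eq] at h1
    have h2 : f j - z * j = (f j / j - z) * j := by field_simp
    rw [h2, abs_mul, abs_of_pos hj0]
    have h3 := mul_le_mul_of_nonneg_right h1.le hj0.le
    have h4 : 0 ≤ ∑ i ∈ Finset.range (J + 1), |f i - z * i| :=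
      Finset.sum_nonneg fun _ _ => abs_nonneg _
    linarith

theorem ae_tendsto_occupation (z : unitInterval) {g : ℕ → ℤ} (hg : Function.Injective g) :
    ∀ᵐ η ∂bernoulliLaw z,
      Tendsto (fun j : ℕ => (∑ i ∈ Finset.range j, (η (g i) : ℝ)) / j) atTop (nhds z) := by
  have hm : Measurable fun k : ℕ => (k : ℝ) := measurable_from_top
  have hmX : ∀ x : ℤ, Measurable fun η : ℤ → ℕ => (η x : ℝ) :=
    fun x => hm.comp (measurable_pi_apply x)
  have hind : iIndepFun (fun (x : ℤ) (η : ℤ → ℕ) => (η x : ℝ)) (bernoulliLaw z) :=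
    iIndepFun_infinitePi (P := fun _ : ℤ => bernoulliMeasure (1 : ℕ) 0 z)
      (X := fun _ k => (k : ℝ)) fun _ => hm
  have hmap : ∀ x : ℤ, (bernoulliLaw z).map (fun η => (η x : ℝ))
      = (bernoulliMeasure (1 : ℕ) 0 z).map (fun k : ℕ => (k : ℝ)) := fun x => by
    rw [← (measurePreserving_eval_infinitePi (fun _ : ℤ => bernoulliMeasure (1 : ℕ) 0 z) x).map_eq,
      Measure.map_map hm (measurable_pi_apply x)]
    rfl
  have hint : ∫ η, (η (g 0) : ℝ) ∂bernoulliLaw z = z := by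
    have h1 := (measurePreserving_eval_infinitePi
      (fun _ : ℤ => bernoulliMeasure (1 : ℕ) 0 z) (g 0)).map_eq
    have h2 := integral_map (μ := bernoulliLaw z) (φ := fun η : ℤ → ℕ => η (g 0))
      (f := fun k : ℕ => (k : ℝ)) (measurable_pi_apply (g 0)).aemeasurable
      hm.aestronglyMeasurable
    rw [← h2]
    erw [h1]
    rw [integral_bernoulliMeasure]
    simp
  have := strong_law_ae_real (μ := bernoulliLaw z) (fun i η => (η (g i) : ℝ))
    (Integrable.of_bound (hmX _).aestronglyMeasurable 1
      ((ae_occupation_le_one z).mono fun η hη => by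
        rw [Real.norm_of_nonneg (by positivity)]; exact_mod_cast hη _))
    (fun i j hij => hind.indepFun (hg.ne hij))
    (fun i => ⟨(hmX _).aemeasurable, (hmX _).aemeasurable, by rw [hmap, hmap]⟩)
  rwa [hint] at this

/-- There are environments in which the law of large numbers holds and few sites are busy. -/
theorem exists_environment {lam : ℝ≥0∞} {z : unitInterval} (h : thirdMoment lam z < ∞) (C : ℕ) :
    ∃ η : ℤ → ℕ, (∀ x, η x ≤ 1) ∧
      (∀ κ : ℝ, 0 < κ → ∃ K : ℝ, 0 ≤ K ∧ ∀ m : ℕ, Regular η z (κ * m + K) m) ∧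
      Small lam fun n => busy lam η (C * n) ⌊(n : ℝ) ^ (3 / 4 : ℝ)⌋₊ := by
  have hr := ae_tendsto_occupation z (g := fun i => 1 + (i : ℤ)) (fun i j hij => by
    dsimp only at hij; omega)
  have hl := ae_tendsto_occupation z (g := fun i => -(1 + (i : ℤ))) (fun i j hij => by
    dsimp only at hij; omega)
  obtain ⟨η, ⟨h1, h2, h3⟩, h4⟩ := (((ae_occupation_le_one z).and (hr.and hl)).and
    (ae_small_busy h C)).exists.imp fun η h => (⟨⟨h.1.1, h.1.2⟩, h.2⟩ : (_ ∧ _ ∧ _) ∧ _)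
  refine ⟨η, h1, fun κ hκ => ?_, h4⟩
  obtain ⟨K1, hK1, b1⟩ := exists_linear_bound h2 hκ
  obtain ⟨K2, hK2, b2⟩ := exists_linear_bound h3 hκ
  refine ⟨K1 + K2, add_nonneg hK1 hK2, fun m => ⟨fun j hj => (b1 j).trans ?_, fun j hj => (b2 j).trans ?_⟩⟩
  all_goals
    have : κ * (j : ℝ) ≤ κ * m := mul_le_mul_of_nonneg_left (by exact_mod_cast hj) hκ.le
    linarith

/-! ### The outer bound -/

/-- A sequence that is legal in D for the smaller configuration is legal on ℤ for the larger one, so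
N bounds its number of firings at each site. -/
theorem exists_isOdo_of_odometer_le {lam : ℝ≥0∞} {D : Finset ℤ} {ρ : Stacks} {ξ η : ℤ → ℕ} {N : ℕ}
    (hξ : ∀ x ∈ D, ξ x ≤ η x) (hN : ∀ x ∈ D, odometer lam ρ (act η) x ≤ N) :
    ∃ w, IsOdo lam D ρ ξ w ∧ ∀ x ∈ D, w x ≤ N := by
  have hcount : ∀ α, Legal lam D ρ (State.init (act ξ)) α → ∀ x ∈ D, odo α x ≤ N := by
    intro α hα x hx
    have h1 : (α.count x : ℕ∞) ≤ odometer lam ρ (act η) x :=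
      le_iSup₂_of_le (f := fun (α : List ℤ) (_ : Legal lam Set.univ ρ _ α) => (α.count x : ℕ∞))
        α (hα.mono (Or.inr rfl) hξ fun _ _ => trivial) le_rfl
    exact_mod_cast h1.trans (hN x hx)
  obtain ⟨β, hβ, hs⟩ := exists_legal_stable (lam := lam) (D := D) (ρ := ρ)
    (S := State.init (act ξ)) (B := ∑ _x ∈ D, N) fun β hβ => by
      rw [length_eq_sum_odo (F := D) fun x hx => by exact_mod_cast hβ.mem x hx]
      exact Finset.sum_le_sum fun x hx => hcount β hβ x hx
  exact ⟨odo β, ⟨β, ⟨hβ, hs⟩, rfl⟩, hcount β hβ⟩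

/-- In the first moment on the k sites beyond m, an arrival from m counts for 1 and an exit costs k
+ 1. With at most N arrivals and little imbalance, not even one exit can be paid for. -/
theorem IsOdo.no_escape_right {lam : ℝ≥0∞} {ρ : Stacks} {ξ w : ℤ → ℕ} {m k N : ℕ}
    (hw : IsOdo lam (Finset.Icc (-(m + k : ℕ) : ℤ) (m + k : ℕ) : Finset ℤ) ρ ξ w)
    (hξ : ∀ x : ℤ, m < x → ξ x = 0) (hN : w m ≤ N)
    (hnet : |∑ x ∈ Finset.Icc (m + 1 : ℤ) (m + k : ℕ), net ρ x (w x)| + N < k + 1) :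
    rights ρ (m + k : ℕ) (w (m + k : ℕ)) = 0 := by
  have h := sum_pos_cnt ξ ρ w (m + 1) k
  have e1 : (m + 1 : ℤ) + k - 1 = (m + k : ℕ) := by push_cast; ring
  have e2 : ∑ x ∈ Finset.Icc (m + 1 : ℤ) (m + k : ℕ), net ρ x (w x)
      = ∑ i ∈ Finset.range k, net ρ (m + 1 + i) (w (m + 1 + i)) := by
    rw [← sum_Icc_eq_sum_range (fun x => net ρ x (w x)), e1]
  have e3 : w (m + 1 + k) = 0 := hw.stab.off _ (by rw [Finset.mem_coe, Finset.mem_Icc]; omega)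
  have e4 : ∑ i ∈ Finset.range k, ((i : ℤ) + 1) * (ξ (m + 1 + i) : ℤ) = 0 :=
    Finset.sum_eq_zero fun i _ => by rw [hξ _ (by omega)]; simp
  have e5 : 0 ≤ ∑ i ∈ Finset.range k, ((i : ℤ) + 1) * cnt ξ ρ w (m + 1 + i) :=
    Finset.sum_nonneg fun i hi => mul_nonneg (by positivity) (hw.cnt_nonneg (by
      rw [Finset.mem_range] at hi
      rw [Finset.mem_coe, Finset.mem_Icc]; omega))
  rw [e1, e3, e4, ← e2, add_sub_cancel_right, lefts_zero] at h
  have h1 := rights_le ρ m (w m)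
  have h2 := le_abs_self (∑ x ∈ Finset.Icc (m + 1 : ℤ) (m + k : ℕ), net ρ x (w x))
  by_contra hc
  have h3 : (1 : ℤ) ≤ rights ρ (m + k : ℕ) (w (m + k : ℕ)) := by
    have := Nat.pos_of_ne_zero hc
    exact_mod_cast this
  have h4 : ((k : ℤ) + 1) * 1 ≤ (k + 1) * rights ρ (m + k : ℕ) (w (m + k : ℕ)) :=
    mul_le_mul_of_nonneg_left h3 (by positivity)
  have h5 : (rights ρ m (w m) : ℤ) ≤ N := by exact_mod_cast h1.trans hN
  simp only [Nat.cast_zero, mul_zero, add_zero, zero_add] at h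
  linarith

theorem IsOdo.no_escape_left {lam : ℝ≥0∞} {ρ : Stacks} {ξ w : ℤ → ℕ} {m k N : ℕ}
    (hw : IsOdo lam (Finset.Icc (-(m + k : ℕ) : ℤ) (m + k : ℕ) : Finset ℤ) ρ ξ w)
    (hξ : ∀ x : ℤ, x < -m → ξ x = 0) (hN : w (-m) ≤ N)
    (hnet : |∑ x ∈ Finset.Icc (-(m + k : ℕ) : ℤ) (-(m + 1)), net ρ x (w x)| + N < k + 1) :
    lefts ρ (-(m + k : ℕ)) (w (-(m + k : ℕ))) = 0 := by
  have h := hw.mirror.no_escape_right (fun x hx => hξ _ (by omega)) hN ?_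
  · rwa [rights_mirror] at h
  · have e : ∑ x ∈ Finset.Icc (m + 1 : ℤ) (m + k : ℕ), net (ARW.mirror ρ) x (w (-x))
        = -∑ x ∈ Finset.Icc (-(m + k : ℕ) : ℤ) (-(m + 1)), net ρ x (w x) := by
      rw [← Finset.sum_neg_distrib]
      refine Finset.sum_nbij' (fun x => -x) (fun x => -x) ?_ ?_ ?_ ?_ ?_
      · intro x hx; rw [Finset.mem_Icc] at *; omega
      · intro x hx; rw [Finset.mem_Icc] at *; omega
      · intro x _; ring
      · intro x _; ring
      · intro x _; rw [net_mirror]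
    rw [e, abs_neg]
    exact hnet

/-- The particles of the configuration `c` on `[-m, m]` that are not used to fill the holes
of `η`. -/
def surplus (η : ℤ → ℕ) (m : ℕ) (c : ℤ → ℕ) : ℤ → ℕ := fun x =>
  if x ∈ Finset.Icc (-m : ℤ) m then c x - (1 - η x) else 0

/-- Removing the virtual particles leaves exactly the pile after using v. The truncated subtraction
is exact because a hole, occupied at the start, stays occupied; and since ±m do not fire, nothing
lies outside. -/
theorem IsOdo.surplus_eq {ρ : Stacks} {η v : ℤ → ℕ} {n m : ℕ} (hη : ∀ x, η x ≤ 1)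
    (hv : IsOdo ∞ (Finset.Icc (-m : ℤ) m : Finset ℤ) ρ (holes n η) v) (hr : v m = 0)
    (hl : v (-m) = 0) (x : ℤ) :
    (surplus η m (settle (Finset.Icc (-m : ℤ) m : Finset ℤ) ρ (holes n η) v) x : ℤ)
      = cnt (single 0 n) ρ v x := by
  have h1 : cnt (holes n η) ρ v x = cnt (single 0 n) ρ v x + (1 - η x : ℕ) := by
    unfold cnt holes
    push_cast
    ring
  have h2 := hη x
  by_cases hx : x ∈ Finset.Icc (-m : ℤ) m
  · have h3 : 0 ≤ cnt (holes n η) ρ v x := hv.cnt_nonneg (by exact_mod_cast hx)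
    have h4 : η x = 0 → 1 ≤ cnt (holes n η) ρ v x := fun h =>
      hv.one_le_cnt x (Or.inr (by simp [holes, h]))
    simp only [surplus, settle, hx, if_true, Finset.mem_coe]
    omega
  · simp only [surplus, hx, if_false]
    have hoff : ∀ y : ℤ, y < -m + 1 ∨ m - 1 < y → v y = 0 := by
      intro y hy
      by_cases h : y ∈ Finset.Icc (-m : ℤ) m
      · rw [Finset.mem_Icc] at h
        rcases hy with hy | hy
        · rw [show y = -m by omega]; exact hl
        · rw [show y = m by omega]; exact hr
      · exact hv.stab.off y (by exact_mod_cast h)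
    rw [Finset.mem_Icc] at hx
    have e0 : single 0 n x = 0 := if_neg (by omega)
    unfold cnt
    rw [hoff x (by omega), hoff (x - 1) (by omega), hoff (x + 1) (by omega), e0]
    simp [rights_zero, lefts_zero]

/-- At most one particle per site remains, and at a hole it is accounted for by the virtual one. -/
theorem IsOdo.surplus_le {ρ : Stacks} {η v : ℤ → ℕ} {n m : ℕ} (hη : ∀ x, η x ≤ 1)
    (hv : IsOdo ∞ (Finset.Icc (-m : ℤ) m : Finset ℤ) ρ (holes n η) v) (x : ℤ) :
    surplus η m (settle (Finset.Icc (-m : ℤ) m : Finset ℤ) ρ (holes n η) v) x ≤ η x := by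
  have h2 := hη x
  by_cases hx : x ∈ Finset.Icc (-m : ℤ) m
  · have h3 : cnt (holes n η) ρ v x ≤ 1 := hv.cnt_le_one (by exact_mod_cast hx)
    simp only [surplus, settle, hx, if_true, Finset.mem_coe]
    omega
  · simp only [surplus, hx, if_false]
    omega

/-- The two stages, Internal DLA and then the stabilization of the surplus, stabilize the pile. -/
theorem IsOdo.stab_add {lam : ℝ≥0∞} {ρ : Stacks} {η v w : ℤ → ℕ} {n m M : ℕ} (hη : ∀ x, η x ≤ 1)
    (hv : IsOdo ∞ (Finset.Icc (-m : ℤ) m : Finset ℤ) ρ (holes n η) v) (hr : v m = 0)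
    (hl : v (-m) = 0) (hmM : m ≤ M)
    (hw : IsOdo lam (Finset.Icc (-M : ℤ) M : Finset ℤ) (shiftBy v ρ)
      (surplus η m (settle (Finset.Icc (-m : ℤ) m : Finset ℤ) ρ (holes n η) v)) w)
    (hwr : rights (shiftBy v ρ) M (w M) = 0) (hwl : lefts (shiftBy v ρ) (-M) (w (-M)) = 0) :
    Stab lam Set.univ ρ (single 0 n) (v + w) := by
  refine ⟨fun x hx => absurd trivial hx, fun x _ => ?_⟩
  -- The firings v may rely on virtual particles and be illegal for the pile; only stability of the
  -- final counts matters. The surplus equals the counts left by v, so the first two terms cancel.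
  have hc := cnt_add (single 0 n)
    (surplus η m (settle (Finset.Icc (-m : ℤ) m : Finset ℤ) ρ (holes n η) v)) ρ v w x
  rw [hv.surplus_eq hη hr hl, sub_self, zero_add] at hc
  rw [hc]
  by_cases hx : x ∈ Finset.Icc (-M : ℤ) M
  · exact (hw.stab.stable x (by exact_mod_cast hx)).unshift
  · left
    have hx' := hx
    rw [Finset.mem_Icc] at hx'
    have h1 : rights (shiftBy v ρ) (x - 1) (w (x - 1)) = 0 := by
      by_cases h : x - 1 = M
      · rw [h]; exact hwr
      · rw [hw.stab.off _ (by rw [Finset.mem_coe, Finset.mem_Icc]; omega), rights_zero]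
    have h2 : lefts (shiftBy v ρ) (x + 1) (w (x + 1)) = 0 := by
      by_cases h : x + 1 = -M
      · rw [h]; exact hwl
      · rw [hw.stab.off _ (by rw [Finset.mem_coe, Finset.mem_Icc]; omega), lefts_zero]
    have h3 : surplus η m (settle (Finset.Icc (-m : ℤ) m : Finset ℤ) ρ (holes n η) v) x = 0 := by
      refine if_neg fun h => hx ?_
      rw [Finset.mem_Icc] at *
      omega
    unfold cnt
    rw [hw.stab.off x (by exact_mod_cast hx), h1, h2, h3]
    simp [rights_zero, lefts_zero]

theorem eventually_exp_rpow_le {c : ℝ} (hc : 0 < c) :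
    ∀ᶠ n : ℕ in atTop, Real.exp (-(c * (n : ℝ) ^ (1 / 4 : ℝ))) ≤ 1 / (n : ℝ) ^ 2 := by
  have h0 : Tendsto (fun n : ℕ => c * (n : ℝ) ^ (1 / 4 : ℝ)) atTop atTop :=
    ((tendsto_rpow_atTop (by norm_num)).comp tendsto_natCast_atTop_atTop).const_mul_atTop hc
  have h1 := ((Real.tendsto_pow_mul_exp_neg_atTop_nhds_zero 8).comp h0).const_mul (1 / c ^ 8)
  rw [mul_zero] at h1
  filter_upwards [h1.eventually (eventually_le_nhds (b := 1) zero_lt_one), eventually_gt_atTop 0]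
    with n hn hpos
  have hn0 : (0 : ℝ) < n := by exact_mod_cast hpos
  rw [le_div_iff₀ (by positivity)]
  refine le_trans (le_of_eq ?_) hn
  have h2 : ((n : ℝ) ^ (1 / 4 : ℝ)) ^ 8 = (n : ℝ) ^ 2 := by
    rw [← Real.rpow_natCast, ← Real.rpow_mul hn0.le, ← Real.rpow_natCast]
    norm_num
  simp only [Function.comp]
  rw [mul_pow, h2]
  field_simp

/-- The pile stays near the origin, at the scale given by the outer density. -/
theorem wide_small {lam : ℝ≥0∞} {z : unitInterval} (hz : 0 < (z : ℝ)) (h : thirdMoment lam z < ∞)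
    {δ : ℝ} (hδ : 0 < δ) (hδ1 : δ ≤ 1) :
    Small lam fun n => {ρ | ¬ ∃ u, IsOdo lam Set.univ ρ (single 0 n) u ∧
      ∀ x : ℤ, (n : ℝ) / (2 * z) * (1 + 4 * δ) < |(x : ℝ)| → u x = 0} := by
  have hz1 : (z : ℝ) ≤ 1 := z.2.2
  obtain ⟨C, hC⟩ := exists_nat_ge (2 / (z : ℝ) + 4)
  have hzinv : 0 < 1 / (z : ℝ) := by positivity
  obtain ⟨η, hη, hreg, hbusy⟩ := exists_environment h C
  -- With e = κm + K, the hypothesis 12e + 2 < δzm of `IsOdo.no_exit` becomes 12K + 2 < 36κm, true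
  -- for large n.
  set κ := δ * z / 48 with hκ
  have hκ0 : 0 < κ := by positivity
  obtain ⟨K, hK0, hK⟩ := hreg κ hκ0
  obtain ⟨C1, hC1, hlong⟩ := long_small lam C
  -- Half-width of the Internal DLA stage; below, k is the extra margin for the second stage and N
  -- the odometer level allowed there.
  set m : ℕ → ℕ := fun n => ⌈n * (1 + δ) / (2 * z)⌉₊ with hm
  set k : ℕ → ℕ := fun n => ⌈δ * n⌉₊ with hk
  set N : ℕ → ℕ := fun n => ⌊(n : ℝ) ^ (3 / 4 : ℝ)⌋₊ with hN
  have hm1 : ∀ n, n * (1 + δ) / (2 * z) ≤ m n := fun n => Nat.le_ceil _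
  have hm2 : ∀ n, (m n : ℝ) ≤ n * (1 + δ) / (2 * z) + 1 := fun n =>
    (Nat.ceil_lt_add_one (by positivity)).le
  have hk1 : ∀ n, δ * n ≤ k n := fun n => Nat.le_ceil _
  have hk2 : ∀ n, (k n : ℝ) ≤ δ * n + 1 := fun n => (Nat.ceil_lt_add_one (by positivity)).le
  have hm3 : ∀ n : ℕ, (m n : ℝ) ≤ n * (1 / z) + 1 := fun n => by
    refine (hm2 n).trans ?_
    have : (n : ℝ) * (1 + δ) / (2 * z) = n * (1 / z) * ((1 + δ) / 2) := by field_simp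
    rw [this]
    have : (n : ℝ) * (1 / z) * ((1 + δ) / 2) ≤ n * (1 / z) * 1 :=
      mul_le_mul_of_nonneg_left (by linarith) (by positivity)
    linarith
  have hCn : ∀ n : ℕ, ((2 * (1 / z) + 4 : ℝ)) * n ≤ C * n := fun n =>
    mul_le_mul_of_nonneg_right (by rw [mul_one_div]; exact hC) (by positivity)
  set D : ℕ → Finset ℤ := fun n => Finset.Icc (-m n : ℤ) (m n) with hD
  set D' : ℕ → Finset ℤ := fun n => Finset.Icc (-(m n + k n : ℕ) : ℤ) (m n + k n : ℕ) with hD'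
  set AR : ℕ → Finset ℤ := fun n => Finset.Icc (m n + 1 : ℤ) (m n + k n : ℕ) with hAR
  set AL : ℕ → Finset ℤ := fun n => Finset.Icc (-(m n + k n : ℕ) : ℤ) (-(m n + 1)) with hAL
  have s1 := hlong ∞ m (fun n => holes n η) (by
    filter_upwards [eventually_ge_atTop 1] with n hn
    have hn1 : (1 : ℝ) ≤ n := by exact_mod_cast hn
    have h1 := hCn n
    have h2 := hm3 n
    have h3 : (0 : ℝ) ≤ n * (1 / z) := by positivity
    constructor
    · have : (m n : ℝ) ≤ C * n := by linarith
      exact_mod_cast this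
    · have h4 : ∑ x ∈ Finset.Icc (-m n : ℤ) (m n), holes n η x ≤ n + (2 * m n + 1) := by
        unfold holes
        rw [Finset.sum_add_distrib]
        refine add_le_add ?_ ?_
        · rw [Finset.sum_eq_single_of_mem 0 (by rw [Finset.mem_Icc]; omega)
            (fun x _ hx => by simp [single, hx])]
          simp [single]
        · refine (Finset.sum_le_card_nsmul _ _ 1 fun x _ => Nat.sub_le _ _).trans ?_
          rw [Int.card_Icc, smul_eq_mul]
          omega
      have h5 : ((n + (2 * m n + 1) : ℕ) : ℝ) ≤ C * n := by push_cast; linarith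
      exact h4.trans (by exact_mod_cast h5))
  have s2 := unbalanced_small lam ∞ hC1 C (c := κ / 4) (by positivity) D (fun n => holes n η)
    (fun n _ => D n)
  have s3 : Small lam fun n => {ρ | ∃ v, IsOdo ∞ (D n) ρ (holes n η) v ∧
      ∑ x ∈ D n, v x < C1 * n ^ 3 ∧ shiftBy v ρ ∈ busy lam η (C * n) (N n)} :=
    ne_top_of_le_ne_top hbusy (ENNReal.tsum_le_tsum fun n =>
      fresh_after_top (B := fun _ => busy lam η (C * n) (N n)) (fun _ => le_rfl) (C1 * n ^ 3))
  -- The second stage is badly unbalanced on A although it makes few firings there. The Gaussian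
  -- exponent is k/(8n^(3/4)) ≥ (δ/8)n^(1/4), enough for summability.
  set U : (ℕ → Finset ℤ) → ℕ → (ℤ → ℕ) → Set Stacks := fun A n c =>
    {ρ | ∃ w, IsOdo lam (D' n) ρ (surplus η (m n) c) w ∧
      ∑ x ∈ D' n, w x < (∑ _x ∈ D' n, N n) + 1 ∧
      (k n / 2 : ℝ) ≤ |((∑ x ∈ A n, net ρ x (w x) : ℤ) : ℝ)| ∧
      ((∑ x ∈ A n, w x : ℕ) : ℝ) ≤ k n * (n : ℝ) ^ (3 / 4 : ℝ)} with hU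
  have s4 : ∀ A : ℕ → Finset ℤ, Small lam fun n => {ρ | ∃ v, IsOdo ∞ (D n) ρ (holes n η) v ∧
      ∑ x ∈ D n, v x < C1 * n ^ 3 ∧ shiftBy v ρ ∈ U A n (settle (D n) ρ (holes n η) v)} := by
    intro A
    refine Small.of_le (K := 2) ?_
    filter_upwards [eventually_ge_atTop 1, eventually_exp_rpow_le (c := δ / 8) (by positivity)]
      with n hn hexp
    have hn0 : (0 : ℝ) < n := by
      have : 0 < n := hn
      exact_mod_cast this
    have hkpos : (0 : ℝ) < k n := lt_of_lt_of_le (by positivity) (hk1 n)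
    refine fresh_after_top (fun c => (net_bound lam lam (D' n) (A n) _ _ (by positivity)
      (by positivity)).trans ?_) (C1 * n ^ 3)
    rw [← ENNReal.ofReal_ofNat, ← ENNReal.ofReal_mul (by norm_num)]
    refine ENNReal.ofReal_le_ofReal ?_
    refine (mul_le_mul_of_nonneg_left (le_trans (Real.exp_le_exp.2 ?_) hexp)
      (by norm_num)).trans (le_of_eq (mul_one_div _ _))
    have e1 : (n : ℝ) = (n : ℝ) ^ (3 / 4 : ℝ) * (n : ℝ) ^ (1 / 4 : ℝ) := by
      rw [← Real.rpow_add hn0]; norm_num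
    have e2 : -((k n : ℝ) / 2) ^ 2 / (2 * (k n * (n : ℝ) ^ (3 / 4 : ℝ)))
        = -(k n / (8 * (n : ℝ) ^ (3 / 4 : ℝ))) := by
      field_simp
      ring
    rw [e2, neg_le_neg_iff, le_div_iff₀ (by positivity)]
    calc δ / 8 * (n : ℝ) ^ (1 / 4 : ℝ) * (8 * (n : ℝ) ^ (3 / 4 : ℝ))
        = δ * ((n : ℝ) ^ (3 / 4 : ℝ) * (n : ℝ) ^ (1 / 4 : ℝ)) := by ring
      _ = δ * n := by rw [← e1]
      _ ≤ k n := hk1 n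
  have hbig : ∀ᶠ n : ℕ in atTop, 2 * (n : ℝ) ^ (3 / 4 : ℝ) ≤ δ * n := by
    have h0 : Tendsto (fun n : ℕ => δ * (n : ℝ) ^ (1 / 4 : ℝ)) atTop atTop :=
      ((tendsto_rpow_atTop (by norm_num)).comp tendsto_natCast_atTop_atTop).const_mul_atTop hδ
    filter_upwards [h0.eventually_ge_atTop 2, eventually_gt_atTop 0] with n hn hpos
    have hn0 : (0 : ℝ) < n := by exact_mod_cast hpos
    have e1 : (n : ℝ) = (n : ℝ) ^ (3 / 4 : ℝ) * (n : ℝ) ^ (1 / 4 : ℝ) := by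
      rw [← Real.rpow_add hn0]; norm_num
    calc 2 * (n : ℝ) ^ (3 / 4 : ℝ) ≤ δ * (n : ℝ) ^ (1 / 4 : ℝ) * (n : ℝ) ^ (3 / 4 : ℝ) :=
          mul_le_mul_of_nonneg_right hn (by positivity)
      _ = δ * ((n : ℝ) ^ (3 / 4 : ℝ) * (n : ℝ) ^ (1 / 4 : ℝ)) := by ring
      _ = δ * n := by rw [← e1]
  obtain ⟨n0, hn0⟩ := exists_nat_ge ((12 * K + 3) / (18 * κ) + 4 / δ)
  refine (((s1.union s2).union s3).union ((s4 AR).union (s4 AL))).mono ?_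
  filter_upwards [hbig, eventually_ge_atTop 1, eventually_ge_atTop n0] with n hbign hn hnn0 ρ hρ
  by_contra hcon
  simp only [Set.mem_union, not_or] at hcon
  obtain ⟨⟨⟨g1, g2⟩, g3⟩, g4, g5⟩ := hcon
  apply hρ
  have hn1 : (1 : ℝ) ≤ n := by exact_mod_cast hn
  have hnn0' : (12 * K + 3) / (18 * κ) + 4 / δ ≤ n := hn0.trans (by exact_mod_cast hnn0)
  have hnK : 12 * K + 3 ≤ 18 * κ * n := by
    have : (12 * K + 3) / (18 * κ) ≤ n := by
      have : 0 < 4 / δ := by positivity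
      linarith
    rwa [div_le_iff₀' (by positivity)] at this
  have hnδ : 4 ≤ δ * n := by
    have : 4 / δ ≤ n := by
      have : 0 ≤ (12 * K + 3) / (18 * κ) := by positivity
      linarith
    rwa [div_le_iff₀' hδ] at this
  have hmn : (n : ℝ) / 2 ≤ m n := by
    refine le_trans ?_ (hm1 n)
    rw [div_le_div_iff₀ (by norm_num) (by positivity)]
    nlinarith
  obtain ⟨v, hv, hvt⟩ := not_not.1 g1
  have hnet : |((∑ x ∈ Finset.Icc (-m n : ℤ) (m n), net ρ x (v x) : ℤ) : ℝ)|
      ≤ (κ * m n + K) * m n := by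
    by_contra hbad
    refine g2 ⟨v, hv, hvt, 0, ?_, Finset.Subset.refl _, lt_of_le_of_lt ?_ (not_le.1 hbad)⟩
    · have h1 := hCn n
      have h2 : (0 : ℝ) ≤ n * (1 / z) := by positivity
      have : (0 : ℝ) < (C * n : ℕ) := by push_cast; linarith
      exact_mod_cast this
    · have h1 : ((n : ℝ) / 2) ^ 2 ≤ (m n : ℝ) ^ 2 := pow_le_pow_left₀ (by positivity) hmn 2
      have h2 := mul_le_mul_of_nonneg_left h1 hκ0.le
      have h3 : 0 ≤ K * m n := by positivity
      linarith
  obtain ⟨hvr, hvl⟩ := hv.no_exit hη hz hδ hδ1 (hK (m n)) (by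
      have := hm1 n
      rw [div_le_iff₀ (by positivity)] at this
      linarith) (by
      have h1 : δ * z * (m n : ℝ) = 48 * κ * m n := by rw [hκ]; ring
      have h2 := mul_le_mul_of_nonneg_left hmn hκ0.le
      rw [h1]
      linarith) hnet
  have hsmall : (m n + k n : ℕ) ≤ C * n := by
    have h1 := hCn n
    have h2 := hm3 n
    have h3 := hk2 n
    have h4 : (0 : ℝ) ≤ n * (1 / z) := by positivity
    have h5 : δ * n ≤ 1 * n := mul_le_mul_of_nonneg_right hδ1 (by positivity)
    have : ((m n + k n : ℕ) : ℝ) ≤ C * n := by push_cast; linarith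
    exact_mod_cast this
  have hodo : ∀ x ∈ D' n, odometer lam (shiftBy v ρ) (act η) x ≤ N n := by
    intro x hx
    by_contra hbad
    refine g3 ⟨v, hv, hvt, x, ?_, not_le.1 hbad⟩
    simp only [hD', Finset.mem_Icc] at hx
    rw [Finset.mem_Icc]
    omega
  obtain ⟨w, hw, hwN⟩ := exists_isOdo_of_odometer_le
    (fun x _ => hv.surplus_le hη x) hodo
  have hNk : (N n : ℝ) ≤ k n / 2 := by
    have h1 : (N n : ℝ) ≤ (n : ℝ) ^ (3 / 4 : ℝ) := Nat.floor_le (by positivity)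
    have h2 := hk1 n
    linarith
  have hwtot : ∑ x ∈ D' n, w x < (∑ _x ∈ D' n, N n) + 1 :=
    Nat.lt_succ_of_le (Finset.sum_le_sum hwN)
  have hA : ∀ A : Finset ℤ, A ⊆ D' n → A.card = k n →
      ((∑ x ∈ A, w x : ℕ) : ℝ) ≤ k n * (n : ℝ) ^ (3 / 4 : ℝ) := by
    intro A hA hc
    have h1 : ∑ x ∈ A, w x ≤ k n * N n := by
      refine (Finset.sum_le_card_nsmul A w (N n) fun x hx => hwN x (hA hx)).trans ?_
      rw [hc, smul_eq_mul]
    have h2 : (N n : ℝ) ≤ (n : ℝ) ^ (3 / 4 : ℝ) := Nat.floor_le (by positivity)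
    have h3 : ((∑ x ∈ A, w x : ℕ) : ℝ) ≤ k n * N n := by exact_mod_cast h1
    exact h3.trans (mul_le_mul_of_nonneg_left h2 (by positivity))
  have hexit : ∀ s : ℤ, |(s : ℝ)| < k n / 2 → |s| + N n < k n + 1 := by
    intro s hs
    have : |(s : ℝ)| + N n < k n + 1 := by linarith
    exact_mod_cast this
  have hwr : rights (shiftBy v ρ) (m n + k n : ℕ) (w (m n + k n : ℕ)) = 0 := by
    refine hw.no_escape_right (fun x hx => if_neg ?_) (hwN _ ?_) (hexit _ ?_)
    · rw [Finset.mem_Icc]; omega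
    · rw [Finset.mem_Icc]; omega
    · by_contra hbad
      refine g4 ⟨v, hv, hvt, w, hw, hwtot, not_lt.1 hbad, hA _ ?_ ?_⟩
      · exact Finset.Icc_subset_Icc (by omega) le_rfl
      · simp only [hAR, Int.card_Icc]; omega
  have hwl : lefts (shiftBy v ρ) (-(m n + k n : ℕ)) (w (-(m n + k n : ℕ))) = 0 := by
    refine hw.no_escape_left (fun x hx => if_neg ?_) (hwN _ ?_) (hexit _ ?_)
    · rw [Finset.mem_Icc]; omega
    · rw [Finset.mem_Icc]; omega
    · by_contra hbad
      refine g5 ⟨v, hv, hvt, w, hw, hwtot, not_lt.1 hbad, hA _ ?_ ?_⟩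
      · exact Finset.Icc_subset_Icc le_rfl (by omega)
      · simp only [hAL, Int.card_Icc]; omega
  have hstab := hv.stab_add hη hvr hvl (Nat.le_add_right _ _) hw hwr hwl
  have hzero : ∀ x ∉ D' n, (v + w) x = 0 := by
    intro x hx
    have h1 : v x = 0 := hv.stab.off x fun hc => hx (by
      rw [Finset.mem_coe, Finset.mem_Icc] at hc
      simp only [hD', Finset.mem_Icc]
      omega)
    have h2 : w x = 0 := hw.stab.off x (by exact_mod_cast hx)
    simp [h1, h2]
  obtain ⟨u, hu⟩ := hstab.exists_isOdo hzero
  refine ⟨u, hu, fun x hx => ?_⟩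
  have h1 := hu.le hstab x
  rw [hzero x ?_] at h1
  · omega
  · intro hc
    simp only [hD', Finset.mem_Icc] at hc
    have h2 : |x| ≤ (m n + k n : ℕ) := abs_le.2 hc
    have h3 : |(x : ℝ)| ≤ (m n : ℝ) + k n := by exact_mod_cast h2
    have h4 := hm2 n
    have h5 := hk2 n
    -- The part 3δn/(2z) ≥ 3δn/2 pays for the margin δn and two roundings, because δn ≥ 4.
    have h6 : (n : ℝ) / (2 * z) * (1 + 4 * δ)
        = n * (1 + δ) / (2 * z) + δ * n * (3 / (2 * z)) := by field_simp; ring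
    have h7 : 3 / 2 ≤ 3 / (2 * (z : ℝ)) :=
      div_le_div_of_nonneg_left (by norm_num) (by positivity) (by linarith)
    have h8 : δ * n * (3 / 2) ≤ δ * n * (3 / (2 * z)) :=
      mul_le_mul_of_nonneg_left h7 (by positivity)
    linarith

/-! ### The shape of the stabilized pile -/

theorem IsOdo.of_univ {lam : ℝ≥0∞} {D : Set ℤ} {ρ : Stacks} {η u : ℤ → ℕ}
    (h : IsOdo lam Set.univ ρ η u) (hD : ∀ x ∉ D, u x = 0) : IsOdo lam D ρ η u := by
  have hs := h.stab
  obtain ⟨α, hα, rfl⟩ := h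
  refine ⟨α, (hα.1.mono (Or.inr rfl) (fun _ _ => le_rfl) fun x hx => ?_).stabilizes
    ⟨hD, fun x _ => hs.stable x trivial⟩, rfl⟩
  by_contra hc
  exact (List.count_pos_iff.2 hx).ne' (hD x hc)

/-- The n particles are those at the origin, at most one, and the fluxes to both sides, each
controlled by the number of fired sites on its side. The origin may be counted on both sides, hence
the + 1. -/
theorem GoodRight.card_fired {lam : ℝ≥0∞} {ρ : Stacks} {n M t : ℕ} {z δ : ℝ} {u : ℤ → ℕ}
    (hg : GoodRight lam ρ n M t z δ) (hg' : GoodRight lam (mirror ρ) n M t z δ) (hz : 0 ≤ z)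
    (hδ : 0 < δ) (hδ2 : δ ≤ 1 / 2) (hn : 8 ≤ δ * n)
    (hu : IsOdo lam Set.univ ρ (single 0 n) u) (hM : ∀ x : ℤ, (M : ℤ) ≤ |x| → u x = 0) :
    (n : ℝ) ≤ z * ({x | 0 < u x}.ncard + 1) + 2 * δ * n + 1 := by
  have hu' : IsOdo lam (Finset.Icc (-M : ℤ) M : Finset ℤ) ρ (single 0 n) u :=
    hu.of_univ fun x hx => hM x (by
      rw [Finset.mem_coe, Finset.mem_Icc, ← abs_le] at hx
      omega)
  obtain ⟨Y, hY, hF⟩ := hg.density hδ hδ2 hn hu' (hM _ (le_abs_self _))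
  have hm := hu'.mirror
  rw [show (fun x => single 0 n (-x)) = single 0 n by funext x; simp [single]] at hm
  obtain ⟨Y', hY', hF'⟩ := hg'.density hδ hδ2 hn hm (hM _ (by rw [abs_neg]; exact le_abs_self _))
  have hflux : (n : ℤ) = cnt (single 0 n) ρ u 0 + flux ρ u 1
      + flux (mirror ρ) (fun x => u (-x)) 1 := by
    simp only [flux, cnt, single, rights_mirror, lefts_mirror, if_true, sub_self, neg_zero,
      zero_add, zero_sub]
    ring
  have hc : cnt (single 0 n) ρ u 0 ≤ 1 := hu.cnt_le_one trivial
  have hflux' : (n : ℝ) ≤ 1 + flux ρ u 1 + flux (mirror ρ) (fun x => u (-x)) 1 := by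
    have : (n : ℤ) ≤ 1 + flux ρ u 1 + flux (mirror ρ) (fun x => u (-x)) 1 := by omega
    exact_mod_cast this
  -- Finiteness is essential: `Set.ncard` is zero on infinite sets.
  have hfin : {x | 0 < u x}.Finite := (Finset.finite_toSet (Finset.Icc (-M : ℤ) M)).subset
    fun x hx => by
      by_contra hc
      exact hx.ne' (hu'.stab.off x hc)
  have hcard : Y + Y' ≤ {x | 0 < u x}.ncard + 1 := by
    have h1 : ((Finset.Ioo (-Y' : ℤ) Y : Finset ℤ) : Set ℤ) ⊆ {x | 0 < u x} := by
      intro x hx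
      rw [Finset.mem_coe, Finset.mem_Ioo] at hx
      rcases le_total 0 x with h | h
      · exact hY x h hx.2
      · have := hY' (-x) (by omega) (by omega)
        rwa [neg_neg] at this
    have h2 := Set.ncard_le_ncard h1 hfin
    rw [Set.ncard_coe_finset, Int.card_Ioo] at h2
    omega
  have hcard' : (Y : ℝ) + Y' ≤ {x | 0 < u x}.ncard + 1 := by exact_mod_cast hcard
  have := mul_le_mul_of_nonneg_left hcard' hz
  linarith

/-- The hypothesis 0 ≤ a excludes the empty set, whose supremum is 0 by convention. -/
theorem exists_lt_of_lt_zetaOut {lam : ℝ≥0∞} {a : ℝ} (ha : 0 ≤ a) (h : a < zetaOut lam) :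
    ∃ z : unitInterval, a < z ∧ thirdMoment lam z < ∞ := by
  have hne : {z : ℝ | ∃ h : z ∈ unitInterval,
      0 < z ∧ z < 1 ∧ thirdMoment lam ⟨z, h⟩ < ∞}.Nonempty := by
    by_contra hc
    rw [Set.not_nonempty_iff_eq_empty] at hc
    unfold zetaOut at h
    rw [hc, Real.sSup_empty] at h
    linarith
  obtain ⟨z, ⟨hz, -, -, hz3⟩, haz⟩ := exists_lt_of_lt_csSup hne h
  exact ⟨⟨z, hz⟩, haz, hz3⟩

theorem atypical_small {lam : ℝ≥0∞} (hi : 0 < zetaIn lam) (ho : 0 < zetaOut lam) {ε : ℝ}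
    (hε : 0 < ε) : Small lam fun n => {ρ | ¬ ((n : ℝ) / zetaIn lam * (1 - ε)
      ≤ ((firedSites lam ρ n).ncard : ℝ) ∧ firedSites lam ρ n ⊆
        {x : ℤ | |(x : ℝ)| ≤ (n : ℝ) / (2 * zetaOut lam) * (1 + ε)})} := by
  set a := zetaIn lam with ha
  set b := zetaOut lam with hb
  -- Leaves room for the factor (1 + δ)(1 + 4δ) in the width, and for the flux loss 2δn together
  -- with the factor 1 + δ on ζ_in in the count.
  set δ := min (ε / 9) (1 / 2) with hδdef
  have hδ : 0 < δ := lt_min (by positivity) (by norm_num)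
  have hδ2 : δ ≤ 1 / 2 := min_le_right _ _
  have hδε : 9 * δ ≤ ε := by
    have : δ ≤ ε / 9 := min_le_left _ _
    linarith
  obtain ⟨z, hbz, hz⟩ := exists_lt_of_lt_zetaOut (lam := lam) (a := b / (1 + δ)) (by positivity)
    (div_lt_self ho (by linarith))
  have hz0 : 0 < (z : ℝ) := lt_trans (by positivity) hbz
  -- The fired sites then lie strictly inside [-Cn, Cn], so stabilizing there with killing is the
  -- same as stabilizing on ℤ, and the end sites do not fire.
  obtain ⟨C, hC⟩ := exists_nat_gt (1 / (2 * (z : ℝ)) * (1 + 4 * δ))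
  have hC1 : 1 ≤ C := by
    have : (0 : ℝ) < C := lt_trans (by positivity) hC
    exact_mod_cast this
  obtain ⟨C1, hgood⟩ := goodRight_small (lam := lam) (z := a * (1 + δ)) (δ := δ)
    (by nlinarith) hδ hδ2 hC1
  obtain ⟨n0, hn0⟩ := exists_nat_ge (8 / δ + (1 + 2 * a) / (3 * δ))
  refine ((wide_small hz0 hz hδ (by linarith)).union
    (hgood.union (hgood.comp (measurePreserving_mirror lam)))).mono ?_
  filter_upwards [eventually_ge_atTop 1, eventually_ge_atTop n0] with n hn hnn0 ρ hρ
  by_contra hcon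
  simp only [Set.mem_union, not_or] at hcon
  obtain ⟨g1, g2, g3⟩ := hcon
  apply hρ
  obtain ⟨u, hu, hwide⟩ := not_not.1 g1
  have hn1 : (1 : ℝ) ≤ n := by exact_mod_cast hn
  have hnn0' : 8 / δ + (1 + 2 * a) / (3 * δ) ≤ n := hn0.trans (by exact_mod_cast hnn0)
  have hn8 : 8 ≤ δ * n := by
    have h1 : 0 ≤ (1 + 2 * a) / (3 * δ) := by positivity
    have h2 : 8 / δ ≤ n := by linarith
    rwa [div_le_iff₀' hδ] at h2
  have hna : 1 + 2 * a ≤ 3 * δ * n := by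
    have h1 : 0 ≤ 8 / δ := by positivity
    have h2 : (1 + 2 * a) / (3 * δ) ≤ n := by linarith
    rwa [div_le_iff₀' (by positivity)] at h2
  rw [firedSites_eq hu]
  refine ⟨?_, fun x hx => ?_⟩
  · have hM : ∀ x : ℤ, ((C * n : ℕ) : ℤ) ≤ |x| → u x = 0 := by
      intro x hx
      refine hwide x ?_
      have h1 : ((C * n : ℕ) : ℝ) ≤ |(x : ℝ)| := by exact_mod_cast hx
      refine lt_of_lt_of_le ?_ h1
      push_cast
      have h2 := mul_lt_mul_of_pos_right hC (show (0 : ℝ) < n by linarith)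
      refine lt_of_eq_of_lt ?_ h2
      field_simp
    have h1 := (not_not.1 g2 : GoodRight lam ρ n (C * n) (C1 * n ^ 3) _ _).card_fired
      (not_not.1 g3) (by positivity) hδ hδ2 hn8 hu hM
    set k : ℝ := ({x | 0 < u x}.ncard : ℝ) with hk
    have hk0 : 0 ≤ k := by positivity
    rw [div_mul_eq_mul_div, div_le_iff₀ hi]
    have h2 : (n : ℝ) * (1 - ε) ≤ n * (1 - 9 * δ) :=
      mul_le_mul_of_nonneg_left (by linarith) (by linarith)
    have h3 : n * (1 - 2 * δ) ≤ a * (k + 1) * (1 + δ) + 1 := by linarith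
    by_contra hcon
    have h4 : a * (k + 1) * (1 + δ) ≤ (n * (1 - 9 * δ) + a) * (1 + δ) :=
      mul_le_mul_of_nonneg_right (by linarith) (by linarith)
    have h5 : a * δ ≤ a * (1 / 2) := mul_le_mul_of_nonneg_left hδ2 hi.le
    have h6 : 0 ≤ δ * δ * n := by positivity
    linarith
  · by_contra hbad
    have h1 : n / (2 * b) * (1 + ε) < |(x : ℝ)| := not_le.1 hbad
    refine hx.ne' (hwide x (lt_of_le_of_lt ?_ h1))
    have h2 : b < z * (1 + δ) := by rwa [div_lt_iff₀ (by linarith)] at hbz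
    have h3 : (n : ℝ) / (2 * z) ≤ n / (2 * b) * (1 + δ) := by
      rw [div_mul_eq_mul_div, div_le_div_iff₀ (by positivity) (by positivity)]
      have := mul_le_mul_of_nonneg_left h2.le (show (0 : ℝ) ≤ 2 * n by positivity)
      linarith
    refine (mul_le_mul_of_nonneg_right h3 (by positivity)).trans ?_
    rw [mul_assoc]
    refine mul_le_mul_of_nonneg_left ?_ (by positivity)
    nlinarith

/-- Only an inequality, through the measurable hull, because E is not assumed to be measurable. -/
theorem measure_preimage_le_of_hasLaw {Ω S : Type*} [MeasurableSpace Ω] [MeasurableSpace S]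
    {P : Measure Ω} {μ : Measure S} {X : Ω → S} (hX : HasLaw X μ P) (E : Set S) :
    P (X ⁻¹' E) ≤ μ E := by
  rw [← measure_toMeasurable E, ← hX.map_eq,
    Measure.map_apply_of_aemeasurable hX.aemeasurable (measurableSet_toMeasurable _ _)]
  exact measure_mono (Set.preimage_mono (subset_toMeasurable _ _))

end ARW

end

theorem theorem1 {Ω : Type*} [MeasurableSpace Ω] (P : Measure Ω) [IsProbabilityMeasure P]
    (lam : ℝ≥0∞) (hlam : 0 < lam)
    (ρ : ℕ → Ω → ARW.Stacks) (hρ : ∀ n, HasLaw (ρ n) (ARW.stackLaw lam) P)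
    (hpos : 0 < min (ARW.zetaIn lam) (ARW.zetaOut lam)) :
    ∀ ε : ℝ, 0 < ε → ∀ᵐ ω ∂P, ∀ᶠ n : ℕ in atTop,
      (n : ℝ) / ARW.zetaIn lam * (1 - ε) ≤ ((ARW.firedSites lam (ρ n ω) n).ncard : ℝ) ∧
      ARW.firedSites lam (ρ n ω) n ⊆
        {x : ℤ | |(x : ℝ)| ≤ (n : ℝ) / (2 * ARW.zetaOut lam) * (1 + ε)} := by
  intro ε hε
  have hsmall := ARW.atypical_small (lt_min_iff.1 hpos).1 (lt_min_iff.1 hpos).2 hε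
  have hsum := ne_top_of_le_ne_top hsmall
    (ENNReal.tsum_le_tsum fun n => ARW.measure_preimage_le_of_hasLaw (hρ n) _)
  -- The first Borel–Cantelli lemma involves only the law of each single stack family, so the joint
  -- law over n is irrelevant.
  filter_upwards [ae_eventually_notMem hsum] with ω hω
  exact hω.mono fun n hn => not_not.1 hn
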